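/- For a commutative ring $A$, a complete intersection $A$-algebra is an $A$-algebra isomorphic to $G/(P)$, where $G$ is a smooth $A$-algebra and $P$ is a finite regular sequence in $G$ (flatness over $A$ is not required). For a finitely presented $A$-algebra $E$, let $H_{E/A}\subset E$ be the radical ideal defining the non-smooth locus of $E$ over $A$. A (not necessarily algebraic) field extension $K'/K$ is separable if every finitely generated subextension $L/K$ has a transcendence basis $s$ such that $L/K(s)$ is separable algebraic. The completion $\hat V$ of a valuation ring $V$ is its completion for the valuation topology. Let $V\subset V'$ be an extension of valuation rings (that is, an injective local homomorphism), with fraction field extension $K\subset K'$. Assume that the inclusion $V\subset V'$ is continuous for the valuation topologies (equivalently, $V$ is a field or every non-zero element of $V'$ divides in $V'$ some non-zero element of $V$), so that it induces a ring homomorphism $\hat V\to\hat V'$ of the completions. Assume that $\hat V'$ is a filtered direct limit of complete intersection $\hat V$-algebras. Then: 1. If $K'/K$ is separable, then $V'$ is a filtered direct limit of complete intersection $V$-algebras. 2. Whether or not $K'/K$ is separable, if $E$ is a finitely presented $V$-algebra and $w:E\to V'$ is a morphism of $V$-algebras such that $w(H_{E/V})V'\neq 0$, then $w$ factors through a complete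 intersection $V$-algebra, i.e. $w$ is a composite $E\to D\to V'$ of $V$-algebra morphisms with $D$ a complete intersection $V$-algebra. -/

import Mathlib

universe u v w

/-! ### Completion of a valuation ring -/

section Completion

variable (V : Type u) [CommRing V] [IsDomain V] [ValuationRing V]

/-- The valuation of a valuation ring `V`: the restriction to `V` of the canonical valuation of
its fraction field, with values in the value group of `V` (with zero adjoined). -/
noncomputable def ValRing.valuation :
    Valuation V (ValuationRing.ValueGroup V (FractionRing V)) :=
  (ValuationRing.valuation V (FractionRing V)).comap (algebraMap V (FractionRing V))

/-- The valuation topology (and uniformity) of `V`: a basis of neighbourhoods of `0` is given by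
the ideals `{x | v x < γ}`, where `γ` runs through the value group. -/
@[reducible] noncomputable def ValRing.valued :
    Valued V (ValuationRing.ValueGroup V (FractionRing V)) :=
  Valued.mk' (ValRing.valuation V)

/-- The completion of the valuation ring `V` for its valuation topology. -/
def ValRing.Completion : Type u :=
  @UniformSpace.Completion V (ValRing.valued V).toUniformSpace

noncomputable instance ValRing.Completion.instCommRing : CommRing (ValRing.Completion V) :=
  letI := ValRing.valued V
  (UniformSpace.Completion.commRing V : CommRing (UniformSpace.Completion V))

variable (V' : Type v) [CommRing V'] [IsDomain V'] [ValuationRing V'] [Algebra V V']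

/-- The map `V → V'` is continuous for the valuation topologies of `V` and of `V'`. This is what
is needed in order that it extends to a (continuous) map between the completions. -/
def ValRing.IsContinuousExtension : Prop :=
  letI := ValRing.valued V
  letI := ValRing.valued V'
  Continuous (algebraMap V V')

variable {V V'} in
/-- The continuous ring homomorphism between the completions of `V` and of `V'` that is induced by
the continuous map `V → V'`. -/
noncomputable def ValRing.completionMap (h : ValRing.IsContinuousExtension V V') :
    ValRing.Completion V →+* ValRing.Completion V' :=
  letI := ValRing.valued V
  letI := ValRing.valued V'
  UniformSpace.Completion.mapRingHom (algebraMap V V') h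

end Completion

/-! ### Separable field extensions, not necessarily algebraic -/

/-- A field extension `K'` of `K` is separable if each finitely generated subextension `L` is
separably generated, that is, `L` has a transcendence basis `s` over `K` such that `L` is a
separable algebraic extension of `K(s)`. -/
def IsSeparableFieldExtension (K : Type v) (K' : Type w) [Field K] [Field K'] [Algebra K K'] :
    Prop :=
  ∀ L : IntermediateField K K', L.FG →
    ∃ s : Set L, IsTranscendenceBasis K ((↑) : s → L) ∧
      Algebra.IsSeparable (IntermediateField.adjoin K s) L

/-! ### Complete intersection algebras and their filtered direct limits -/

/-- A complete intersection `A`-algebra (not assumed flat over `A`): an `A`-algebra of the form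
`G / (P)`, where `G` is a smooth `A`-algebra and `P` is a (finite) regular sequence in `G`. -/
def IsCompleteIntersectionAlgebra (A : Type u) (B : Type u) [CommRing A] [CommRing B]
    [Algebra A B] : Prop :=
  ∃ (G : Type u) (_ : CommRing G) (_ : Algebra A G) (P : List G),
    Algebra.Smooth A G ∧ RingTheory.Sequence.IsRegular G P ∧
      Nonempty (B ≃ₐ[A] G ⧸ Ideal.ofList P)

/-- `B` is a filtered direct limit (a colimit over a small filtered category, taken in the category
of commutative `A`-algebras) of complete intersection `A`-algebras. -/
def IsFilteredLimitOfCI (A : Type u) (B : Type u) [CommRing A] [CommRing B] [Algebra A B] : Prop :=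
  CategoryTheory.ObjectProperty.ind.{u}
    (fun C : CommAlgCat.{u} A => IsCompleteIntersectionAlgebra A C) (CommAlgCat.of A B)

/-! ### The non-smooth locus -/

/-- The ideal `H_{E/A}` of `E` defining the non-smooth locus of `E` over `A`: the radical ideal of
all elements contained in every prime of `E` at which `E` is not smooth over `A`. -/
def nonSmoothIdeal (A : Type u) (E : Type v) [CommRing A] [CommRing E] [Algebra A E] : Ideal E :=
  PrimeSpectrum.vanishingIdeal (Algebra.smoothLocus A E)ᶜ

/-! Both claims reduce to one: if $E$ is finitely presented over $V$ and smooth at the kernel of $w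
: E \to V'$, then $w$ factors through a complete intersection
(`ValRing.exists_factorization_of_isSmoothAt`). In claim 2, $w(H_{E/V})V' \neq 0$ forces smoothness
at $\ker w$. In claim 1, finitely many equations can be added to $E$ so that its local ring at the
kernel becomes the fraction field of the image, which is formally smooth over $K$ by separability
(`exists_isSmoothAt_of_isSeparableFieldExtension`); and a filtered limit of complete intersections
is recognized by the factorization of all morphisms from finitely presented algebras.

The factorization is an approximation argument. Some $E_s$ with $w(s) \neq 0$ is standard smooth,
and if $w(s)$ is a unit then $E_s$ itself will do. Otherwise, clearing denominators turns $w$ into a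
solution $x$ in $V'$ of equations $g$ whose Jacobian matrix has a right inverse up to a factor $t$,
modulo $(g)$; the relations $e$ of $E$ satisfy $te \in (g)$, and $t$ is a nonzero nonunit of $V'$
(`exists_jacobianData`). By the assumption on the completions, $g$ and $e$ have a common zero in
some complete intersection $\hat V$-algebra $G/(P)$, congruent to $x$ modulo $t^3$.

Since $V/t^3 = \hat V/t^3$, this zero can be brought back to $V$ up to multiples of $t^3$. A
standard smooth localization of $G$ is lifted to a smooth $V$-algebra (`exists_smooth_lift`). Lifts
$P_i$ of the regular sequence need not be regular, nor vanish in $V'$, but the deformation $P_i -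
t^3X_i$ with new variables is regular and can be made to vanish in $V'$ (`RevRegular.sub_C_mul_X`).
Modulo it the values of $g$ and $e$ become $t^3$ times elements which respect the linear relations
between $g$ and $e$ (`exists_divided_values`). Both facts rest on the syzygies of a regular sequence
being Koszul. Finally Newton's method, carried out in a smooth extension, produces an exact zero of
$e$ modulo the sequence (`JacobianData.exists_smooth`), that is, a map from $E$ to a complete
intersection.

If $V$ is a field, it contains no suitable $t$. Then $\hat V = V$, and the argument runs over $V[X]$
with $X$ sent to a suitable element of $V'$; a complete intersection over $V$ is also one over
$V[X]$, and conversely since $V[X]$ is smooth over $V$. -/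

/-! ### Regular sequences, Koszul syzygies and deformation -/

section RevRegular

open Ideal

/-- A sequence `v` is reverse regular if, for each `i`, `v i` is a nonzerodivisor modulo the
ideal generated by the later entries. -/
def RevRegular {S : Type*} [CommRing S] : (n : ℕ) → (Fin n → S) → Prop
  | 0, _ => True
  | n + 1, v => (∀ m, v 0 * m ∈ span (Set.range (Fin.tail v)) →
      m ∈ span (Set.range (Fin.tail v))) ∧ RevRegular n (Fin.tail v)

variable {S Sh C : Type*} [CommRing S] [CommRing Sh] [CommRing C]

/-- An antisymmetric matrix is paired with a symmetric one. Two families `v` and `w` are allowed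
because `v` will be `c` times `w` after passing to a quotient. -/
lemma sum_sub_transpose_mul_eq_zero {n : ℕ} (k : Fin n → Fin n → S) (v w : Fin n → S)
    (h : ∀ i l, v l * w i = v i * w l) :
    ∑ i, (∑ l, (k i l - k l i) * v l) * w i = 0 := by
  simp_rw [sub_mul, Finset.sum_sub_distrib, sub_mul, Finset.sum_mul, Finset.sum_sub_distrib]
  rw [sub_eq_zero, Finset.sum_comm]
  refine Finset.sum_congr rfl fun i _ ↦ Finset.sum_congr rfl fun l _ ↦ ?_
  rw [mul_assoc, mul_assoc, h]

/-- The syzygies of a reverse regular sequence are the Koszul syzygies. -/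
lemma RevRegular.koszul {n : ℕ} {v : Fin n → S} (hv : RevRegular n v) (b : Fin n → S)
    (hb : ∑ i, b i * v i = 0) :
    ∃ k : Fin n → Fin n → S, ∀ i, b i = ∑ l, (k i l - k l i) * v l := by
  induction n with
  | zero => exact ⟨0, fun i ↦ i.elim0⟩
  | succ n ih =>
    rw [Fin.sum_univ_succ] at hb
    have h0 : b 0 ∈ span (Set.range (Fin.tail v)) := by
      apply hv.1
      rw [mem_span_range_iff_exists_fun]
      refine ⟨fun i ↦ - b i.succ, ?_⟩
      simp only [Fin.tail, neg_mul, Finset.sum_neg_distrib]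
      linear_combination - hb
    rw [mem_span_range_iff_exists_fun] at h0
    obtain ⟨μ, hμ⟩ := h0
    -- Substituting `b 0 = ∑ μ i * v (i + 1)` turns the given relation into a syzygy of the tail.
    obtain ⟨k, hk⟩ := ih hv.2 (fun i ↦ b i.succ + μ i * v 0) (by
      simp only [add_mul, Finset.sum_add_distrib]
      have : ∑ i, μ i * v 0 * Fin.tail v i = v 0 * b 0 := by
        rw [← hμ, Finset.mul_sum]
        exact Finset.sum_congr rfl fun i _ ↦ by ring
      rw [this]
      simp only [Fin.tail]
      linear_combination hb)
    -- The first row is `(0, μ)` and the first column is zero, so `k - kᵀ` gives `μ` in row `0` and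
    -- the correction `-μ i * v 0` in the other rows.
    refine ⟨Fin.cons (Fin.cons 0 μ) fun i ↦ Fin.cons 0 (k i), fun i ↦ ?_⟩
    refine Fin.cases ?_ (fun i ↦ ?_) i
    · simp only [Fin.sum_univ_succ, Fin.cons_zero, Fin.cons_succ, sub_self, sub_zero, zero_mul,
        zero_add]
      exact hμ.symm
    · have := hk i
      simp only [Fin.sum_univ_succ, Fin.cons_zero, Fin.cons_succ, zero_sub]
      simp only [Fin.tail] at this
      linear_combination this

lemma RevRegular.of_comp_ringEquiv {S' : Type*} [CommRing S'] (e : S ≃+* S') {n : ℕ}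
    {v : Fin n → S} (hv : RevRegular n (e ∘ v)) : RevRegular n v := by
  induction n with
  | zero => trivial
  | succ n ih =>
    refine ⟨fun m hm ↦ ?_, ih hv.2⟩
    have hr : Set.range (Fin.tail (e ∘ v)) = e '' Set.range (Fin.tail v) := by
      rw [← Set.range_comp]; rfl
    have key : ∀ x, e x ∈ span (Set.range (Fin.tail (e ∘ v))) ↔
        x ∈ span (Set.range (Fin.tail v)) := by
      intro x
      rw [hr, ← map_span, Ideal.mem_map_iff_of_surjective e e.surjective]
      exact ⟨fun ⟨y, hy, h⟩ ↦ e.injective h ▸ hy, fun h ↦ ⟨x, h, rfl⟩⟩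
    rw [← key]
    apply hv.1
    rw [← key, map_mul] at hm
    exact hm

lemma RevRegular.mvPolynomial {n : ℕ} {v : Fin n → S} (hv : RevRegular n v) (τ : Type*) :
    RevRegular n (fun i ↦ (MvPolynomial.C (v i) : MvPolynomial τ S)) := by
  induction n with
  | zero => trivial
  | succ n ih =>
    refine ⟨fun m hm ↦ ?_, ih hv.2⟩
    have hr : span (Set.range (Fin.tail fun i ↦ (MvPolynomial.C (v i) : MvPolynomial τ S))) =
        (span (Set.range (Fin.tail v))).map MvPolynomial.C := by
      rw [map_span, ← Set.range_comp]; rfl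
    rw [hr, MvPolynomial.mem_map_C_iff] at hm ⊢
    intro d
    apply hv.1
    simpa using hm d

lemma RevRegular.polynomial {n : ℕ} {v : Fin n → S} (hv : RevRegular n v) :
    RevRegular n (fun i ↦ Polynomial.C (v i)) := by
  induction n with
  | zero => trivial
  | succ n ih =>
    refine ⟨fun m hm ↦ ?_, ih hv.2⟩
    have hr : span (Set.range (Fin.tail fun i ↦ Polynomial.C (v i))) =
        (span (Set.range (Fin.tail v))).map Polynomial.C := by
      rw [map_span, ← Set.range_comp]; rfl
    rw [hr, mem_map_C_iff] at hm ⊢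
    intro d
    apply hv.1
    simpa using hm d

/-- If multiplication by `p` is injective on the `c`-torsion of `S ⧸ q`, then `p - c X` is a
nonzerodivisor on `(S ⧸ q)[X]`. -/
lemma mem_map_C_of_sub_C_mul_X_mul_mem (q : Ideal S) (p c : S)
    (h : ∀ x, c * x ∈ q → p * x ∈ q → x ∈ q) (f : Polynomial S)
    (hf : (Polynomial.C p - Polynomial.C c * Polynomial.X) * f ∈ q.map Polynomial.C) :
    f ∈ q.map Polynomial.C := by
  rw [mem_map_C_iff] at hf ⊢
  have h0 : p * f.coeff 0 ∈ q := by simpa [sub_mul, mul_assoc] using hf 0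
  have h1 (k : ℕ) : p * f.coeff (k + 1) - c * f.coeff k ∈ q := by
    simpa [sub_mul, mul_assoc] using hf (k + 1)
  have hpow (k : ℕ) : p ^ (k + 1) * f.coeff k ∈ q := by
    induction k with
    | zero => simpa using h0
    | succ k ih =>
      have : p ^ (k + 1 + 1) * f.coeff (k + 1) =
        p ^ (k + 1) * (p * f.coeff (k + 1) - c * f.coeff k) + c * (p ^ (k + 1) * f.coeff k) := by
        ring
      rw [this]
      exact add_mem (mul_mem_left _ _ (h1 k)) (mul_mem_left _ _ ih)
  -- If the next coefficient lies in `q`, then `f.coeff k` is `c`-torsion modulo `q`. It is also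
  -- killed by a power of `p`, which acts injectively on that torsion. The descent starts above the
  -- degree.
  have step (k : ℕ) (hk : f.coeff (k + 1) ∈ q) : f.coeff k ∈ q := by
    have hc : c * f.coeff k ∈ q := by
      have : c * f.coeff k = p * f.coeff (k + 1) - (p * f.coeff (k + 1) - c * f.coeff k) := by ring
      rw [this]
      exact sub_mem (mul_mem_left _ _ hk) (h1 k)
    have hj : ∀ j : ℕ, p ^ j * f.coeff k ∈ q → f.coeff k ∈ q := by
      intro j
      induction j with
      | zero => simp
      | succ j ih =>
        intro hj
        apply ih
        apply h
        · rw [mul_left_comm]; exact mul_mem_left _ _ hc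
        · rwa [← mul_assoc, ← pow_succ']
    exact hj _ (hpow k)
  have hdown : ∀ j k : ℕ, k + j = f.natDegree + 1 → f.coeff k ∈ q := by
    intro j
    induction j with
    | zero =>
      intro k hk
      rw [Polynomial.coeff_eq_zero_of_natDegree_lt (by omega)]
      exact zero_mem _
    | succ j ih => exact fun k hk ↦ step k (ih (k + 1) (by omega))
  intro k
  rcases le_or_gt k (f.natDegree + 1) with hk | hk
  · exact hdown (f.natDegree + 1 - k) k (by omega)
  · rw [Polynomial.coeff_eq_zero_of_natDegree_lt (by omega)]
    exact zero_mem _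

/-- `π` identifies its target with the quotient of its source by the nonzerodivisor `c`. -/
structure IsRegularQuotient (π : S →+* C) (c : S) : Prop where
  surjective : Function.Surjective π
  exists_eq_mul : ∀ s, π s = 0 → ∃ s', s = c * s'
  map_eq_zero : π c = 0
  eq_zero_of_mul_eq_zero : ∀ s, c * s = 0 → s = 0

lemma IsRegularQuotient.mvPolynomial {π : S →+* C} {c : S} (h : IsRegularQuotient π c)
    (τ : Type*) : IsRegularQuotient (MvPolynomial.map (σ := τ) π) (MvPolynomial.C c) where
  surjective := MvPolynomial.map_surjective π h.surjective
  exists_eq_mul s hs := by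
    have : MvPolynomial.C c ∣ s := by
      rw [MvPolynomial.C_dvd_iff_dvd_coeff]
      intro d
      obtain ⟨s', hs'⟩ := h.exists_eq_mul (s.coeff d) (by
        rw [← MvPolynomial.coeff_map, hs, MvPolynomial.coeff_zero])
      exact ⟨s', hs'⟩
    exact this
  map_eq_zero := by simp [h.map_eq_zero]
  eq_zero_of_mul_eq_zero s hs := by
    ext d
    rw [MvPolynomial.coeff_zero]
    apply h.eq_zero_of_mul_eq_zero
    rw [← MvPolynomial.coeff_C_mul, hs, MvPolynomial.coeff_zero]

lemma IsRegularQuotient.exists_of_map_eq {π : S →+* C} {c : S} (h : IsRegularQuotient π c)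
    {a b : S} (hab : π a = π b) : ∃ d, a = b + c * d := by
  obtain ⟨d, hd⟩ := h.exists_eq_mul (a - b) (by rw [map_sub, hab, sub_self])
  exact ⟨d, by rw [← hd]; ring⟩

lemma IsRegularQuotient.cancel {π : S →+* C} {c : S} (h : IsRegularQuotient π c)
    {a b : S} (hab : c * a = c * b) : a = b := by
  rw [← sub_eq_zero]
  apply h.eq_zero_of_mul_eq_zero
  rw [mul_sub, hab, sub_self]

/-- Only `Sh` is known to have `ph` regular modulo `Qh`, so the argument moves there and back
through the common quotient `C`. Write `c x = ∑ b i Q i`. As `p x` lies in `(Q)`, the vector `p b`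
is Koszul modulo `c`; in `Sh` this shows that `∑ bh i Qh i = ch m` with `ph m`, hence `m`, in
`(Qh)`. So `bh` is Koszul modulo `ch`, and therefore `b` is Koszul modulo `c`. Koszul vectors pair
to zero with `Q`, and `c` cancels. -/
lemma mem_span_of_mul_mem_span_of_isRegularQuotient {π : S →+* C} {πh : Sh →+* C} {c : S} {ch : Sh}
    (hπ : IsRegularQuotient π c) (hπh : IsRegularQuotient πh ch) {n : ℕ}
    (Q : Fin n → S) (Qh : Fin n → Sh) (hQ : ∀ i, π (Q i) = πh (Qh i))
    (hreg : RevRegular n Q) (hregh : RevRegular n Qh) (p : S) (ph : Sh) (hp : π p = πh ph)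
    (hph : ∀ m, ph * m ∈ span (Set.range Qh) → m ∈ span (Set.range Qh))
    (x : S) (hcx : c * x ∈ span (Set.range Q)) (hpx : p * x ∈ span (Set.range Q)) :
    x ∈ span (Set.range Q) := by
  rw [mem_span_range_iff_exists_fun] at hcx hpx ⊢
  obtain ⟨b, hb⟩ := hcx
  obtain ⟨b', hb'⟩ := hpx
  obtain ⟨k, hk⟩ := hreg.koszul (fun i ↦ p * b i - c * b' i) (by
    simp only [sub_mul, Finset.sum_sub_distrib, mul_assoc, ← Finset.mul_sum, hb, hb']
    ring)
  choose lift hlift using hπh.surjective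
  choose lift' hlift' using hπ.surjective
  set bh : Fin n → Sh := fun i ↦ lift (π (b i)) with hbh
  set kh : Fin n → Fin n → Sh := fun i l ↦ lift (π (k i l)) with hkh
  obtain ⟨m, hm⟩ := hπh.exists_eq_mul (∑ i, bh i * Qh i) (by
    simp only [map_sum, map_mul, hbh, hlift, ← hQ]
    simp only [← map_mul, ← map_sum, hb]
    rw [map_mul, hπ.map_eq_zero, zero_mul])
  have hd : ∀ i, ∃ d, ph * bh i = ∑ l, (kh i l - kh l i) * Qh l + ch * d := by
    intro i
    apply hπh.exists_of_map_eq
    simp only [map_sum, map_mul, map_sub, hbh, hkh, hlift, ← hQ, ← hp]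
    simp only [← map_mul, ← map_sub, ← map_sum]
    rw [← hk i, map_sub, map_mul π c, hπ.map_eq_zero]
    ring
  choose d hd using hd
  have hm' : m ∈ span (Set.range Qh) := by
    apply hph
    rw [mem_span_range_iff_exists_fun]
    refine ⟨d, ?_⟩
    apply hπh.cancel
    rw [mul_left_comm, ← hm, Finset.mul_sum, Finset.mul_sum]
    simp_rw [← mul_assoc, hd, add_mul, Finset.sum_add_distrib]
    rw [sum_sub_transpose_mul_eq_zero kh Qh Qh (fun i l ↦ by ring), zero_add]
  rw [mem_span_range_iff_exists_fun] at hm'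
  obtain ⟨e, he⟩ := hm'
  obtain ⟨lh, hlh⟩ := hregh.koszul (fun i ↦ bh i - ch * e i) (by
    simp only [sub_mul, Finset.sum_sub_distrib, mul_assoc, ← Finset.mul_sum, hm, he, sub_self])
  set l : Fin n → Fin n → S := fun i j ↦ lift' (πh (lh i j)) with hl
  have hf : ∀ i, ∃ f, b i = ∑ j, (l i j - l j i) * Q j + c * f := by
    intro i
    apply hπ.exists_of_map_eq
    simp only [map_sum, map_mul, map_sub, hl, hlift', hQ]
    simp only [← map_mul, ← map_sub, ← map_sum]
    rw [← hlh i, map_sub, map_mul, hπh.map_eq_zero, zero_mul, sub_zero]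
    simp [hbh, hlift]
  choose f hf using hf
  refine ⟨f, ?_⟩
  apply hπ.cancel
  rw [← hb, Finset.mul_sum]
  conv_rhs => simp only [hf, add_mul, Finset.sum_add_distrib]
  rw [sum_sub_transpose_mul_eq_zero l Q Q (fun i l ↦ by ring), zero_add]
  simp only [mul_assoc]

/-- Deforming a regular sequence modulo a nonzerodivisor `c` and adding `c` times new variables
gives a regular sequence. -/
lemma RevRegular.sub_C_mul_X {π : S →+* C} {πh : Sh →+* C} {c : S} {ch : Sh}
    (hπ : IsRegularQuotient π c) (hπh : IsRegularQuotient πh ch) {n : ℕ}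
    (P : Fin n → S) (Ph : Fin n → Sh) (hP : ∀ i, π (P i) = πh (Ph i)) (hreg : RevRegular n Ph) :
    RevRegular n (fun i ↦ (MvPolynomial.C (P i) - MvPolynomial.C c * MvPolynomial.X i :
      MvPolynomial (Fin n) S)) := by
  induction n with
  | zero => trivial
  | succ n ih =>
    -- In `S[X₁, …, Xₙ][X₀]` the tail of the sequence consists of constants, and its head is the
    -- linear polynomial `P 0 - c X₀`.
    apply RevRegular.of_comp_ringEquiv (MvPolynomial.finSuccEquiv S n).toRingEquiv
    have ih' := ih (Fin.tail P) (Fin.tail Ph) (fun i ↦ hP i.succ) hreg.2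
    set Q : Fin n → MvPolynomial (Fin n) S :=
      fun i ↦ MvPolynomial.C (Fin.tail P i) - MvPolynomial.C c * MvPolynomial.X i with hQ
    have htail : Fin.tail ((MvPolynomial.finSuccEquiv S n).toRingEquiv ∘
        fun i ↦ (MvPolynomial.C (P i) - MvPolynomial.C c * MvPolynomial.X i :
          MvPolynomial (Fin (n + 1)) S)) = fun i ↦ Polynomial.C (Q i) := by
      funext i
      change MvPolynomial.finSuccEquiv S n (_ - _ * MvPolynomial.X i.succ) = _
      rw [map_sub, map_mul, MvPolynomial.finSuccEquiv_X_succ]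
      simp [MvPolynomial.finSuccEquiv_apply, hQ, Fin.tail]
    refine ⟨fun m hm ↦ ?_, by rw [htail]; exact ih'.polynomial⟩
    rw [htail] at hm ⊢
    have hr : span (Set.range fun i ↦ Polynomial.C (Q i)) =
        (span (Set.range Q)).map Polynomial.C := by
      rw [map_span, ← Set.range_comp]; rfl
    rw [hr] at hm ⊢
    refine mem_map_C_of_sub_C_mul_X_mul_mem _ (MvPolynomial.C (P 0)) (MvPolynomial.C c) ?_ m ?_
    · refine mem_span_of_mul_mem_span_of_isRegularQuotient (hπ.mvPolynomial (Fin n))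
        (hπh.mvPolynomial (Fin n)) Q (fun i ↦ MvPolynomial.C (Fin.tail Ph i)) ?_ ih'
        (hreg.2.mvPolynomial _) _ (MvPolynomial.C (Ph 0)) ?_ ?_
      · intro i
        simp only [hQ, map_sub, map_mul, MvPolynomial.map_C, hπ.map_eq_zero, Fin.tail, hP]
        simp
      · simp [hP]
      · exact (hreg.mvPolynomial (Fin n)).1
    · convert hm using 2
      change _ = MvPolynomial.finSuccEquiv S n (_ - _ * MvPolynomial.X 0)
      rw [map_sub, map_mul, MvPolynomial.finSuccEquiv_X_zero]
      simp [MvPolynomial.finSuccEquiv_apply]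

open RingTheory.Sequence in
-- The reversed order suits inductions that split off the index `0` of `Fin (n + 1)`, as
-- `MvPolynomial.finSuccEquiv` does.
lemma isWeaklyRegular_reverse_ofFn_iff {n : ℕ} (v : Fin n → S) :
    IsWeaklyRegular S (List.ofFn v).reverse ↔ RevRegular n v := by
  induction n with
  | zero => simp [RevRegular]
  | succ n ih =>
    rw [List.ofFn_succ, List.reverse_cons, isWeaklyRegular_append_iff, RevRegular,
      isWeaklyRegular_singleton_iff, and_comm, ← ih]
    refine and_congr ?_ Iff.rfl
    have hI : Ideal.ofList (List.ofFn fun i : Fin n ↦ v i.succ).reverse =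
        span (Set.range (Fin.tail v)) := by
      simp only [Ideal.ofList, List.mem_reverse, List.mem_ofFn]
      rfl
    rw [isSMulRegular_quotient_iff_mem_of_smul_mem, hI]
    simp

end RevRegular

/-! ### The Jacobian criterion -/

section Jacobian

open MvPolynomial

/-- The quotient of a polynomial ring by finitely many polynomials is smooth after inverting a
maximal minor of the Jacobian matrix. -/
lemma Algebra.smooth_localizationAway_jacobian {R : Type u} [CommRing R] {ι κ : Type}
    [Finite ι] [Fintype κ] [DecidableEq κ] (v : κ → MvPolynomial ι R) (a : κ → ι)
    (ha : Function.Injective a) :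
    Algebra.Smooth R (Localization.Away (Ideal.Quotient.mk (Ideal.span (Set.range v))
      (Matrix.of fun i j ↦ pderiv (a i) (v j)).det)) := by
  set P := PreSubmersivePresentation.naive (R := R) (v := v) a ha with hP
  set J := Ideal.Quotient.mk (Ideal.span (Set.range v))
      (Matrix.of fun i j ↦ pderiv (a i) (v j)).det with hJ
  have hPJ : P.jacobian = J := by
    rw [PreSubmersivePresentation.jacobian_eq_jacobiMatrix_det]
    have : P.jacobiMatrix = Matrix.of fun i j ↦ pderiv (a i) (v j) := by
      ext1 i j
      exact PreSubmersivePresentation.jacobiMatrix_naive ..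
    rw [this]
    rfl
  -- The naive presentation need not be submersive. Composition with the presentation of the
  -- localization multiplies its Jacobian `J`, now inverted, by a unit.
  let L := SubmersivePresentation.localizationAway (Localization.Away J) J
  let Q : SubmersivePresentation R (Localization.Away J) _ _ :=
    { toPreSubmersivePresentation := L.toPreSubmersivePresentation.comp P
      jacobian_isUnit := by
        rw [PreSubmersivePresentation.comp_jacobian_eq_jacobian_smul_jacobian, Algebra.smul_def,
          IsUnit.mul_iff, hPJ]
        exact ⟨IsLocalization.Away.algebraMap_isUnit J, L.jacobian_isUnit⟩ }
  have := Q.isStandardSmooth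
  infer_instance

end Jacobian

/-! ### Taylor expansion along a line, without division -/

section Taylor

open MvPolynomial

variable {R D : Type*} [CommRing R] [CommRing D] [Algebra R D] {ι : Type*}

/-- The restriction of `p` to the line through `η` with direction `ω`. -/
noncomputable def MvPolynomial.lineRestriction (η ω : ι → D) :
    MvPolynomial ι R →ₐ[R] Polynomial D :=
  aeval fun k ↦ Polynomial.C (η k) + Polynomial.C (ω k) * Polynomial.X

lemma MvPolynomial.eval_lineRestriction (η ω : ι → D) (e : D) (p : MvPolynomial ι R) :
    (lineRestriction η ω p).eval e = aeval (fun k ↦ η k + e * ω k) p := by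
  have : ((Polynomial.aeval e).restrictScalars R).comp (lineRestriction η ω) =
      aeval (R := R) (fun k ↦ η k + e * ω k) := by
    ext k
    simp [lineRestriction, mul_comm e]
  exact congr($this p)

lemma MvPolynomial.coeff_zero_lineRestriction (η ω : ι → D) (p : MvPolynomial ι R) :
    (lineRestriction η ω p).coeff 0 = aeval η p := by
  rw [Polynomial.coeff_zero_eq_eval_zero, eval_lineRestriction]
  simp

lemma MvPolynomial.coeff_one_lineRestriction [Fintype ι] (η ω : ι → D) (p : MvPolynomial ι R) :
    (lineRestriction η ω p).coeff 1 = ∑ k, aeval η (pderiv k p) * ω k := by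
  classical
  induction p using MvPolynomial.induction_on with
  | C r =>
    simp [lineRestriction, Polynomial.algebraMap_apply]
  | add p q hp hq => simp [hp, hq, add_mul, Finset.sum_add_distrib]
  | mul_X p i hp =>
    have hX : lineRestriction η ω (X i : MvPolynomial ι R) =
        Polynomial.C (η i) + Polynomial.C (ω i) * Polynomial.X := by simp [lineRestriction]
    rw [map_mul, hX, mul_add, Polynomial.coeff_add, Polynomial.coeff_mul_C, hp, ← mul_assoc,
      Polynomial.coeff_mul_X, Polynomial.coeff_mul_C, coeff_zero_lineRestriction]
    simp only [Derivation.leibniz, pderiv_X, smul_eq_mul, map_add, map_mul, aeval_X, add_mul,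
      Finset.sum_add_distrib, Finset.sum_mul]
    have : ∑ k, aeval η p * (aeval η (Pi.single (M := fun _ ↦ MvPolynomial ι R) k 1 i)) * ω k =
        aeval η p * ω i := by
      rw [Finset.sum_eq_single i]
      · simp
      · intro k _ hk
        simp [Ne.symm hk]
      · simp
    rw [this]
    rw [add_comm]
    congr 1
    exact Finset.sum_congr rfl fun k _ ↦ by ring

/-- The difference quotient `(p (η + e ω) - p η) / e`. -/
noncomputable def MvPolynomial.diffQuot (η ω : ι → D) (e : D) (p : MvPolynomial ι R) : D :=
  (lineRestriction η ω p).divX.eval e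

/-- The second order term `(p (η + e ω) - p η - e p'(η) ω) / e ^ 2`. -/
noncomputable def MvPolynomial.diffQuot₂ (η ω : ι → D) (e : D) (p : MvPolynomial ι R) : D :=
  (lineRestriction η ω p).divX.divX.eval e

variable (η ω : ι → D) (e : D)

lemma MvPolynomial.aeval_add_mul (p : MvPolynomial ι R) :
    aeval (fun k ↦ η k + e * ω k) p = aeval η p + e * diffQuot η ω e p := by
  rw [← eval_lineRestriction, ← coeff_zero_lineRestriction η ω, diffQuot]
  conv_lhs => rw [← Polynomial.divX_mul_X_add (lineRestriction η ω p)]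
  simp [mul_comm, add_comm]

lemma MvPolynomial.diffQuot_eq [Fintype ι] (p : MvPolynomial ι R) :
    diffQuot η ω e p = ∑ k, aeval η (pderiv k p) * ω k + e * diffQuot₂ η ω e p := by
  rw [diffQuot, diffQuot₂, ← coeff_one_lineRestriction]
  conv_lhs => rw [← Polynomial.divX_mul_X_add (lineRestriction η ω p).divX]
  simp [mul_comm, add_comm, Polynomial.coeff_divX]

/-- A Leibniz rule with one factor evaluated at the shifted point. It carries the relations `t e = ∑
a g` over to difference quotients even where the step `e` is a zero divisor. -/
lemma MvPolynomial.diffQuot_mul (p q : MvPolynomial ι R) :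
    diffQuot η ω e (p * q) =
      aeval (fun k ↦ η k + e * ω k) p * diffQuot η ω e q + aeval η q * diffQuot η ω e p := by
  have key : (lineRestriction η ω (p * q)).divX =
      lineRestriction η ω p * (lineRestriction η ω q).divX +
        Polynomial.C ((lineRestriction η ω q).coeff 0) * (lineRestriction η ω p).divX := by
    have hreg : Function.Injective (fun f : Polynomial D ↦ f * Polynomial.X) :=
      (Polynomial.isRegular_X).right
    apply hreg
    have h1 := Polynomial.divX_mul_X_add (lineRestriction η ω p)
    have h2 := Polynomial.divX_mul_X_add (lineRestriction η ω q)
    have h3 := Polynomial.divX_mul_X_add (lineRestriction η ω (p * q))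
    have h4 : (lineRestriction η ω (p * q)).coeff 0 =
        (lineRestriction η ω p).coeff 0 * (lineRestriction η ω q).coeff 0 := by
      rw [map_mul, Polynomial.mul_coeff_zero]
    rw [h4, map_mul Polynomial.C] at h3
    rw [map_mul] at h3 ⊢
    dsimp only
    linear_combination h3 - (lineRestriction η ω p) * h2 -
      Polynomial.C ((lineRestriction η ω q).coeff 0) * h1
  rw [diffQuot, key, Polynomial.eval_add, Polynomial.eval_mul, Polynomial.eval_mul,
    eval_lineRestriction, Polynomial.eval_C, coeff_zero_lineRestriction]
  rfl

lemma MvPolynomial.diffQuot_C (r : R) : diffQuot η ω e (C r : MvPolynomial ι R) = 0 := by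
  have : lineRestriction η ω (C r : MvPolynomial ι R) = Polynomial.C (algebraMap R D r) := by
    simp [lineRestriction, Polynomial.algebraMap_apply]
  simp [diffQuot, this]

lemma MvPolynomial.diffQuot_sum {κ : Type*} (s : Finset κ) (f : κ → MvPolynomial ι R) :
    diffQuot η ω e (∑ k ∈ s, f k) = ∑ k ∈ s, diffQuot η ω e (f k) := by
  classical
  have hadd (p q : MvPolynomial ι R) :
      diffQuot η ω e (p + q) = diffQuot η ω e p + diffQuot η ω e q := by
    simp [diffQuot, Polynomial.divX_add]
  induction s using Finset.induction_on with
  | empty => simpa using diffQuot_C η ω e (0 : R)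
  | insert a s ha ih => rw [Finset.sum_insert ha, Finset.sum_insert ha, hadd, ih]

end Taylor

/-! ### Newton's lemma -/

/-- Polynomials `g`, `e` over `R` such that, after inverting `t`, the `e i` are contained in the
ideal generated by the `g j`, and the `g j` satisfy the Jacobian criterion. -/
structure JacobianData (R : Type u) [CommRing R] (t : R) (ι σ κ : Type) [Fintype ι] [Fintype σ]
    [DecidableEq σ] where
  g : σ → MvPolynomial ι R
  e : κ → MvPolynomial ι R
  a : κ → σ → MvPolynomial ι R
  rel : ∀ i, MvPolynomial.C t * e i = ∑ j, a i j * g j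
  N : ι → σ → MvPolynomial ι R
  θ : σ → σ → σ → MvPolynomial ι R
  jac : ∀ j m, ∑ p, MvPolynomial.pderiv p (g j) * N p m =
    (if j = m then MvPolynomial.C t else 0) + ∑ l, θ j m l * g l

namespace JacobianData

open MvPolynomial

variable {R : Type u} [CommRing R] {t : R} {ι σ κ : Type} [Fintype ι] [Fintype σ]
    [DecidableEq σ] (d : JacobianData R t ι σ κ)

section

variable {D : Type*} [CommRing D] [Algebra R D] (η : ι → D) (u : σ → D)
  (ζ : ι → D) (W : σ → D)

/-- The direction of the Newton correction. -/
noncomputable def direction (p : ι) : D :=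
  algebraMap R D t * ζ p + ∑ m, aeval η (d.N p m) * W m

/-- The terms of the Newton equation which are divisible by `t`. -/
noncomputable def newtonError (j : σ) : D :=
  algebraMap R D t * ∑ m, ∑ l, aeval η (d.θ j m l) * u l * W m +
    diffQuot₂ η (d.direction η ζ W) (algebraMap R D t ^ 2) (d.g j)

/-- The equation whose solutions give exact zeros of the polynomials `g j`. -/
noncomputable def newton (j : σ) : D :=
  W j + (u j + ∑ p, aeval η (pderiv p (d.g j)) * ζ p) +
    algebraMap R D t * d.newtonError η u ζ W j

/-- In direction `ω = t ζ + N W` the first order term is `t ∂g ζ + (∂g N) W`. Here `∂g N` is `t`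
plus a combination of the values `g (η) = t ^ 3 u`, and the second order term carries the step `t ^
2`; so a factor `t` splits off everywhere. -/
lemma diffQuot_eq_newton (hu : ∀ j, aeval η (d.g j) = algebraMap R D t ^ 3 * u j) (j : σ) :
    algebraMap R D t * u j + diffQuot η (d.direction η ζ W) (algebraMap R D t ^ 2) (d.g j) =
      algebraMap R D t * d.newton η u ζ W j := by
  rw [diffQuot_eq, newton, newtonError]
  have h1 : ∑ p, aeval η (pderiv p (d.g j)) * d.direction η ζ W p =
      algebraMap R D t * ∑ p, aeval η (pderiv p (d.g j)) * ζ p +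
        ∑ m, aeval η (∑ p, pderiv p (d.g j) * d.N p m) * W m := by
    simp only [direction, mul_add, Finset.sum_add_distrib, Finset.mul_sum, map_sum, map_mul,
      Finset.sum_mul]
    rw [Finset.sum_comm (s := Finset.univ (α := ι)) (t := Finset.univ (α := σ))]
    congr 1
    · exact Finset.sum_congr rfl fun _ _ ↦ by ring
    · exact Finset.sum_congr rfl fun _ _ ↦ Finset.sum_congr rfl fun _ _ ↦ by ring
  have h2 : ∑ m, aeval η (∑ p, pderiv p (d.g j) * d.N p m) * W m = algebraMap R D t * W j +
      algebraMap R D t ^ 3 * ∑ m, ∑ l, aeval η (d.θ j m l) * u l * W m := by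
    simp only [d.jac, map_add, map_sum, map_mul, hu, add_mul, Finset.sum_add_distrib,
      Finset.mul_sum, Finset.sum_mul]
    congr 1
    · rw [Finset.sum_eq_single j]
      · simp
      · intro m _ hm
        simp [Ne.symm hm]
      · simp
    · exact Finset.sum_congr rfl fun _ _ ↦ Finset.sum_congr rfl fun _ _ ↦ by ring
  rw [h1, h2]
  ring

lemma aeval_g_eq_newton (hu : ∀ j, aeval η (d.g j) = algebraMap R D t ^ 3 * u j) (j : σ) :
    aeval (fun k ↦ η k + algebraMap R D t ^ 2 * d.direction η ζ W k) (d.g j) =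
      algebraMap R D t ^ 3 * d.newton η u ζ W j := by
  rw [aeval_add_mul, hu]
  linear_combination algebraMap R D t ^ 2 * d.diffQuot_eq_newton η u ζ W hu j

/-- A solution of the Newton equation gives a common zero of all the polynomials `e i`. -/
lemma aeval_e_eq_zero (hu : ∀ j, aeval η (d.g j) = algebraMap R D t ^ 3 * u j) (u' : κ → D)
    (hu' : ∀ i, aeval η (d.e i) = algebraMap R D t ^ 3 * u' i)
    (hrel : ∀ i, algebraMap R D t * u' i = ∑ j, aeval η (d.a i j) * u j)
    (h0 : ∀ j, d.newton η u ζ W j = 0) (i : κ) :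
    aeval (fun k ↦ η k + algebraMap R D t ^ 2 * d.direction η ζ W k) (d.e i) = 0 := by
  set τ := algebraMap R D t with hτ
  set ω := d.direction η ζ W with hω
  set Δ := diffQuot (R := R) η ω (τ ^ 2) with hΔ
  have hv (j : σ) : τ * u j + Δ (d.g j) = 0 := by
    rw [hΔ, hω, hτ, d.diffQuot_eq_newton η u ζ W hu j, h0, mul_zero]
  have hD : τ * Δ (d.e i) = ∑ j, (aeval (fun k ↦ η k + τ ^ 2 * ω k) (d.a i j) * Δ (d.g j) +
      aeval η (d.g j) * Δ (d.a i j)) := by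
    have := congr(Δ $(d.rel i))
    rw [hΔ, diffQuot_mul, diffQuot_C, diffQuot_sum, mul_zero, add_zero, aeval_C] at this
    rw [hΔ, hτ, this]
    exact Finset.sum_congr rfl fun j _ ↦ diffQuot_mul ..
  -- This factor `τ` cannot be cancelled, since `D` may have `τ`-torsion. It need not be: the value
  -- of `e i` at the new point is `τ ^ 2 * (τ * u' i + Δ (e i))`, which contains it.
  have hv' : τ * (τ * u' i + Δ (d.e i)) = 0 := by
    rw [mul_add, hD, hrel i, Finset.mul_sum, ← Finset.sum_add_distrib]
    refine Finset.sum_eq_zero fun j _ ↦ ?_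
    rw [aeval_add_mul, hu j]
    linear_combination (aeval η (d.a i j) + τ ^ 2 * Δ (d.a i j)) * hv j
  rw [aeval_add_mul, hu' i]
  linear_combination τ * hv'

end

end JacobianData

namespace JacobianData

open MvPolynomial

section

variable {R : Type*} [CommRing R] {D D' : Type*} [CommRing D] [Algebra R D] [CommRing D']
  [Algebra R D'] {ι : Type*}

lemma _root_.MvPolynomial.algHom_aeval (F : D →ₐ[R] D') (η : ι → D) (p : MvPolynomial ι R) :
    F (aeval η p) = aeval (fun k ↦ F (η k)) p := by
  rw [← AlgHom.comp_apply, comp_aeval]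

lemma _root_.MvPolynomial.map_diffQuot₂ (F : D →ₐ[R] D') (η ω : ι → D) (e : D)
    (p : MvPolynomial ι R) :
    F (diffQuot₂ η ω e p) = diffQuot₂ (fun k ↦ F (η k)) (fun k ↦ F (ω k)) (F e) p := by
  have h : lineRestriction (fun k ↦ F (η k)) (fun k ↦ F (ω k)) p =
      (lineRestriction η ω p).map (F : D →+* D') := by
    have : lineRestriction (R := R) (fun k ↦ F (η k)) (fun k ↦ F (ω k)) =
        (Polynomial.mapAlgHom F).comp (lineRestriction η ω) := by
      ext k
      simp [lineRestriction]
    exact congr($this p)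
  have h2 : (lineRestriction (fun k ↦ F (η k)) (fun k ↦ F (ω k)) p).divX.divX =
      (lineRestriction η ω p).divX.divX.map (F : D →+* D') := by
    ext n
    simp [h, Polynomial.coeff_divX]
  rw [diffQuot₂, diffQuot₂, h2]
  exact (Polynomial.eval_map_apply (f := (F : D →+* D')) e).symm

end

variable {R : Type u} [CommRing R] {t : R} {ι σ κ : Type} [Fintype ι] [Fintype σ]
    [DecidableEq σ] (d : JacobianData R t ι σ κ)

section

variable {D D' : Type*} [CommRing D] [Algebra R D] [CommRing D']
  [Algebra R D'] (F : D →ₐ[R] D') (η : ι → D) (u : σ → D) (ζ : ι → D) (W : σ → D)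

lemma map_direction (p : ι) : F (d.direction η ζ W p) =
    d.direction (fun k ↦ F (η k)) (fun k ↦ F (ζ k)) (fun k ↦ F (W k)) p := by
  simp [direction, algHom_aeval]

/-- The Newton equation is written in a polynomial ring, then read in `A`, where it has a known
solution, and in a quotient, where the congruences for `u` become equalities. -/
lemma map_newton (j : σ) : F (d.newton η u ζ W j) =
    d.newton (fun k ↦ F (η k)) (fun k ↦ F (u k)) (fun k ↦ F (ζ k)) (fun k ↦ F (W k)) j := by
  simp [newton, newtonError, algHom_aeval, map_diffQuot₂, map_direction]

end

/-- **Newton's lemma.** An approximate common zero of the polynomials of a Jacobian data becomes an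
exact common zero in a smooth algebra. -/
theorem exists_smooth {G : Type u} [CommRing G] [Algebra R G] {A : Type u} [CommRing A]
    [IsDomain A] [IsLocalRing A] [Algebra R A] (φ : G →ₐ[R] A) (ht0 : algebraMap R A t ≠ 0)
    (htm : ¬ IsUnit (algebraMap R A t)) (q : Ideal G) (hq : ∀ s ∈ q, φ s = 0)
    (η : ι → G) (u : σ → G) (u' : κ → G)
    (hu : ∀ j, aeval η (d.g j) - algebraMap R G t ^ 3 * u j ∈ q)
    (hu' : ∀ i, aeval η (d.e i) - algebraMap R G t ^ 3 * u' i ∈ q)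
    (hrel : ∀ i, algebraMap R G t * u' i - ∑ j, aeval η (d.a i j) * u j ∈ q)
    (x z : ι → A) (hx : ∀ j, aeval x (d.g j) = 0)
    (hz : ∀ k, x k = φ (η k) + algebraMap R A t ^ 3 * z k) :
    ∃ (T : Type u) (_ : CommRing T) (_ : Algebra R T) (_ : Algebra G T) (_ : IsScalarTower R G T)
      (y : ι → T) (ψ : T →ₐ[R] A), Algebra.Smooth G T ∧ (∀ s, ψ (algebraMap G T s) = φ s) ∧
        (∀ k, ψ (y k) = x k) ∧ ∀ i, aeval y (d.e i) ∈ q.map (algebraMap G T) := by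
  classical
  let _ : Algebra G A := φ.toRingHom.toAlgebra
  have _ : IsScalarTower R G A := .of_algebraMap_eq fun r ↦ (φ.commutes r).symm
  let H := MvPolynomial (ι ⊕ σ) G
  let ηH : ι → H := fun k ↦ C (η k)
  let uH : σ → H := fun k ↦ C (u k)
  let ζH : ι → H := fun k ↦ X (Sum.inl k)
  let WH : σ → H := fun k ↦ X (Sum.inr k)
  let h : σ → H := d.newton ηH uH ζH WH
  let I : Ideal H := Ideal.span (Set.range h)
  let M : Matrix σ σ H := Matrix.of fun i j ↦ pderiv (Sum.inr i) (h j)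
  let J : H ⧸ I := Ideal.Quotient.mk I M.det
  let T := Localization.Away J
  have hsm : Algebra.Smooth G T :=
    Algebra.smooth_localizationAway_jacobian h Sum.inr Sum.inr_injective
  -- With `W = 0` and `ζ = z` the direction is `t z`, so the corrected point `η + t ^ 2 ω` is
  -- exactly `x`.
  let ψ₀ : H →ₐ[R] A := (aeval (R := G) (Sum.elim z (0 : σ → A))).restrictScalars R
  have hψC (s : G) : ψ₀ (C s) = φ s := by
    change aeval (R := G) (Sum.elim z (0 : σ → A)) (C s) = φ s
    rw [aeval_C]; rfl
  have hψζ (k : ι) : ψ₀ (ζH k) = z k := by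
    change aeval (R := G) (Sum.elim z (0 : σ → A)) (X (Sum.inl k)) = _
    simp
  have hψW (k : σ) : ψ₀ (WH k) = 0 := by
    change aeval (R := G) (Sum.elim z (0 : σ → A)) (X (Sum.inr k)) = _
    simp
  have hdir (k : ι) : ψ₀ (d.direction ηH ζH WH k) = algebraMap R A t * z k := by
    rw [map_direction]
    simp [direction, hψζ, hψW]
  have hxk (k : ι) : ψ₀ (ηH k + algebraMap R H t ^ 2 * d.direction ηH ζH WH k) = x k := by
    rw [map_add, map_mul, map_pow, hdir, AlgHom.commutes, hψC, hz]
    ring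
  -- `t ^ 3` times the Newton equation is the value of `g j` at `x`, which is zero, and `A` is a
  -- domain.
  have hψh (j : σ) : ψ₀ (h j) = 0 := by
    have h3 : algebraMap R A t ^ 3 ≠ 0 := pow_ne_zero _ ht0
    apply (mul_eq_zero.mp ?_).resolve_left h3
    rw [map_newton, ← aeval_g_eq_newton, ← hx j]
    · congr 2
      funext k
      rw [← hxk, map_add, map_mul, map_pow, AlgHom.commutes, map_direction]
    · intro j
      simp only [ηH, uH, hψC]
      have := hq _ (hu j)
      rw [map_sub, map_mul, map_pow, AlgHom.commutes, sub_eq_zero] at this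
      rw [← this, algHom_aeval]
  have hderiv (i j : σ) : ψ₀ (M i j) = (if i = j then 1 else 0) +
      algebraMap R A t * ψ₀ (pderiv (Sum.inr i) (d.newtonError ηH uH ζH WH j)) := by
    have haev (p : MvPolynomial ι R) : aeval ηH p = C (aeval η p) := by
      exact (algHom_aeval (IsScalarTower.toAlgHom R G H) η p).symm
    have htH : algebraMap R H t = C (algebraMap R G t) := rfl
    have e1 : M i j = pderiv (Sum.inr i) (WH j) +
        algebraMap R H t * pderiv (Sum.inr i) (d.newtonError ηH uH ζH WH j) := by
      simp only [M, Matrix.of_apply, h, newton, map_add, Derivation.leibniz, htH, pderiv_C, haev,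
        map_sum, uH, ζH, smul_eq_mul]
      simp
    rw [e1, map_add, map_mul, AlgHom.commutes]
    congr 1
    by_cases hij : i = j
    · subst hij
      simp [WH, pderiv_X]
    · rw [if_neg hij]
      have : pderiv (R := G) (Sum.inr i : ι ⊕ σ) (WH j) = 0 :=
        pderiv_X_of_ne (by simpa using Ne.symm hij)
      rw [this, map_zero]
  -- By `hderiv`, the matrix of derivatives in the variables `W` is the identity modulo the nonunit
  -- `t` of the local ring `A`.
  have hdet : IsUnit (ψ₀ M.det) := by
    rw [← IsLocalRing.residue_ne_zero_iff_isUnit]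
    have ht : IsLocalRing.residue A (algebraMap R A t) = 0 := by
      rw [IsLocalRing.residue_eq_zero_iff]
      exact htm
    have : ((IsLocalRing.residue A).comp (ψ₀ : H →+* A)).mapMatrix M = 1 := by
      ext i j
      simp only [RingHom.mapMatrix_apply, Matrix.map_apply, RingHom.comp_apply, RingHom.coe_coe,
        hderiv, map_add, map_mul, ht, zero_mul, add_zero, Matrix.one_apply]
      split_ifs <;> simp
    have h2 := RingHom.map_det ((IsLocalRing.residue A).comp (ψ₀ : H →+* A)) M
    rw [this, Matrix.det_one] at h2
    have h3 : IsLocalRing.residue A (ψ₀ M.det) = 1 := h2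
    rw [h3]
    exact one_ne_zero
  let ψ₁ : H ⧸ I →ₐ[R] A := Ideal.Quotient.liftₐ I ψ₀ (by
    intro s hs
    have : I ≤ RingHom.ker ψ₀ := by
      rw [Ideal.span_le]
      rintro _ ⟨j, rfl⟩
      exact hψh j
    exact this hs)
  have hψ₁ (s : H) : ψ₁ (Ideal.Quotient.mk I s) = ψ₀ s := rfl
  have hJ : IsUnit (ψ₁ J) := by rw [hψ₁]; exact hdet
  let ψ₂ : T →+* A := IsLocalization.Away.lift (S := T) (g := (ψ₁ : H ⧸ I →+* A)) J hJ
  have hψ₂ (s : H) : ψ₂ (algebraMap (H ⧸ I) T (Ideal.Quotient.mk I s)) = ψ₀ s := by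
    exact IsLocalization.Away.lift_eq (S := T) (g := (ψ₁ : H ⧸ I →+* A)) J hJ _
  let ψ : T →ₐ[R] A := { ψ₂ with
    commutes' := fun r ↦ (hψ₂ (algebraMap R H r)).trans (ψ₀.commutes r) }
  let b : H →ₐ[R] T := (IsScalarTower.toAlgHom R (H ⧸ I) T).comp (Ideal.Quotient.mkₐ R I)
  have hψb (s : H) : ψ (b s) = ψ₀ s := hψ₂ s
  refine ⟨T, inferInstance, inferInstance, inferInstance, inferInstance,
    fun k ↦ b (ηH k + algebraMap R H t ^ 2 * d.direction ηH ζH WH k), ψ, hsm, fun s ↦ ?_,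
    fun k ↦ ?_, fun i ↦ ?_⟩
  · exact (hψb (C s)).trans (hψC s)
  · rw [hψb, hxk]
  -- Modulo `q` the hypotheses on `u` and `u'` hold exactly, and the Newton equation already holds
  -- in `T`.
  · let F : H →ₐ[R] T ⧸ q.map (algebraMap G T) := (Ideal.Quotient.mkₐ R _).comp b
    have hFq (s : G) (hs : s ∈ q) : F (C s) = 0 :=
      Ideal.Quotient.eq_zero_iff_mem.mpr (Ideal.mem_map_of_mem (algebraMap G T) hs)
    let FG : G →ₐ[R] T ⧸ q.map (algebraMap G T) := F.comp (IsScalarTower.toAlgHom R G H)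
    have hFG (s : G) (hs : s ∈ q) : FG s = 0 := hFq s hs
    rw [← Ideal.Quotient.eq_zero_iff_mem, ← Ideal.Quotient.mkₐ_eq_mk R, algHom_aeval]
    have key := d.aeval_e_eq_zero (fun k ↦ FG (η k)) (fun k ↦ FG (u k)) (fun k ↦ F (ζH k))
      (fun k ↦ F (WH k)) (fun j ↦ ?_) (fun k ↦ FG (u' k)) (fun i ↦ ?_) (fun i ↦ ?_) (fun j ↦ ?_) i
    · refine Eq.trans ?_ key
      congr 2
      funext k
      change F (ηH k + algebraMap R H t ^ 2 * d.direction ηH ζH WH k) = _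
      rw [map_add, map_mul, map_pow, AlgHom.commutes, map_direction]
      rfl
    · have := hFG _ (hu j)
      rw [map_sub, map_mul, map_pow, AlgHom.commutes, sub_eq_zero] at this
      rw [← this, algHom_aeval]
    · have := hFG _ (hu' i)
      rw [map_sub, map_mul, map_pow, AlgHom.commutes, sub_eq_zero] at this
      rw [← this, algHom_aeval]
    · have := hFG _ (hrel i)
      rw [map_sub, map_mul, map_sum, AlgHom.commutes, sub_eq_zero] at this
      rw [this]
      exact Finset.sum_congr rfl fun j _ ↦ by rw [map_mul, algHom_aeval]
    · have h1 := d.map_newton F ηH uH ζH WH j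
      refine Eq.trans ?_ (h1.symm.trans ?_)
      · rfl
      · change Ideal.Quotient.mk _ (algebraMap (H ⧸ I) T (Ideal.Quotient.mk I (h j))) = 0
        have : Ideal.Quotient.mk I (h j) = 0 :=
          Ideal.Quotient.eq_zero_iff_mem.mpr (Ideal.subset_span ⟨j, rfl⟩)
        rw [this, map_zero, map_zero]

end JacobianData

/-! ### From solutions modulo `t ^ 3` to exact solutions -/

section

open MvPolynomial

section Syzygies

variable {R : Type*} [CommRing R] {S Sh C' : Type*} [CommRing S] [CommRing Sh] [CommRing C']
  [Algebra R S] [Algebra R Sh] {π : S →+* C'} {πh : Sh →+* C'} {c : R}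

/-- If the polynomials `p i` vanish at the point `yh` modulo a regular sequence `Ph`, then the
values `p i (η)` at a congruent point `η` can be divided by `c` after deforming the sequence, in a
way which respects the linear relations between the `p i`. -/
lemma exists_divided_values (hπ : IsRegularQuotient π (algebraMap R S c))
    (halg : ∀ r, π (algebraMap R S r) = πh (algebraMap R Sh r)) {n : ℕ}
    (P : Fin n → S) (Ph : Fin n → Sh) (hP : ∀ i, π (P i) = πh (Ph i)) (hreg : RevRegular n Ph)
    {ι κ : Type*} [Fintype κ] (η : ι → S) (yh : ι → Sh) (hη : ∀ k, π (η k) = πh (yh k))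
    (p : κ → MvPolynomial ι R) (hp : ∀ i, aeval yh (p i) ∈ Ideal.span (Set.range Ph)) :
    ∃ u : κ → MvPolynomial (Fin n) S,
      (∀ i, C (aeval η (p i)) - C (algebraMap R S c) * u i ∈
        Ideal.span (Set.range fun i ↦ C (P i) - C (algebraMap R S c) * X i)) ∧
      ∀ r : κ → MvPolynomial ι R, ∑ i, r i * p i = 0 → ∑ i, C (aeval η (r i)) * u i ∈
        Ideal.span (Set.range fun i ↦ C (P i) - C (algebraMap R S c) * X i) := by
  set cS := algebraMap R S c with hcS
  set Q := Ideal.span (Set.range fun i ↦ (C (P i) - C cS * X i : MvPolynomial (Fin n) S)) with hQ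
  have hCP (i : Fin n) : Ideal.Quotient.mk Q (C (P i)) = Ideal.Quotient.mk Q (C cS * X i) :=
    Ideal.Quotient.eq.mpr (Ideal.subset_span ⟨i, rfl⟩)
  have haev (f : MvPolynomial ι R) : π (aeval η f) = πh (aeval yh f) := by
    rw [aeval_def, aeval_def, hom_eval₂, hom_eval₂]
    congr 1
    · ext r; exact halg r
    · funext k; exact hη k
  simp only [Ideal.mem_span_range_iff_exists_fun] at hp
  choose αh hαh using hp
  choose lift hlift using hπ.surjective
  set α : κ → Fin n → S := fun i k ↦ lift (πh (αh i k)) with hα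
  have hβ : ∀ i, ∃ β, aeval η (p i) = ∑ k, α i k * P k + cS * β := by
    intro i
    apply hπ.exists_of_map_eq
    rw [haev, ← hαh i]
    simp [hα, hlift, hP]
  choose β hβ using hβ
  -- Since `P k = c X k` modulo the deformed sequence, `∑ α i k P k + c β i` becomes `c` times this
  -- element.
  refine ⟨fun i ↦ ∑ k, C (α i k) * X k + C (β i), fun i ↦ ?_, fun r hr ↦ ?_⟩
  · rw [← Ideal.Quotient.eq_zero_iff_mem, hβ]
    simp only [map_add, map_sub, map_sum, map_mul, hCP, mul_add, Finset.mul_sum]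
    rw [add_sub_add_right_eq_sub, ← Finset.sum_sub_distrib]
    exact Finset.sum_eq_zero fun k _ ↦ by ring
  -- A linear relation between the `p i` makes the combined coefficients of `Ph` a syzygy, hence
  -- Koszul. The Koszul part lifts to `S` and contributes nothing after `P k` is replaced by `c X
  -- k`; `hβρ` cancels the remaining error.
  · obtain ⟨lh, hlh⟩ := hreg.koszul (fun k ↦ ∑ i, aeval yh (r i) * αh i k) (by
      have := congr(aeval yh $hr)
      simp only [map_sum, map_mul, map_zero, ← hαh, Finset.mul_sum] at this
      simp only [Finset.sum_mul]
      rw [Finset.sum_comm, ← this]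
      exact Finset.sum_congr rfl fun _ _ ↦ Finset.sum_congr rfl fun _ _ ↦ by ring)
    set l : Fin n → Fin n → S := fun i k ↦ lift (πh (lh i k)) with hl
    have hρ : ∀ k, ∃ ρ, ∑ i, aeval η (r i) * α i k = ∑ j, (l k j - l j k) * P j + cS * ρ := by
      intro k
      apply hπ.exists_of_map_eq
      simp only [map_sum, map_mul, map_sub, hl, hlift, hP, haev, hα]
      simp only [← map_mul, ← map_sub, ← map_sum]
      rw [hlh]
    choose ρ hρ using hρ
    have hβρ : ∑ i, aeval η (r i) * β i = - ∑ k, ρ k * P k := by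
      apply hπ.cancel
      have h0 := congr(aeval η $hr)
      simp only [map_sum, map_mul, map_zero, hβ, mul_add, Finset.sum_add_distrib] at h0
      have h1 : ∑ i, aeval η (r i) * ∑ k, α i k * P k =
          ∑ k, (∑ i, aeval η (r i) * α i k) * P k := by
        simp only [Finset.mul_sum, Finset.sum_mul]
        rw [Finset.sum_comm]
        exact Finset.sum_congr rfl fun _ _ ↦ Finset.sum_congr rfl fun _ _ ↦ by ring
      have h2 : ∑ i, aeval η (r i) * (cS * β i) = cS * ∑ i, aeval η (r i) * β i := by
        rw [Finset.mul_sum]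
        exact Finset.sum_congr rfl fun _ _ ↦ by ring
      have h3 : ∑ k, (cS * ρ k) * P k = cS * ∑ k, ρ k * P k := by
        rw [Finset.mul_sum]
        exact Finset.sum_congr rfl fun _ _ ↦ by ring
      rw [h1, h2] at h0
      simp only [hρ, add_mul, Finset.sum_add_distrib] at h0
      rw [sum_sub_transpose_mul_eq_zero l P P (fun i l ↦ by ring), h3] at h0
      linear_combination h0
    have h4 : ∑ i, C (aeval η (r i)) * (∑ k, C (α i k) * X k + C (β i)) =
        ∑ k, C (∑ i, aeval η (r i) * α i k) * X k +
          (C (∑ i, aeval η (r i) * β i) : MvPolynomial (Fin n) S) := by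
      simp only [mul_add, Finset.sum_add_distrib, map_sum, map_mul, Finset.mul_sum, Finset.sum_mul]
      rw [Finset.sum_comm]
      congr 1
      exact Finset.sum_congr rfl fun _ _ ↦ Finset.sum_congr rfl fun _ _ ↦ by ring
    rw [h4, hβρ, ← Ideal.Quotient.eq_zero_iff_mem]
    simp only [hρ, map_add, map_sum, map_mul, map_neg, map_sub, hCP, add_mul,
      Finset.sum_add_distrib]
    rw [sum_sub_transpose_mul_eq_zero (fun i j ↦ Ideal.Quotient.mk Q (C (l i j)))
      (fun i ↦ Ideal.Quotient.mk Q (C cS) * Ideal.Quotient.mk Q (X i)) _ (fun i l ↦ by ring),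
      zero_add, ← sub_eq_add_neg, ← Finset.sum_sub_distrib]
    exact Finset.sum_eq_zero fun k _ ↦ by ring

end Syzygies

open RingTheory.Sequence in
/-- A quotient of a smooth algebra by a regular sequence, which is given in reverse order. -/
lemma isCompleteIntersectionAlgebra_of_revRegular {R G T : Type u} [CommRing R] [CommRing G]
    [CommRing T] [Algebra R G] [Algebra G T] [Algebra R T] [IsScalarTower R G T]
    [Algebra.Smooth R G] [Algebra.Smooth G T] {n : ℕ} (Q : Fin n → G) (hQ : RevRegular n Q)
    [hT : Nontrivial (T ⧸ (Ideal.span (Set.range Q)).map (algebraMap G T))] :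
    IsCompleteIntersectionAlgebra R (T ⧸ (Ideal.span (Set.range Q)).map (algebraMap G T)) := by
  have hs : Algebra.Smooth R T := Algebra.Smooth.comp R G T
  -- A smooth algebra is flat, so regularity passes from `G` to `T`.
  have hw : IsWeaklyRegular T ((List.ofFn Q).reverse.map (algebraMap G T)) :=
    ((isWeaklyRegular_reverse_ofFn_iff Q).mpr hQ).of_flat
  have hI : Ideal.ofList ((List.ofFn Q).reverse.map (algebraMap G T)) =
      (Ideal.span (Set.range Q)).map (algebraMap G T) := by
    rw [← Ideal.map_ofList]
    congr 1
    simp only [Ideal.ofList, List.mem_reverse, List.mem_ofFn]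
    rfl
  refine ⟨T, inferInstance, inferInstance, _, hs, ⟨hw, ?_⟩, ⟨Ideal.quotientEquivAlgOfEq R hI.symm⟩⟩
  rw [hI, smul_eq_mul, Ideal.mul_top]
  exact (Ideal.Quotient.nontrivial_iff.mp hT).symm

/-- The core of the lifting argument: a solution in a complete intersection which is congruent to
`x` modulo `t ^ 3` yields an exact factorization through a complete intersection. -/
theorem JacobianData.exists_completeIntersection_of_isRegularQuotient
    {R : Type u} [CommRing R] {t : R} {ι σ κ : Type} [Fintype ι] [Fintype σ] [Fintype κ]
    [DecidableEq σ] (d : JacobianData R t ι σ κ)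
    {A : Type u} [CommRing A] [IsDomain A] [IsLocalRing A] [Algebra R A]
    (ht0 : algebraMap R A t ≠ 0) (htm : ¬ IsUnit (algebraMap R A t))
    (x : ι → A) (hx : ∀ j, aeval x (d.g j) = 0)
    {S : Type u} {Sh C' : Type*} [CommRing S] [CommRing Sh] [CommRing C'] [Algebra R S]
    [Algebra R Sh] [Algebra.Smooth R S] {π : S →+* C'} {πh : Sh →+* C'}
    (hπ : IsRegularQuotient π (algebraMap R S (t ^ 3)))
    (hπh : IsRegularQuotient πh (algebraMap R Sh (t ^ 3)))
    (halg : ∀ r, π (algebraMap R S r) = πh (algebraMap R Sh r)) {n : ℕ}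
    (Ph : Fin n → Sh) (hreg : RevRegular n Ph) (yh : ι → Sh)
    (hg : ∀ j, aeval yh (d.g j) ∈ Ideal.span (Set.range Ph))
    (he : ∀ j, aeval yh (d.e j) ∈ Ideal.span (Set.range Ph))
    (φ : S →ₐ[R] A)
    (hφP : ∀ i s, π s = πh (Ph i) → ∃ a, φ s = algebraMap R A t ^ 3 * a)
    (hφy : ∀ k s, π s = πh (yh k) → ∃ a, x k = φ s + algebraMap R A t ^ 3 * a) :
    ∃ (D : Type u) (_ : CommRing D) (_ : Algebra R D) (y : ι → D) (h : D →ₐ[R] A),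
      IsCompleteIntersectionAlgebra R D ∧ (∀ k, h (y k) = x k) ∧ ∀ i, aeval y (d.e i) = 0 := by
  choose lift hlift using hπ.surjective
  set η : ι → S := fun k ↦ lift (πh (yh k)) with hη
  set P : Fin n → S := fun i ↦ lift (πh (Ph i)) with hP
  obtain ⟨u, hu, hrel⟩ := exists_divided_values hπ halg P Ph (fun i ↦ hlift _) hreg η yh
    (fun k ↦ hlift _) (Sum.elim d.g d.e) (Sum.rec hg he)
  choose p hp using fun i ↦ hφP i (P i) (hlift _)
  choose z hz using fun k ↦ hφy k (η k) (hlift _)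
  let Q : Fin n → MvPolynomial (Fin n) S := fun i ↦ C (P i) - C (algebraMap R S (t ^ 3)) * X i
  have hQ : RevRegular n Q := hreg.sub_C_mul_X hπ hπh P Ph (fun i ↦ hlift _)
  let _ : Algebra S A := φ.toRingHom.toAlgebra
  have _ : IsScalarTower R S A := .of_algebraMap_eq fun r ↦ (φ.commutes r).symm
  -- The new variable `X i` goes to the quotient `p i` of `φ (P i)` by `t ^ 3`, so the deformed
  -- sequence vanishes in `A`.
  let φG : MvPolynomial (Fin n) S →ₐ[R] A := (aeval (R := S) p).restrictScalars R
  have hφC (s : S) : φG (C s) = φ s := by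
    change aeval (R := S) p (C s) = φ s
    rw [aeval_C]; rfl
  have hφX (i : Fin n) : φG (X i) = p i := by
    change aeval (R := S) p (X i) = p i
    rw [aeval_X]
  have hφQ : ∀ s ∈ Ideal.span (Set.range Q), φG s = 0 := by
    have : Ideal.span (Set.range Q) ≤ RingHom.ker φG := by
      rw [Ideal.span_le]
      rintro _ ⟨i, rfl⟩
      change φG (C (P i) - C (algebraMap R S (t ^ 3)) * X i) = 0
      rw [map_sub, map_mul, hφC, hφC, hφX, hp, AlgHom.commutes, map_pow, sub_self]
    exact fun s hs ↦ this hs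
  have haev (f : MvPolynomial ι R) :
      aeval (fun k ↦ (C (η k) : MvPolynomial (Fin n) S)) f = C (aeval η f) :=
    (algHom_aeval (IsScalarTower.toAlgHom R S (MvPolynomial (Fin n) S)) η f).symm
  have ht3 : algebraMap R (MvPolynomial (Fin n) S) t ^ 3 = C (algebraMap R S (t ^ 3)) := by
    rw [← map_pow]; rfl
  obtain ⟨T, _, _, _, _, y, ψ, hsm, hψ, hψy, hye⟩ := d.exists_smooth φG ht0 htm _ hφQ
    (fun k ↦ C (η k)) (fun j ↦ u (Sum.inl j)) (fun i ↦ u (Sum.inr i))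
    (fun j ↦ by rw [haev, ht3]; exact hu (Sum.inl j))
    (fun i ↦ by rw [haev, ht3]; exact hu (Sum.inr i))
    (fun i ↦ by
      classical
      -- The relation used is `t e i - ∑ a i j g j = 0`.
      have := hrel (Sum.elim (fun j ↦ - d.a i j) (fun k ↦ if k = i then C t else 0)) (by
        simp [d.rel])
      simp only [Fintype.sum_sum_type, Sum.elim_inl, Sum.elim_inr, map_neg, neg_mul] at this
      rw [Finset.sum_eq_single_of_mem (f := fun x ↦ C _ * u (Sum.inr x)) i (Finset.mem_univ _)
        (by intro b _ hb; simp [hb])] at this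
      rw [if_pos rfl, aeval_C, Finset.sum_neg_distrib, add_comm, ← sub_eq_add_neg] at this
      simp only [haev]
      exact this) x z hx (fun k ↦ by rw [hz k, hφC])
  let q := (Ideal.span (Set.range Q)).map (algebraMap (MvPolynomial (Fin n) S) T)
  let h : T ⧸ q →ₐ[R] A := Ideal.Quotient.liftₐ q ψ (by
    intro s hs
    have : q ≤ RingHom.ker ψ := by
      rw [Ideal.map_le_iff_le_comap]
      intro s hs
      change ψ _ = 0
      rw [hψ, hφQ s hs]
    exact this hs)
  have : Nontrivial (T ⧸ q) := h.toRingHom.domain_nontrivial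
  have : Algebra.Smooth S (MvPolynomial (Fin n) S) := ⟨inferInstance, inferInstance⟩
  have : Algebra.Smooth R (MvPolynomial (Fin n) S) := Algebra.Smooth.comp R S _
  refine ⟨T ⧸ q, inferInstance, inferInstance, fun k ↦ Ideal.Quotient.mk q (y k), h,
    isCompleteIntersectionAlgebra_of_revRegular Q hQ, fun k ↦ hψy k, fun i ↦ ?_⟩
  have := algHom_aeval (Ideal.Quotient.mkₐ R q) y (d.e i)
  refine this.symm.trans ?_
  exact Ideal.Quotient.eq_zero_iff_mem.mpr (hye i)

end

/-! ### Lifting smooth algebras modulo `c` -/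

section

open MvPolynomial

/-- A nonzerodivisor of the base stays a nonzerodivisor on a flat algebra. -/
lemma eq_zero_of_algebraMap_mul_eq_zero {R S : Type*} [CommRing R] [CommRing S] [Algebra R S]
    [Module.Flat R S] {c : R} (hc : ∀ r, c * r = 0 → r = 0) (s : S)
    (hs : algebraMap R S c * s = 0) : s = 0 := by
  have hc' : c ∈ nonZeroDivisors R :=
    mem_nonZeroDivisors_iff_right.mpr fun x hx ↦ hc x (by rwa [mul_comm])
  have := Module.Flat.isSMulRegular_of_nonZeroDivisors (M := S) hc'
  apply this
  simpa [Algebra.smul_def] using hs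

lemma isRegularQuotient_mk {S : Type*} [CommRing S] {c : S} (hc : ∀ s, c * s = 0 → s = 0) :
    IsRegularQuotient (Ideal.Quotient.mk (Ideal.span {c})) c where
  surjective := Ideal.Quotient.mk_surjective
  exists_eq_mul _ hs := Ideal.mem_span_singleton.mp (Ideal.Quotient.eq_zero_iff_mem.mp hs)
  map_eq_zero := Ideal.Quotient.eq_zero_iff_mem.mpr (Ideal.mem_span_singleton_self c)
  eq_zero_of_mul_eq_zero := hc

lemma isUnit_of_isUnit_mk_span_singleton {A : Type*} [CommRing A] [IsLocalRing A] {c : A}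
    (hc : ¬ IsUnit c) {a : A} (ha : IsUnit (Ideal.Quotient.mk (Ideal.span {c}) a)) :
    IsUnit a := by
  obtain ⟨b, hb⟩ := ha.exists_right_inv
  obtain ⟨b, rfl⟩ := Ideal.Quotient.mk_surjective b
  rw [← map_mul, ← map_one (Ideal.Quotient.mk _), Ideal.Quotient.eq,
    Ideal.mem_span_singleton] at hb
  obtain ⟨d, hd⟩ := hb
  have h1 : IsUnit (a * b) := by
    have h2 : (1 : A) = a * b + - (c * d) := by rw [← hd]; ring
    rcases IsLocalRing.isUnit_or_isUnit_of_add_one h2.symm with h | h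
    · exact h
    · exact absurd (isUnit_of_mul_isUnit_left (IsUnit.neg_iff _ |>.mp h)) hc
  exact isUnit_of_mul_isUnit_left h1

/-- Lifting a standard smooth algebra over `Rh` to a smooth algebra over `R`, where `R` and `Rh`
agree modulo `c`, together with a local homomorphism to `A` which is given modulo `c`. -/
theorem exists_smooth_lift {R Rh Gh A : Type u} [CommRing R] [CommRing Rh] [CommRing Gh]
    [CommRing A] [IsLocalRing A] [Algebra R Rh] [Algebra Rh Gh] [Algebra R A] [Algebra R Gh]
    [IsScalarTower R Rh Gh]
    {c : R} (hc : ∀ r, c * r = 0 → r = 0) (hcA : ¬ IsUnit (algebraMap R A c))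
    (ρ : Rh →+* R ⧸ Ideal.span {c}) (hρ : IsRegularQuotient ρ (algebraMap R Rh c))
    (hρR : ∀ r, ρ (algebraMap R Rh r) = Ideal.Quotient.mk _ r)
    {ι σ : Type} [Finite ι] [Fintype σ] (P : Algebra.SubmersivePresentation Rh Gh ι σ)
    (θ : Gh →ₐ[R] A ⧸ Ideal.span {algebraMap R A c}) :
    ∃ (S : Type u) (_ : CommRing S) (_ : Algebra R S)
      (π : S →+* MvPolynomial σ Gh ⧸ Ideal.span {algebraMap R (MvPolynomial σ Gh) c})
      (φ : S →ₐ[R] A)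
      (Θ : MvPolynomial σ Gh ⧸ Ideal.span {algebraMap R (MvPolynomial σ Gh) c} →+*
        A ⧸ Ideal.span {algebraMap R A c}),
      Algebra.Smooth R S ∧ IsRegularQuotient π (algebraMap R S c) ∧
      (∀ r, π (algebraMap R S r) = Ideal.Quotient.mk _ (algebraMap R _ r)) ∧
      (∀ s, Θ (π s) = Ideal.Quotient.mk _ (φ s)) ∧
      (∀ g, Θ (Ideal.Quotient.mk _ (C g)) = θ g) := by
  classical
  set Sh := MvPolynomial σ Gh with hSh
  set C' := Sh ⧸ Ideal.span {algebraMap R Sh c} with hC'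
  set mkC : Sh →ₐ[R] C' := Ideal.Quotient.mkₐ R _ with hmkC
  have hcC : mkC (algebraMap R Sh c) = 0 :=
    Ideal.Quotient.eq_zero_iff_mem.mpr (Ideal.mem_span_singleton_self _)
  have hcA' : algebraMap R (A ⧸ Ideal.span {algebraMap R A c}) c = 0 :=
    Ideal.Quotient.eq_zero_iff_mem.mpr (Ideal.mem_span_singleton_self _)
  -- congruent polynomials have the same values in rings where `c` vanishes
  have hcong {B : Type u} [CommRing B] (β : Rh →+* B) (hβ : β (algebraMap R Rh c) = 0)
      (w : ι → B) (F : MvPolynomial ι R) (Fh : MvPolynomial ι Rh)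
      (hF : map (Ideal.Quotient.mk (Ideal.span {c})) F = map ρ Fh) :
      eval₂ (β.comp (algebraMap R Rh)) w F = eval₂ β w Fh := by
    have h1 : map ρ Fh = map ρ (map (algebraMap R Rh) F) := by
      rw [← hF, map_map]
      congr 2
      ext r
      exact (hρR r).symm
    obtain ⟨E, hE⟩ := (hρ.mvPolynomial ι).exists_of_map_eq h1
    rw [hE, eval₂_add, eval₂_mul, eval₂_C, hβ, zero_mul, add_zero, eval₂_map]
  choose f hf using fun j ↦ MvPolynomial.map_surjective (Ideal.Quotient.mk (Ideal.span {c}))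
    Ideal.Quotient.mk_surjective (map ρ (P.relation j))
  let H := MvPolynomial (ι ⊕ σ) R
  -- The lifted relations `f j` vanish at a lifted point of `A` only modulo `c`; the extra variables
  -- absorb the errors. Modulo `c` they become free, which is why the special fibre is that of
  -- `MvPolynomial σ Gh` rather than of `Gh`.
  let v : σ → H := fun j ↦ rename Sum.inl (f j) - C c * X (Sum.inr j)
  let a : σ → ι ⊕ σ := fun j ↦ Sum.inl (P.map j)
  have ha : Function.Injective a := Sum.inl_injective.comp P.map_inj
  let I : Ideal H := Ideal.span (Set.range v)
  let M : Matrix σ σ H := Matrix.of fun i j ↦ pderiv (a i) (v j)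
  let Mf : Matrix σ σ (MvPolynomial ι R) := Matrix.of fun i j ↦ pderiv (P.map i) (f j)
  have hM : M.det = rename Sum.inl Mf.det := by
    have : M = (rename (R := R) (Sum.inl : ι → ι ⊕ σ)).mapMatrix Mf := by
      ext1 i j
      simp only [M, Mf, v, a, Matrix.of_apply, AlgHom.mapMatrix_apply, Matrix.map_apply, map_sub,
        Derivation.leibniz, pderiv_C, pderiv_rename Sum.inl_injective]
      rw [pderiv_X_of_ne (by simp)]
      simp
    rw [this, AlgHom.map_det]
  have hMf : map (Ideal.Quotient.mk (Ideal.span {c})) Mf.det = map ρ P.jacobiMatrix.det := by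
    rw [RingHom.map_det, RingHom.map_det]
    congr 1
    ext1 i j
    simp only [RingHom.mapMatrix_apply, Matrix.map_apply, Mf, Matrix.of_apply,
      Algebra.PreSubmersivePresentation.jacobiMatrix_apply, ← pderiv_map, hf]
  let J : H ⧸ I := Ideal.Quotient.mk I M.det
  let S := Localization.Away J
  have hsm : Algebra.Smooth R S := Algebra.smooth_localizationAway_jacobian v a ha
  let mkS : S →+* S ⧸ Ideal.span {algebraMap R S c} := Ideal.Quotient.mk _
  have hcS : mkS (algebraMap R S c) = 0 :=
    Ideal.Quotient.eq_zero_iff_mem.mpr (Ideal.mem_span_singleton_self _)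
  -- values of lifts in an algebra through `Gh`
  have hval {B : Type u} [CommRing B] [Algebra R B] (γ : Gh →ₐ[R] B)
      (hγ : algebraMap R B c = 0) (F : MvPolynomial ι R) (Fh : MvPolynomial ι Rh)
      (hF : map (Ideal.Quotient.mk (Ideal.span {c})) F = map ρ Fh) :
      aeval (fun i ↦ γ (P.val i)) F = γ (aeval P.val Fh) := by
    have := hcong ((γ : Gh →+* B).comp (algebraMap Rh Gh)) (by
      rw [RingHom.comp_apply, ← IsScalarTower.algebraMap_apply, RingHom.coe_coe, γ.commutes, hγ])
      (fun i ↦ γ (P.val i)) F Fh hF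
    rw [aeval_def, aeval_def]
    refine Eq.trans ?_ (this.trans ?_)
    · congr 1
      ext r
      rw [RingHom.comp_apply, RingHom.comp_apply, ← IsScalarTower.algebraMap_apply,
        RingHom.coe_coe, γ.commutes]
    · exact (hom_eval₂ Fh (algebraMap Rh Gh) (γ : Gh →+* B) P.val).symm
  have hvalv {B : Type u} [CommRing B] [Algebra R B] (γ : Gh →ₐ[R] B)
      (hγ : algebraMap R B c = 0) (w : σ → B) (j : σ) :
      aeval (Sum.elim (fun i ↦ γ (P.val i)) w) (v j) = 0 := by
    simp only [v, map_sub, map_mul, aeval_rename, aeval_C, hγ, zero_mul, sub_zero]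
    refine Eq.trans ?_ ((hval γ hγ _ _ (hf j)).trans ?_)
    · rfl
    · rw [P.aeval_val_relation, map_zero]
  have hvalJ {B : Type u} [CommRing B] [Algebra R B] (γ : Gh →ₐ[R] B)
      (hγ : algebraMap R B c = 0) (w : σ → B) :
      IsUnit (aeval (Sum.elim (fun i ↦ γ (P.val i)) w) M.det) := by
    rw [hM, aeval_rename]
    have h1 : aeval (Sum.elim (fun i ↦ γ (P.val i)) w ∘ Sum.inl) Mf.det =
      γ (aeval P.val P.jacobiMatrix.det) := hval γ hγ _ _ hMf
    rw [h1, ← P.algebraMap_apply, ← P.jacobian_eq_jacobiMatrix_det]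
    exact P.jacobian_isUnit.map γ
  have hlift {B : Type u} [CommRing B] [Algebra R B] (w : ι ⊕ σ → B)
      (hw : ∀ j, aeval w (v j) = 0) (hJ : IsUnit (aeval w M.det)) :
      ∃ F : S →ₐ[R] B, ∀ h : H, F (algebraMap (H ⧸ I) S (Ideal.Quotient.mk I h)) = aeval w h := by
    let F₁ : H ⧸ I →ₐ[R] B := Ideal.Quotient.liftₐ I (aeval w) (by
      intro s hs
      have : I ≤ RingHom.ker (aeval (R := R) w) := by
        rw [Ideal.span_le]
        rintro _ ⟨j, rfl⟩
        exact hw j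
      exact this hs)
    have hF₁ (h : H) : F₁ (Ideal.Quotient.mk I h) = aeval w h := rfl
    have hJ' : IsUnit ((F₁ : H ⧸ I →+* B) J) := hJ
    let F₂ : S →+* B := IsLocalization.Away.lift (S := S) J hJ'
    have hF₂ (h : H) : F₂ (algebraMap (H ⧸ I) S (Ideal.Quotient.mk I h)) = aeval w h :=
      IsLocalization.Away.lift_eq (S := S) (g := (F₁ : H ⧸ I →+* B)) J hJ' _
    exact ⟨{ F₂ with commutes' := fun r ↦ (hF₂ (algebraMap R H r)).trans (AlgHom.commutes _ r) },
      hF₂⟩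
  have hext {B : Type u} [CommRing B] (F G : S →+* B)
      (hFG : ∀ h : H, F (algebraMap (H ⧸ I) S (Ideal.Quotient.mk I h)) =
        G (algebraMap (H ⧸ I) S (Ideal.Quotient.mk I h))) : F = G := by
    apply IsLocalization.ringHom_ext (Submonoid.powers J)
    apply Ideal.Quotient.ringHom_ext
    exact RingHom.ext hFG
  -- the map to the special fibre
  let γC : Gh →ₐ[R] C' := mkC.comp (IsScalarTower.toAlgHom R Gh Sh)
  have hγC (g : Gh) : γC g = Ideal.Quotient.mk _ (C g) := rfl
  have hcC' : algebraMap R C' c = 0 := hcC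
  obtain ⟨π, hπ⟩ := hlift (B := C') (Sum.elim (fun i ↦ γC (P.val i)) (fun j ↦ mkC (X j)))
    (hvalv γC hcC' _) (hvalJ γC hcC' _)
  -- the map to `A`
  choose x hx using fun i ↦ Ideal.Quotient.mk_surjective (I := Ideal.span {algebraMap R A c})
    (θ (P.val i))
  have hfx (j : σ) : algebraMap R A c ∣ aeval x (f j) := by
    rw [← Ideal.mem_span_singleton, ← Ideal.Quotient.eq_zero_iff_mem,
      ← Ideal.Quotient.mkₐ_eq_mk R, algHom_aeval]
    simp only [Ideal.Quotient.mkₐ_eq_mk, hx]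
    rw [hval θ hcA' _ _ (hf j), P.aeval_val_relation, map_zero]
  -- The values `z` of the extra variables are the errors divided by `c`.
  choose z hz using hfx
  let mkA : A →ₐ[R] A ⧸ Ideal.span {algebraMap R A c} := Ideal.Quotient.mkₐ R _
  have hmkA (h : H) : mkA (aeval (Sum.elim x z) h) =
      aeval (Sum.elim (fun i ↦ θ (P.val i)) fun j ↦ mkA (z j)) h := by
    rw [algHom_aeval]
    congr 2
    funext k
    rcases k with i | j
    · exact hx i
    · rfl
  obtain ⟨φ, hφ⟩ := hlift (B := A) (Sum.elim x z) (by
    intro j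
    simp only [v, map_sub, map_mul, aeval_rename, aeval_C, aeval_X, Sum.elim_inr]
    exact sub_eq_zero.mpr (hz j)) (by
    apply isUnit_of_isUnit_mk_span_singleton hcA
    change IsUnit (mkA _)
    rw [hmkA]
    exact hvalJ θ hcA' _)
  -- the comparison over `A ⧸ c`
  let Θ₀ : Sh →+* A ⧸ Ideal.span {algebraMap R A c} := eval₂Hom (θ : Gh →+* _) fun j ↦ mkA (z j)
  have hΘ₀R (r : R) : Θ₀ (algebraMap R Sh r) = algebraMap R _ r := by
    rw [IsScalarTower.algebraMap_apply R Gh Sh]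
    exact (eval₂Hom_C _ _ _).trans (θ.commutes r)
  let Θ : C' →+* A ⧸ Ideal.span {algebraMap R A c} := Ideal.Quotient.lift _ Θ₀ (by
    intro s hs
    obtain ⟨d, rfl⟩ := Ideal.mem_span_singleton.mp hs
    rw [map_mul, hΘ₀R, hcA', zero_mul])
  have hΘ (s : Sh) : Θ (mkC s) = Θ₀ s := rfl
  have hΘR : ∀ r, Θ (algebraMap R C' r) = algebraMap R _ r := fun r ↦ hΘ₀R r
  -- the inverse of the map to the special fibre
  let χ₀ : MvPolynomial ι Rh →+* S ⧸ Ideal.span {algebraMap R S c} :=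
    eval₂Hom ((Ideal.Quotient.lift (Ideal.span {c}) (mkS.comp (algebraMap R S)) (by
      intro s hs
      obtain ⟨d, rfl⟩ := Ideal.mem_span_singleton.mp hs
      rw [map_mul, RingHom.comp_apply, hcS, zero_mul])).comp ρ)
      (fun i ↦ mkS (algebraMap (H ⧸ I) S (Ideal.Quotient.mk I (X (Sum.inl i)))))
  have hχ₀R (r : R) : χ₀ (C (algebraMap R Rh r)) = mkS (algebraMap R S r) := by
    simp only [χ₀, eval₂Hom_C, RingHom.comp_apply, hρR, Ideal.Quotient.lift_mk]
  have hχ₀f (F : MvPolynomial ι R) (Fh : MvPolynomial ι Rh)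
      (hF : map (Ideal.Quotient.mk (Ideal.span {c})) F = map ρ Fh) :
      χ₀ Fh = mkS (algebraMap (H ⧸ I) S (Ideal.Quotient.mk I (rename Sum.inl F))) := by
    have h1 : χ₀ Fh = χ₀ (map (algebraMap R Rh) F) := by
      obtain ⟨E, hE⟩ := (hρ.mvPolynomial ι).exists_of_map_eq
        (show map ρ Fh = map ρ (map (algebraMap R Rh) F) by
          rw [← hF, map_map]
          congr 2
          ext r
          exact (hρR r).symm)
      rw [hE, map_add, map_mul, hχ₀R, hcS, zero_mul, add_zero]
    rw [h1]
    have h2 : χ₀.comp (map (algebraMap R Rh)) = (mkS.comp ((algebraMap (H ⧸ I) S).comp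
        (Ideal.Quotient.mk I))).comp (rename (R := R) (Sum.inl : ι → ι ⊕ σ) : _ →+* H) := by
      apply MvPolynomial.ringHom_ext
      · intro r
        simp only [RingHom.comp_apply, map_C, hχ₀R, RingHom.coe_coe, rename_C]
        rfl
      · intro i
        simp [χ₀]
    exact congr($h2 F)
  have hχ₀ker (p : MvPolynomial ι Rh) (hp : p ∈ RingHom.ker (aeval (R := Rh) P.val)) :
      χ₀ p = 0 := by
    rw [← P.ker_eq_ker_aeval_val, ← P.span_range_relation_eq_ker] at hp
    have : Ideal.span (Set.range P.relation) ≤ RingHom.ker χ₀ := by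
      rw [Ideal.span_le]
      rintro _ ⟨j, rfl⟩
      change χ₀ (P.relation j) = 0
      have hv0 : Ideal.Quotient.mk I (v j) = 0 :=
        Ideal.Quotient.eq_zero_iff_mem.mpr (Ideal.subset_span ⟨j, rfl⟩)
      have h1 : Ideal.Quotient.mk I (rename Sum.inl (f j)) =
          Ideal.Quotient.mk I (C c) * Ideal.Quotient.mk I (X (Sum.inr j)) := by
        rw [map_sub, sub_eq_zero] at hv0
        rw [hv0, map_mul]
      rw [hχ₀f _ _ (hf j), h1, map_mul, map_mul]
      have h2 : mkS (algebraMap (H ⧸ I) S (Ideal.Quotient.mk I (C c))) = 0 := hcS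
      rw [h2, zero_mul]
    exact this hp
  let χ₁ : Gh →+* S ⧸ Ideal.span {algebraMap R S c} :=
    RingHom.liftOfSurjective (aeval (R := Rh) P.val : MvPolynomial ι Rh →+* Gh)
      P.aeval_val_surjective ⟨χ₀, fun p hp ↦ hχ₀ker p hp⟩
  have hχ₁ (p : MvPolynomial ι Rh) : χ₁ (aeval P.val p) = χ₀ p :=
    RingHom.liftOfRightInverse_comp_apply (aeval (R := Rh) P.val : MvPolynomial ι Rh →+* Gh) _ _
      ⟨χ₀, fun p hp ↦ hχ₀ker p hp⟩ p
  have hχ₁R (r : R) : χ₁ (algebraMap R Gh r) = mkS (algebraMap R S r) := by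
    rw [IsScalarTower.algebraMap_apply R Rh Gh, ← hχ₀R, ← hχ₁, aeval_C]
  let χ₂ : Sh →+* S ⧸ Ideal.span {algebraMap R S c} := eval₂Hom χ₁
    fun j ↦ mkS (algebraMap (H ⧸ I) S (Ideal.Quotient.mk I (X (Sum.inr j))))
  have hχ₂R (r : R) : χ₂ (algebraMap R Sh r) = mkS (algebraMap R S r) := by
    rw [IsScalarTower.algebraMap_apply R Gh Sh]
    exact (eval₂Hom_C _ _ _).trans (hχ₁R r)
  let χ : C' →+* S ⧸ Ideal.span {algebraMap R S c} := Ideal.Quotient.lift _ χ₂ (by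
    intro s hs
    obtain ⟨d, rfl⟩ := Ideal.mem_span_singleton.mp hs
    rw [map_mul, hχ₂R, hcS, zero_mul])
  have hχ (s : Sh) : χ (mkC s) = χ₂ s := rfl
  have hχπ : χ.comp (π : S →+* C') = mkS := by
    apply hext
    intro h
    simp only [RingHom.comp_apply, RingHom.coe_coe, hπ]
    have : (χ.comp (aeval (R := R) (Sum.elim (fun i ↦ γC (P.val i)) fun j ↦ mkC (X j)) :
        H →+* C')) = mkS.comp ((algebraMap (H ⧸ I) S).comp (Ideal.Quotient.mk I)) := by
      apply MvPolynomial.ringHom_ext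
      · intro r
        simp only [RingHom.comp_apply, RingHom.coe_coe, aeval_C]
        exact (hχ₂R r)
      · intro k
        simp only [RingHom.comp_apply, RingHom.coe_coe, aeval_X]
        rcases k with i | j
        · change χ₂ (C (P.val i)) = _
          have h1 := hχ₁ (X i)
          rw [aeval_X] at h1
          exact (eval₂Hom_C _ _ _).trans (h1.trans (eval₂Hom_X' _ _ _))
        · change χ₂ (X j) = _
          exact eval₂Hom_X' _ _ _
    exact congr($this h)
  refine ⟨S, inferInstance, inferInstance, π, φ, Θ, hsm, ⟨?_, ?_, ?_, ?_⟩, ?_, ?_, ?_⟩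
  · have hπR (r : R) : π (algebraMap R S r) = algebraMap R C' r := π.commutes r
    have hRh (r : Rh) : ∃ s, π s = γC (algebraMap Rh Gh r) := by
      obtain ⟨r', hr'⟩ := Ideal.Quotient.mk_surjective (ρ r)
      obtain ⟨d, hd⟩ := hρ.exists_of_map_eq (hr'.symm.trans (hρR r').symm)
      refine ⟨algebraMap R S r', ?_⟩
      have h1 : γC (algebraMap Rh Gh (algebraMap R Rh c)) = 0 := by
        rw [← IsScalarTower.algebraMap_apply, γC.commutes, hcC']
      rw [hd, map_add, map_add, map_mul, map_mul, h1, zero_mul, add_zero, hπR,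
        ← IsScalarTower.algebraMap_apply, γC.commutes]
    have hGh (g : Gh) : ∃ s, π s = γC g := by
      obtain ⟨p, rfl⟩ := P.aeval_val_surjective g
      induction p using MvPolynomial.induction_on with
      | C r => rw [aeval_C]; exact hRh r
      | add p q hp hq =>
        obtain ⟨s, hs⟩ := hp
        obtain ⟨s', hs'⟩ := hq
        exact ⟨s + s', by rw [map_add, map_add, map_add, hs, hs']⟩
      | mul_X p i hp =>
        obtain ⟨s, hs⟩ := hp
        refine ⟨s * algebraMap (H ⧸ I) S (Ideal.Quotient.mk I (X (Sum.inl i))), ?_⟩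
        rw [map_mul, map_mul, map_mul, hs, hπ, aeval_X, aeval_X, Sum.elim_inl]
    intro s'
    obtain ⟨s', rfl⟩ := Ideal.Quotient.mk_surjective s'
    change ∃ s, π s = mkC s'
    induction s' using MvPolynomial.induction_on with
    | C g => exact hGh g
    | add p q hp hq =>
      obtain ⟨s, hs⟩ := hp
      obtain ⟨s', hs'⟩ := hq
      exact ⟨s + s', by rw [map_add, map_add, hs, hs']⟩
    | mul_X p j hp =>
      obtain ⟨s, hs⟩ := hp
      refine ⟨s * algebraMap (H ⧸ I) S (Ideal.Quotient.mk I (X (Sum.inr j))), ?_⟩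
      rw [map_mul, map_mul, hs, hπ, aeval_X, Sum.elim_inr]
  · intro s hs
    have h1 : χ (π s) = mkS s := congr($hχπ s)
    have hs' : π s = 0 := hs
    rw [hs', map_zero] at h1
    exact Ideal.mem_span_singleton.mp (Ideal.Quotient.eq_zero_iff_mem.mp h1.symm)
  · exact (π.commutes c).trans hcC'
  · exact eq_zero_of_algebraMap_mul_eq_zero hc
  · exact fun r ↦ π.commutes r
  · have : Θ.comp (π : S →+* C') = (mkA : A →+* _).comp (φ : S →+* A) := by
      apply hext
      intro h
      simp only [RingHom.comp_apply, RingHom.coe_coe, hπ, hφ, hmkA]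
      have : Θ.comp (aeval (R := R) (Sum.elim (fun i ↦ γC (P.val i)) fun j ↦ mkC (X j)) :
          H →+* C') = (aeval (R := R) (Sum.elim (fun i ↦ θ (P.val i)) fun j ↦ mkA (z j)) :
            H →+* _) := by
        apply MvPolynomial.ringHom_ext
        · intro r
          simp only [RingHom.comp_apply, RingHom.coe_coe, aeval_C]
          exact hΘR r
        · intro k
          simp only [RingHom.comp_apply, RingHom.coe_coe, aeval_X]
          rcases k with i | j
          · exact eval₂Hom_C _ _ _
          · exact eval₂Hom_X' _ _ _
      exact congr($this h)
    exact fun s ↦ congr($this s)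
  · intro g
    exact eval₂Hom_C _ _ _

end

/-! ### Descent of complete intersections along a congruence -/

section

open MvPolynomial

/-- If `R` and `Rh` agree modulo `t ^ 3`, then a factorization modulo `t ^ 3` through a complete
intersection `Rh`-algebra gives a factorization through a complete intersection `R`-algebra. -/
theorem JacobianData.exists_completeIntersection
    {R : Type u} [CommRing R] {t : R} {ι σ κ : Type} [Fintype ι] [Fintype σ] [Fintype κ]
    [DecidableEq σ] (d : JacobianData R t ι σ κ) (hc : ∀ r, t ^ 3 * r = 0 → r = 0)
    {A : Type u} [CommRing A] [IsDomain A] [IsLocalRing A] [Algebra R A]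
    (ht0 : algebraMap R A t ≠ 0) (htm : ¬ IsUnit (algebraMap R A t))
    (x : ι → A) (hx : ∀ j, aeval x (d.g j) = 0)
    {Rh : Type u} [CommRing Rh] [Algebra R Rh]
    (ρ : Rh →+* R ⧸ Ideal.span {t ^ 3}) (hρ : IsRegularQuotient ρ (algebraMap R Rh (t ^ 3)))
    (hρR : ∀ r, ρ (algebraMap R Rh r) = Ideal.Quotient.mk _ r)
    {D : Type u} [CommRing D] [Algebra Rh D] [Algebra R D] [IsScalarTower R Rh D]
    (hD : IsCompleteIntersectionAlgebra Rh D) (y : ι → D)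
    (hg : ∀ j, aeval y (d.g j) = 0) (he : ∀ j, aeval y (d.e j) = 0)
    (θ : D →ₐ[R] A ⧸ Ideal.span {algebraMap R A (t ^ 3)})
    (hθ : ∀ k, θ (y k) = Ideal.Quotient.mk _ (x k)) :
    ∃ (D : Type u) (_ : CommRing D) (_ : Algebra R D) (y : ι → D) (h : D →ₐ[R] A),
      IsCompleteIntersectionAlgebra R D ∧ (∀ k, h (y k) = x k) ∧ ∀ i, aeval y (d.e i) = 0 := by
  obtain ⟨G, _, _, L, hG, hL, ⟨ε⟩⟩ := hD
  have hcA : ¬ IsUnit (algebraMap R A (t ^ 3)) := by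
    rw [map_pow]
    exact fun h ↦ htm (isUnit_pow_iff three_ne_zero |>.mp h)
  let _ : Algebra R G := ((algebraMap Rh G).comp (algebraMap R Rh)).toAlgebra
  have : IsScalarTower R Rh G := .of_algebraMap_eq fun _ ↦ rfl
  let εR : D ≃ₐ[R] G ⧸ Ideal.ofList L := ε.restrictScalars R
  let q : G →ₐ[R] G ⧸ Ideal.ofList L := Ideal.Quotient.mkₐ R _
  have hqL : ∀ s ∈ Ideal.ofList L, q s = 0 := fun s hs ↦ Ideal.Quotient.eq_zero_iff_mem.mpr hs
  have hLq : ∀ s, q s = 0 → s ∈ Ideal.ofList L := fun s hs ↦ Ideal.Quotient.eq_zero_iff_mem.mp hs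
  let θG : G →ₐ[R] A ⧸ Ideal.span {algebraMap R A (t ^ 3)} :=
    (θ.comp (εR.symm : (G ⧸ Ideal.ofList L) →ₐ[R] D)).comp q
  have hθG (s : G) : θG s = θ (εR.symm (q s)) := rfl
  choose yG hyG using fun k ↦ Ideal.Quotient.mk_surjective (εR (y k))
  have hyG' (k) : q (yG k) = εR (y k) := hyG k
  have hmem (p : MvPolynomial ι R) (hp : aeval y p = 0) : aeval yG p ∈ Ideal.ofList L := by
    apply hLq
    rw [MvPolynomial.algHom_aeval]
    simp only [hyG']
    exact (MvPolynomial.algHom_aeval (εR : D →ₐ[R] G ⧸ Ideal.ofList L) y p).symm.trans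
      ((congrArg εR hp).trans (map_zero _))
  have : Nontrivial (A ⧸ Ideal.span {algebraMap R A (t ^ 3)}) :=
    Ideal.Quotient.nontrivial_iff.mpr (mt Ideal.span_singleton_eq_top.mp hcA)
  have : IsLocalRing (A ⧸ Ideal.span {algebraMap R A (t ^ 3)}) :=
    .of_surjective' (Ideal.Quotient.mk _) Ideal.Quotient.mk_surjective
  -- Standard smoothness is available only locally. Around this prime it is enough, as an element
  -- outside `p` becomes a unit in the local ring `A ⧸ t ^ 3`, and `θG` extends to the localization.
  let p : Ideal G := (IsLocalRing.maximalIdeal _).comap θG.toRingHom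
  have : p.IsPrime := Ideal.comap_isPrime _ _
  obtain ⟨f, hf, hstd⟩ := Algebra.IsSmoothAt.exists_notMem_isStandardSmooth Rh p
  have hfu : IsUnit (θG f) := by
    by_contra h
    exact hf h
  obtain ⟨ι', σ', _, _, ⟨P⟩⟩ := hstd.out
  have := Fintype.ofFinite σ'
  set Gf := Localization.Away f
  let θf : Gf →ₐ[R] A ⧸ Ideal.span {algebraMap R A (t ^ 3)} :=
    IsLocalization.liftAlgHom (M := Submonoid.powers f) (f := θG) (by
      rintro ⟨_, n, rfl⟩
      exact (map_pow θG f n).symm ▸ hfu.pow n)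
  have hθf (s : G) : θf (algebraMap G Gf s) = θG s := IsLocalization.lift_eq _ s
  obtain ⟨S, _, _, π, φ, Θ, hS, hπ, hπR, hΘ, hΘC⟩ := exists_smooth_lift hc hcA ρ hρ hρR P θf
  let Sh := MvPolynomial σ' Gf
  obtain ⟨n, v, hvL⟩ : ∃ (n : ℕ) (v : Fin n → G), (List.ofFn v).reverse = L :=
    ⟨_, L.reverse.get, by rw [List.ofFn_get, List.reverse_reverse]⟩
  have hspan : Ideal.ofList L = Ideal.span (Set.range v) := by
    rw [← hvL]
    simp only [Ideal.ofList, List.mem_reverse, List.mem_ofFn]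
    rfl
  have hreg : RevRegular n (fun i ↦ (C (algebraMap G Gf (v i)) : Sh)) := by
    apply RevRegular.mvPolynomial
    rw [← isWeaklyRegular_reverse_ofFn_iff]
    have := hL.1
    rw [← hvL] at this
    have := this.of_flat (S := Gf)
    rwa [List.map_reverse, List.map_ofFn] at this
  have hflat : Module.Flat Rh Sh := Module.Flat.trans Rh Gf Sh
  have hcSh : ∀ s, algebraMap R Sh (t ^ 3) * s = 0 → s = 0 := by
    intro s hs
    rw [IsScalarTower.algebraMap_apply R Rh Sh] at hs
    exact eq_zero_of_algebraMap_mul_eq_zero hρ.eq_zero_of_mul_eq_zero s hs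
  have hspan' (s : G) (hs : s ∈ Ideal.ofList L) : (C (algebraMap G Gf s) : Sh) ∈
      Ideal.span (Set.range fun i ↦ (C (algebraMap G Gf (v i)) : Sh)) := by
    rw [hspan] at hs
    have := Ideal.mem_map_of_mem ((C : Gf →+* Sh).comp (algebraMap G Gf)) hs
    rwa [Ideal.map_span, ← Set.range_comp] at this
  let γ : G →ₐ[R] Sh := ((IsScalarTower.toAlgHom R Gf Sh).comp (IsScalarTower.toAlgHom R G Gf))
  have haev (p : MvPolynomial ι R) : aeval (fun k ↦ (C (algebraMap G Gf (yG k)) : Sh)) p =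
      C (algebraMap G Gf (aeval yG p)) := (MvPolynomial.algHom_aeval γ yG p).symm
  have hdvd (a : A) (ha : Ideal.Quotient.mk (Ideal.span {algebraMap R A (t ^ 3)}) a = 0) :
      ∃ b, a = algebraMap R A t ^ 3 * b := by
    rw [← map_pow]
    exact Ideal.mem_span_singleton.mp (Ideal.Quotient.eq_zero_iff_mem.mp ha)
  refine d.exists_completeIntersection_of_isRegularQuotient ht0 htm x hx hπ
    (isRegularQuotient_mk hcSh) hπR (fun i ↦ (C (algebraMap G Gf (v i)) : Sh)) hreg
    (fun k ↦ C (algebraMap G Gf (yG k))) (fun j ↦ ?_) (fun j ↦ ?_) φ (fun i s hs ↦ ?_)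
    (fun k s hs ↦ ?_)
  · rw [haev]
    exact hspan' _ (hmem _ (hg j))
  · rw [haev]
    exact hspan' _ (hmem _ (he j))
  · apply hdvd
    rw [← hΘ, hs, hΘC, hθf, hθG, hqL, map_zero, map_zero]
    rw [hspan]
    exact Ideal.subset_span ⟨i, rfl⟩
  · have : ∃ b, x k - φ s = algebraMap R A t ^ 3 * b := by
      apply hdvd
      rw [map_sub, ← hΘ, hs, hΘC, hθf, hθG, hyG', AlgEquiv.symm_apply_apply, hθ, sub_self]
    obtain ⟨b, hb⟩ := this
    exact ⟨b, by rw [← hb]; ring⟩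

end

/-! ### Clearing denominators -/

section

open MvPolynomial

namespace MvPolynomial

variable {R ι : Type*} [CommRing R]

/-- The substitution that multiplies the variable with index `i` by `τ i`. -/
noncomputable def scaling (τ : ι → R) : MvPolynomial ι R →ₐ[R] MvPolynomial ι R :=
  aeval fun i ↦ C (τ i) * X i

@[simp]
lemma scaling_X (τ : ι → R) (i : ι) : scaling τ (X i) = C (τ i) * X i := aeval_X _ _

@[simp]
lemma scaling_C (τ : ι → R) (r : R) : scaling τ (C r) = C r := aeval_C _ _

lemma aeval_scaling {D : Type*} [CommRing D] [Algebra R D] (τ : ι → R) (x : ι → D)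
    (F : MvPolynomial ι R) :
    aeval x (scaling τ F) = aeval (fun i ↦ algebraMap R D (τ i) * x i) F := by
  rw [scaling, algHom_aeval]
  simp

lemma coeff_scaling (τ : ι → R) (F : MvPolynomial ι R) (m : ι →₀ ℕ) :
    coeff m (scaling τ F) = (m.prod fun i k ↦ τ i ^ k) * coeff m F := by
  classical
  induction F using MvPolynomial.induction_on' with
  | monomial s a =>
    rw [scaling, aeval_monomial, coeff_monomial, algebraMap_eq]
    have : (s.prod fun i k ↦ (C (τ i) * X i : MvPolynomial ι R) ^ k) =
        monomial s (s.prod fun i k ↦ τ i ^ k) := by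
      rw [monomial_eq, Finsupp.prod, Finsupp.prod, Finsupp.prod, map_prod,
        ← Finset.prod_mul_distrib]
      exact Finset.prod_congr rfl fun i _ ↦ by rw [mul_pow, map_pow]
    rw [this, C_mul_monomial, coeff_monomial]
    split_ifs with h
    · rw [h, mul_comm]
    · rw [mul_zero]
  | add p q hp hq => rw [map_add, coeff_add, coeff_add, hp, hq, mul_add]

lemma scaling_injective {τ : ι → R} (hτ : ∀ i, τ i ∈ nonZeroDivisors R) :
    Function.Injective (scaling τ) := by
  rw [injective_iff_map_eq_zero]
  intro F hF
  ext m
  have h := coeff_scaling τ F m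
  rw [hF, coeff_zero] at h
  have hm : (m.prod fun i k ↦ τ i ^ k) ∈ nonZeroDivisors R :=
    Submonoid.prod_mem _ fun i _ ↦ pow_mem (hτ i) _
  rw [coeff_zero]
  exact (mul_left_mem_nonZeroDivisors_eq_zero_iff hm).mp h.symm

lemma pderiv_scaling (τ : ι → R) (p : ι) (F : MvPolynomial ι R) :
    pderiv p (scaling τ F) = C (τ p) * scaling τ (pderiv p F) := by
  classical
  induction F using MvPolynomial.induction_on with
  | C r => simp
  | add F G hF hG => simp only [map_add, hF, hG, mul_add]
  | mul_X F i hF =>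
    simp only [map_mul, scaling_X, Derivation.leibniz, hF, pderiv_C, smul_eq_mul, map_add,
      pderiv_X, Pi.single_apply]
    split_ifs with h
    · subst h
      simp
      ring
    · simp
      ring

open Filter in
/-- Each polynomial becomes a scaled polynomial after multiplication by a high power of `t`. -/
lemma eventually_exists_scaling_eq {τ : ι → R} {t : R} (hτ : ∀ i, τ i ∣ t)
    (F : MvPolynomial ι R) : ∀ᶠ n in atTop, ∃ G, scaling τ G = C t ^ n * F := by
  suffices ∃ n, ∃ G, scaling τ G = C t ^ n * F by
    obtain ⟨n, G, hG⟩ := this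
    filter_upwards [eventually_ge_atTop n] with m hm
    exact ⟨C t ^ (m - n) * G, by
      rw [map_mul, map_pow, scaling_C, hG, ← mul_assoc, ← pow_add, Nat.sub_add_cancel hm]⟩
  induction F using MvPolynomial.induction_on with
  | C r => exact ⟨0, C r, by simp⟩
  | add F G hF hG =>
    obtain ⟨n, F', hF'⟩ := hF
    obtain ⟨m, G', hG'⟩ := hG
    exact ⟨n + m, C t ^ m * F' + C t ^ n * G', by
      simp only [map_add, map_mul, map_pow, scaling_C, hF', hG']; ring⟩
  | mul_X F i hF =>
    obtain ⟨n, F', hF'⟩ := hF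
    obtain ⟨s, hs⟩ := hτ i
    exact ⟨n + 1, F' * (C s * X i), by
      simp only [map_mul, scaling_C, hF', scaling_X, hs]; ring⟩

end MvPolynomial

open Filter in
/-- Clearing denominators: identities for a system with invertible Jacobian matrix yield a
`JacobianData` for the system in the scaled variables. -/
theorem exists_jacobianData_of_scaling {R : Type u} [CommRing R] {t : R}
    (ht : t ∈ nonZeroDivisors R) {ι σ κ : Type} [Fintype ι] [Fintype σ] [Finite κ] [DecidableEq σ]
    (τ : ι → R) (hτ : ∀ i, τ i ∣ t) (f : σ → MvPolynomial ι R) (e : κ → MvPolynomial ι R)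
    (he : ∀ i, scaling τ (e i) = e i) (hef : ∀ i, e i ∈ Ideal.span (Set.range f))
    (N : ι → σ → MvPolynomial ι R)
    (hN : ∀ j m, ∑ p, pderiv p (f j) * N p m - (if j = m then 1 else 0) ∈
      Ideal.span (Set.range f)) :
    ∃ n, n ≠ 0 ∧ ∃ d : JacobianData R (t ^ n) ι σ κ, d.e = e ∧
      ∃ m : ℕ, ∀ j, scaling τ (d.g j) = C t ^ m * f j := by
  have hτ0 (i : ι) : τ i ∈ nonZeroDivisors R := by
    obtain ⟨s, hs⟩ := hτ i
    rw [hs] at ht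
    exact (mul_mem_nonZeroDivisors.mp ht).1
  choose a ha using fun i ↦ Ideal.mem_span_range_iff_exists_fun.mp (hef i)
  choose θ hθ using fun j m ↦ Ideal.mem_span_range_iff_exists_fun.mp (hN j m)
  have hev (F : MvPolynomial ι R) := eventually_exists_scaling_eq hτ F
  -- One exponent `n` serves the finitely many polynomials `f`, `a`, `N`, `θ`.
  obtain ⟨n, hn, hf', ha', hN', hθ'⟩ := ((eventually_gt_atTop 0).and
    ((eventually_all.mpr fun j ↦ hev (f j)).and
    ((eventually_all.mpr fun i ↦ eventually_all.mpr fun j ↦ hev (a i j)).and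
    ((eventually_all.mpr fun p ↦ eventually_all.mpr fun j ↦ hev (N p j)).and
    (eventually_all.mpr fun j ↦ eventually_all.mpr fun m ↦ eventually_all.mpr fun l ↦
      hev (θ j m l)))))).exists
  choose f' hf' using hf'
  choose a' ha' using ha'
  choose N' hN' using hN'
  choose θ' hθ' using hθ'
  have hinj := scaling_injective hτ0
  -- Each identity is a product of two polynomials scaled by `t ^ n`, whence `2 * n`. The factor `τ
  -- p` in front of `N'` is the one which the chain rule produces when `f'` is scaled. The
  -- identities are checked after the injective map `scaling τ`.
  refine ⟨2 * n, by omega, ⟨f', e, a', fun i ↦ hinj ?_, fun p m ↦ C (τ p) * N' p m, θ',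
    fun j m ↦ hinj ?_⟩, rfl, n, hf'⟩
  · rw [map_mul, scaling_C, he, ← ha i, map_sum, Finset.mul_sum, map_pow]
    simp only [map_mul, hf', ha']
    exact Finset.sum_congr rfl fun j _ ↦ by ring
  · have h1 (p : ι) : scaling τ (pderiv p (f' j) * (C (τ p) * N' p m)) =
        C t ^ (2 * n) * (pderiv p (f j) * N p m) := by
      have := pderiv_scaling τ p (f' j)
      rw [hf', ← map_pow, pderiv_C_mul, map_pow] at this
      rw [map_mul, map_mul, scaling_C, hN']
      linear_combination C t ^ n * N p m * this.symm
    have h2 : ∑ p, pderiv p (f j) * N p m = (if j = m then 1 else 0) + ∑ l, θ j m l * f l := by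
      rw [hθ]; ring
    have h3 (l : σ) : scaling τ (θ' j m l * f' l) = C t ^ (2 * n) * (θ j m l * f l) := by
      rw [map_mul, hθ', hf']; ring
    rw [map_sum, map_add, map_sum]
    simp only [h1, h3, ← Finset.mul_sum, h2, mul_add]
    congr 1
    split_ifs <;> simp

/-- The quotient map onto `MvPolynomial (ι ⊕ τ) R` modulo `X (inr l) - p l` is the substitution
of `p l` for `X (inr l)`. -/
lemma MvPolynomial.sub_aeval_sumElim_mem {R ι τ : Type*} [CommRing R] (p : τ → MvPolynomial ι R)
    (F : MvPolynomial (ι ⊕ τ) R) :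
    F - rename Sum.inl (aeval (Sum.elim X p) F) ∈
      Ideal.span (Set.range fun l ↦ (X (Sum.inr l) - rename Sum.inl (p l) :
        MvPolynomial (ι ⊕ τ) R)) := by
  set I := Ideal.span (Set.range fun l ↦ (X (Sum.inr l) - rename Sum.inl (p l) :
        MvPolynomial (ι ⊕ τ) R))
  rw [← Ideal.Quotient.eq]
  have : Ideal.Quotient.mkₐ R I = ((Ideal.Quotient.mkₐ R I).comp (rename Sum.inl)).comp
      (aeval (Sum.elim X p)) := by
    apply algHom_ext
    rintro (i | l)
    · simp
    · simp only [AlgHom.comp_apply, aeval_X, Sum.elim_inr]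
      exact Ideal.Quotient.eq.mpr (Ideal.subset_span ⟨l, rfl⟩)
  exact congr($this F)

open MvPolynomial Matrix in
/-- A standard smooth algebra has a presentation with a right inverse of the Jacobian matrix,
such that the generators contain a given finite family. -/
theorem Algebra.IsStandardSmooth.exists_jacobian_inverse {V B : Type u} [CommRing V] [CommRing B]
    [Algebra V B] [Algebra.IsStandardSmooth V B] {τ : Type} [Finite τ] (y : τ → B) :
    ∃ (ι σ : Type) (_ : Finite ι) (_ : Fintype (ι ⊕ τ)) (_ : Fintype σ) (_ : DecidableEq σ)
      (x : ι → B) (f : σ → MvPolynomial (ι ⊕ τ) V) (N : ι ⊕ τ → σ → MvPolynomial (ι ⊕ τ) V),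
      (∀ F, aeval (Sum.elim x y) F = 0 ↔ F ∈ Ideal.span (Set.range f)) ∧
      ∀ j m, ∑ p, pderiv p (f j) * N p m - (if j = m then 1 else 0) ∈
        Ideal.span (Set.range f) := by
  classical
  obtain ⟨ι, σ, _, _, ⟨P⟩⟩ := Algebra.IsStandardSmooth.out (R := V) (S := B)
  have := Fintype.ofFinite ι
  have := Fintype.ofFinite σ
  have := Fintype.ofFinite τ
  obtain ⟨q, hq⟩ := P.aeval_val_surjective P.jacobian_isUnit.unit⁻¹.val
  choose p hp using fun l ↦ P.aeval_val_surjective (y l)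
  -- The prescribed elements `y l = p l (x)` become redundant generators, each with its own
  -- relation.
  let f : σ ⊕ τ → MvPolynomial (ι ⊕ τ) V := Sum.elim (fun j ↦ rename Sum.inl (P.relation j))
    fun l ↦ X (Sum.inr l) - rename Sum.inl (p l)
  let M : Matrix σ σ (MvPolynomial ι V) := P.jacobiMatrix
  -- The adjugate of the Jacobian minor times a lift `q` of the inverse of its determinant, extended
  -- by zero to the remaining rows.
  let N₀ : ι → σ → MvPolynomial ι V := fun i m ↦
    ∑ k, if P.map k = i then Mᵀ.adjugate k m * q else 0
  -- The inverse of a block triangular matrix; the lower left block compensates the derivatives `-∂p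
  -- l` of the new relations.
  let N : ι ⊕ τ → σ ⊕ τ → MvPolynomial (ι ⊕ τ) V := Sum.elim
    (fun i ↦ Sum.elim (fun m ↦ rename Sum.inl (N₀ i m)) 0)
    (fun l ↦ Sum.elim (fun m ↦ rename Sum.inl (∑ i, pderiv i (p l) * N₀ i m))
      fun l' ↦ if l = l' then 1 else 0)
  have hker (F : MvPolynomial (ι ⊕ τ) V) :
      aeval (Sum.elim P.val y) F = 0 ↔ F ∈ Ideal.span (Set.range f) := by
    constructor
    · intro hF
      have h1 : aeval P.val (aeval (Sum.elim X p) F) = 0 := by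
        rw [algHom_aeval, ← hF]
        congr 2
        funext k
        rcases k with i | l
        · simp
        · simp [hp]
      have h2 : aeval (Sum.elim X p) F ∈ Ideal.span (Set.range P.relation) := by
        rw [P.span_range_relation_eq_ker, P.ker_eq_ker_aeval_val]
        exact h1
      have h3 : rename Sum.inl (aeval (Sum.elim X p) F) ∈ Ideal.span (Set.range f) := by
        have := Ideal.mem_map_of_mem (rename (R := V) (Sum.inl : ι → ι ⊕ τ)) h2
        rw [Ideal.map_span, ← Set.range_comp] at this
        refine Ideal.span_mono ?_ this
        rintro _ ⟨j, rfl⟩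
        exact ⟨Sum.inl j, rfl⟩
      have h4 := Ideal.span_mono (by
        rintro _ ⟨l, rfl⟩
        exact ⟨Sum.inr l, rfl⟩ : _ ⊆ Set.range f) (sub_aeval_sumElim_mem p F)
      simpa using add_mem h4 h3
    · intro hF
      have : Ideal.span (Set.range f) ≤ RingHom.ker (aeval (R := V) (Sum.elim P.val y)) := by
        rw [Ideal.span_le]
        rintro _ ⟨j | l, rfl⟩
        · change aeval _ (rename Sum.inl (P.relation j)) = 0
          rw [aeval_rename, Sum.elim_comp_inl, P.aeval_val_relation]
        · change aeval _ (X (Sum.inr l) - rename Sum.inl (p l)) = 0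
          rw [map_sub, aeval_X, aeval_rename, Sum.elim_comp_inl, hp, Sum.elim_inr, sub_self]
      exact this hF
  have hJ (j m : σ) : ∑ i, pderiv i (P.relation j) * N₀ i m - (if j = m then 1 else 0) ∈
      Ideal.span (Set.range P.relation) := by
    rw [P.span_range_relation_eq_ker, P.ker_eq_ker_aeval_val]
    change aeval P.val _ = 0
    have h1 : ∑ i, pderiv i (P.relation j) * N₀ i m = (if j = m then M.det else 0) * q := by
      have h2 : ∑ i, pderiv i (P.relation j) * N₀ i m = ∑ k, Mᵀ j k * (Mᵀ.adjugate k m * q) := by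
        simp only [N₀, Finset.mul_sum]
        rw [Finset.sum_comm]
        refine Finset.sum_congr rfl fun k _ ↦ ?_
        rw [Finset.sum_eq_single (P.map k) (by
          intro b _ hb
          rw [if_neg hb.symm, mul_zero]) (by simp), if_pos rfl]
        congr 1
        exact (P.jacobiMatrix_apply k j).symm
      rw [h2]
      simp only [← mul_assoc]
      rw [← Finset.sum_mul, ← Matrix.mul_apply, Matrix.mul_adjugate, Matrix.smul_apply,
        Matrix.one_apply, Matrix.det_transpose, smul_eq_mul, mul_ite, mul_one, mul_zero]
    have h3 : aeval P.val M.det * aeval P.val q = 1 := by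
      rw [hq, ← P.algebraMap_apply, ← P.jacobian_eq_jacobiMatrix_det]
      exact P.jacobian_isUnit.mul_val_inv
    rw [h1, map_sub]
    split_ifs
    · rw [map_mul, h3, map_one, sub_self]
    · simp
  refine ⟨ι, σ ⊕ τ, inferInstance, inferInstance, inferInstance, inferInstance, P.val, f, N,
    hker, ?_⟩
  rintro (j | l) m
  · have h1 (F : MvPolynomial ι V) (l : τ) : pderiv (Sum.inr l) (rename Sum.inl F) = 0 :=
      pderiv_eq_zero_of_notMem_vars (by
        intro h
        have := vars_rename Sum.inl F h
        simp at this)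
    rw [Fintype.sum_sum_type]
    simp only [f, Sum.elim_inl, h1, zero_mul, Finset.sum_const_zero, add_zero,
      pderiv_rename Sum.inl_injective, N]
    rcases m with m | m
    · have := Ideal.mem_map_of_mem (rename (R := V) (Sum.inl : ι → ι ⊕ τ)) (hJ j m)
      rw [Ideal.map_span, ← Set.range_comp] at this
      have := Ideal.span_mono (by
        rintro _ ⟨j, rfl⟩
        exact ⟨Sum.inl j, rfl⟩ : _ ⊆ Set.range f) this
      simp only [map_sub, map_sum, map_mul] at this
      convert this using 2
      · rfl
      · simp only [Sum.inl.injEq]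
        split_ifs <;> simp
    · simp
  · have h1 (F : MvPolynomial ι V) (l : τ) : pderiv (Sum.inr l) (rename Sum.inl F) = 0 :=
      pderiv_eq_zero_of_notMem_vars (by
        intro h
        have := vars_rename Sum.inl F h
        simp at this)
    rw [Fintype.sum_sum_type]
    simp only [f, Sum.elim_inr, map_sub, h1, pderiv_rename Sum.inl_injective, N, sub_zero,
      pderiv_X, Pi.single_apply]
    rcases m with m | m
    · simp
    · simp

/-- A morphism from a finitely presented algebra to a domain, which is generically smooth, is
governed by a `JacobianData` over each `V`-algebra `R`, for suitable `t` in `R`. -/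
theorem exists_jacobianData {V E A : Type u} [CommRing V] [CommRing E] [CommRing A] [IsDomain A]
    [Algebra V E] [Algebra V A] [Algebra.FinitePresentation V E] (w : E →ₐ[V] A) {s : E}
    (hs : w s ≠ 0) [Algebra.IsStandardSmooth V (Localization.Away s)] :
    ∃ a : A, a ≠ 0 ∧ ∀ (R : Type u) [CommRing R] [Algebra V R] [Algebra R A] [IsScalarTower V R A]
      (t : R), t ∈ nonZeroDivisors R → a ∣ algebraMap R A t →
      ∃ (n : ℕ) (ι σ κ : Type) (_ : Fintype ι) (_ : Fintype σ) (_ : Fintype κ) (_ : DecidableEq σ)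
        (d : JacobianData R (t ^ n) ι σ κ) (x : ι → A), n ≠ 0 ∧
        (∀ j, aeval x (d.g j) = 0) ∧ (∀ k, aeval x (d.e k) = 0) ∧
        ∀ (D : Type u) [CommRing D] [Algebra R D] [Algebra V D] [IsScalarTower V R D]
          (h : D →ₐ[R] A) (y : ι → D), (∀ k, h (y k) = x k) → (∀ k, aeval y (d.e k) = 0) →
          ∃ g : E →ₐ[V] D, ∀ z, h (g z) = w z := by
  classical
  obtain ⟨n, π, hπ, r, hr⟩ := Algebra.FinitePresentation.out (R := V) (A := E)
  let y : Fin n → E := fun l ↦ π (X l)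
  have hπy : π = aeval y := (aeval_unique π).trans rfl
  obtain ⟨ι₀, σ, _, _, _, _, x₀, f, N, hf, hN⟩ :=
    Algebra.IsStandardSmooth.exists_jacobian_inverse (V := V)
      (fun l ↦ algebraMap E (Localization.Away s) (y l))
  let F := FractionRing A
  have hinj : Function.Injective (algebraMap A F) := IsFractionRing.injective A F
  let wF : Localization.Away s →ₐ[V] F :=
    IsLocalization.liftAlgHom (M := Submonoid.powers s)
      (f := (IsScalarTower.toAlgHom V A F).comp w) (by
      rintro ⟨_, n, rfl⟩
      exact (map_pow ((IsScalarTower.toAlgHom V A F).comp w) s n).symm ▸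
        (IsUnit.mk0 _ ((map_ne_zero_iff _ hinj).mpr hs)).pow n)
  have hwF (z : E) : wF (algebraMap E (Localization.Away s) z) = algebraMap A F (w z) :=
    IsLocalization.lift_eq _ z
  -- `a` is a common denominator of the values in `Frac A` of the generators of the localization.
  obtain ⟨⟨a, ha⟩, hax⟩ := IsLocalization.exist_integer_multiples_of_finite (nonZeroDivisors A)
    (fun i ↦ wF (x₀ i))
  choose b hb using hax
  simp only [Algebra.smul_def] at hb
  refine ⟨a, nonZeroDivisors.ne_zero ha, fun R _ _ _ _ t ht hat ↦ ?_⟩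
  obtain ⟨a', ha'⟩ := hat
  have : IsScalarTower V R F := .of_algebraMap_eq fun v ↦ by
    rw [IsScalarTower.algebraMap_apply V A F, IsScalarTower.algebraMap_apply V R A,
      ← IsScalarTower.algebraMap_apply R A F]
  -- Only the generators of the localization are scaled. Those of `E` already have values in `A`,
  -- and leaving them alone keeps the relations `e` of `E` unchanged, so that a zero of `e` is a map
  -- from `E`.
  let τ : ι₀ ⊕ Fin n → R := Sum.elim (fun _ ↦ t) fun _ ↦ 1
  let φ : MvPolynomial (ι₀ ⊕ Fin n) V →+* MvPolynomial (ι₀ ⊕ Fin n) R := map (algebraMap V R)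
  have hφspan (q) (hq : q ∈ Ideal.span (Set.range f)) :
      φ q ∈ Ideal.span (Set.range fun j ↦ φ (f j)) := by
    have := Ideal.mem_map_of_mem φ hq
    rwa [Ideal.map_span, ← Set.range_comp] at this
  let e : Fin r.card → MvPolynomial (ι₀ ⊕ Fin n) V := fun k ↦ rename Sum.inr (r.equivFin.symm k).1
  have hπr (k : r) : aeval y k.1 = 0 := by
    rw [← hπy]
    exact (hr ▸ Ideal.subset_span k.2 : k.1 ∈ RingHom.ker π.toRingHom)
  have he (k) : scaling τ (φ (e k)) = φ (e k) := by
    simp only [e, φ, map_rename]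
    rw [scaling, aeval_rename]
    have : (fun i ↦ C (τ i) * X i : ι₀ ⊕ Fin n → MvPolynomial (ι₀ ⊕ Fin n) R) ∘ Sum.inr =
        X ∘ Sum.inr := by
      funext l
      simp [τ]
    rw [this, ← aeval_rename, aeval_X_left_apply]
  have hef (k) : φ (e k) ∈ Ideal.span (Set.range fun j ↦ φ (f j)) := by
    refine hφspan _ ((hf _).mp ?_)
    rw [aeval_rename, Sum.elim_comp_inr]
    refine (algHom_aeval (IsScalarTower.toAlgHom V E (Localization.Away s)) y _).symm.trans ?_
    rw [hπr, map_zero]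
  have hφN (j m) : ∑ p, pderiv p (φ (f j)) * φ (N p m) - (if j = m then 1 else 0) ∈
      Ideal.span (Set.range fun j ↦ φ (f j)) := by
    have := hφspan _ (hN j m)
    simp only [map_sub, map_sum, map_mul] at this
    convert this using 2
    · refine Finset.sum_congr rfl fun p _ ↦ ?_
      rw [pderiv_map]
    · split_ifs <;> simp
  obtain ⟨M, hM, d, hde, m, hdg⟩ := exists_jacobianData_of_scaling ht τ
    (by rintro (i | l); exacts [dvd_rfl, one_dvd t]) (fun j ↦ φ (f j)) (fun k ↦ φ (e k))
    he hef (fun p m ↦ φ (N p m)) hφN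
  let x : ι₀ ⊕ Fin n → A := Sum.elim (fun i ↦ a' * b i) fun l ↦ w (y l)
  let ξ : ι₀ ⊕ Fin n → F := fun i ↦ wF (Sum.elim x₀
    (fun l ↦ algebraMap E (Localization.Away s) (y l)) i)
  have hxξ (i) : algebraMap A F (x i) = algebraMap R F (τ i) * ξ i := by
    rcases i with i | l
    · simp only [x, ξ, τ, Sum.elim_inl]
      rw [map_mul, hb, IsScalarTower.algebraMap_apply R A F, ha', map_mul]
      ring
    · simp only [x, ξ, τ, Sum.elim_inr]
      rw [map_one, one_mul, hwF]
  have hwy (k : r) : aeval (fun l ↦ w (y l)) k.1 = 0 := by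
    rw [← algHom_aeval, hπr, map_zero]
  refine ⟨M, ι₀ ⊕ Fin n, σ, Fin r.card, inferInstance, inferInstance, inferInstance,
    inferInstance, d, x, hM, fun j ↦ hinj ?_, fun k ↦ ?_, fun D _ _ _ _ h yD hyD heD ↦ ?_⟩
  · rw [map_zero]
    refine (algHom_aeval (IsScalarTower.toAlgHom R A F) x _).trans ?_
    simp only [IsScalarTower.coe_toAlgHom', hxξ]
    rw [← aeval_scaling, hdg, map_mul, aeval_map_algebraMap, ← algHom_aeval,
      (hf _).mpr (Ideal.subset_span ⟨j, rfl⟩), map_zero, mul_zero]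
  · rw [hde]
    simp only [e, φ, map_rename]
    rw [aeval_rename, aeval_map_algebraMap]
    exact hwy _
  · have hk : RingHom.ker π.toRingHom ≤ RingHom.ker (aeval (R := V) fun l ↦ yD (Sum.inr l)) := by
      rw [← hr, Ideal.span_le]
      intro q hq
      have := heD (r.equivFin ⟨q, hq⟩)
      rw [hde] at this
      simp only [e, φ, map_rename, Equiv.symm_apply_apply] at this
      rw [aeval_rename, aeval_map_algebraMap] at this
      exact this
    refine ⟨AlgHom.liftOfSurjective π hπ _ hk, fun z ↦ ?_⟩
    obtain ⟨q, rfl⟩ := hπ z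
    refine (congrArg h (AlgHom.liftOfSurjective_apply π hπ _ hk q)).trans ?_
    refine (algHom_aeval (h.restrictScalars V) _ q).trans ?_
    rw [hπy, algHom_aeval]
    congr 2
    funext l
    exact hyD _

end

/-! ### Completions of valuation rings -/

section

open Topology UniformSpace

section AdicCompletion

variable {V : Type u} [CommRing V] [UniformSpace V] [IsUniformAddGroup V] [IsTopologicalRing V]

/-- A ring homomorphism which is continuous for the discrete topology extends to the completion. -/
lemma UniformSpace.Completion.exists_extension_of_discrete {B : Type u} [CommRing B] (q : V →+* B)
    (hq : (RingHom.ker q : Set V) ∈ 𝓝 (0 : V)) :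
    ∃ ρ : Completion V →+* B, (∀ v : V, ρ v = q v) ∧ ∀ a, IsOpen (ρ ⁻¹' {a}) := by
  let _ : UniformSpace B := ⊥
  have : DiscreteTopology B := inferInstance
  have : IsTopologicalRing B := inferInstance
  have hcont : Continuous q := by
    refine continuous_of_continuousAt_zero q ?_
    rw [ContinuousAt, map_zero, nhds_discrete B, Filter.tendsto_pure]
    exact hq
  exact ⟨Completion.extensionHom q hcont, fun v ↦ Completion.extensionHom_coe q hcont v,
    fun a ↦ (isOpen_discrete _).preimage (Completion.continuous_extension (f := q))⟩

/-- The projection from the completion to a discrete quotient ring. -/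
lemma UniformSpace.Completion.exists_residue {c : V} (hc : {x | c ∣ x} ∈ 𝓝 (0 : V)) :
    ∃ ρ : Completion V →+* V ⧸ Ideal.span {c}, (∀ v : V, ρ v = Ideal.Quotient.mk _ v) ∧
      ∀ a, IsOpen (ρ ⁻¹' {a}) := by
  apply Completion.exists_extension_of_discrete
  filter_upwards [hc] with x hx
  exact Ideal.Quotient.eq_zero_iff_mem.mpr (Ideal.mem_span_singleton.mpr hx)

variable {c : V} {ρ : Completion V →+* V ⧸ Ideal.span {c}}

lemma UniformSpace.Completion.mem_closure_of_residue_eq_zero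
    (hρ : ∀ v : V, ρ v = Ideal.Quotient.mk _ v)
    (hopen : ∀ a, IsOpen (ρ ⁻¹' {a})) {x : Completion V} (hx : ρ x = 0) :
    x ∈ closure (((↑) : V → Completion V) '' {v | c ∣ v}) := by
  rw [mem_closure_iff]
  intro U hU hxU
  obtain ⟨v, hv⟩ := Completion.denseRange_coe.exists_mem_open (hU.inter (hopen 0)) ⟨x, hxU, hx⟩
  refine ⟨v, hv.1, v, ?_, rfl⟩
  have := hv.2
  rw [Set.mem_preimage, hρ, Set.mem_singleton_iff, Ideal.Quotient.eq_zero_iff_mem,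
    Ideal.mem_span_singleton] at this
  exact this

/-- A discrete ring is its own completion. -/
lemma UniformSpace.Completion.bijective_coe_of_discrete (h0 : {0} ∈ 𝓝 (0 : V)) :
    Function.Bijective ((↑) : V → Completion V) := by
  have hc : {x | (0 : V) ∣ x} ∈ 𝓝 (0 : V) := by
    simpa [zero_dvd_iff] using h0
  obtain ⟨ρ, hρ, hopen⟩ := Completion.exists_residue hc
  constructor
  · intro v w h
    have := congrArg ρ h
    rw [hρ, hρ, Ideal.Quotient.eq, Ideal.mem_span_singleton, zero_dvd_iff, sub_eq_zero] at this
    exact this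
  · intro x
    obtain ⟨v, hv⟩ := Ideal.Quotient.mk_surjective (ρ x)
    refine ⟨v, ?_⟩
    have := Completion.mem_closure_of_residue_eq_zero (x := x - v) hρ hopen (by
      rw [map_sub, hρ, hv, sub_self])
    simp only [zero_dvd_iff, Set.ofPred_eq_eq_singleton, Set.image_singleton,
      Completion.coe_zero, closure_singleton, Set.mem_singleton_iff, sub_eq_zero] at this
    exact this.symm

/-- If the topology of `V` is given by the principal ideals, then `V` and its completion agree
modulo each nonzero element of `V`. -/
lemma UniformSpace.Completion.isRegularQuotient_residue [IsDomain V]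
    (hnhds : ∀ c : V, c ≠ 0 → {x | c ∣ x} ∈ 𝓝 (0 : V))
    (hbasis : ∀ s ∈ 𝓝 (0 : V), ∃ c : V, c ≠ 0 ∧ {x | c ∣ x} ⊆ s) (hc : c ≠ 0)
    (hρ : ∀ v : V, ρ v = Ideal.Quotient.mk _ v) (hopen : ∀ a, IsOpen (ρ ⁻¹' {a})) :
    IsRegularQuotient ρ (c : Completion V) := by
  choose r hr hro using fun d : {d : V // d ≠ 0} ↦ Completion.exists_residue (hnhds d.1 d.2)
  -- the kernels of the projections are a basis of neighbourhoods of zero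
  have hker (W : Set (Completion V)) (hW : W ∈ 𝓝 0) : ∃ d, ∀ x, r d x = 0 → x ∈ W := by
    obtain ⟨W', hW', hcl, hsub⟩ := exists_mem_nhds_isClosed_subset hW
    have : ((↑) : V → Completion V) ⁻¹' W' ∈ 𝓝 (0 : V) :=
      (Completion.continuous_coe V).continuousAt.preimage_mem_nhds (by rwa [Completion.coe_zero])
    obtain ⟨d, hd0, hd⟩ := hbasis _ this
    refine ⟨⟨d, hd0⟩, fun x hx ↦ hsub (hcl.closure_subset_iff.mpr ?_
      (Completion.mem_closure_of_residue_eq_zero (hr _) (hro _) hx))⟩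
    rintro _ ⟨v, hv, rfl⟩
    exact hd hv
  -- Replacing `x` by an element `v` of `V` with the same residues reduces this to cancelling `c` in
  -- `c * d ∣ c * v`.
  have hmul (d : {d : V // d ≠ 0}) (x : Completion V)
      (hx : r ⟨c * d.1, mul_ne_zero hc d.2⟩ (c * x) = 0) : r d x = 0 := by
    obtain ⟨v, hv1, hv2⟩ := Completion.denseRange_coe.exists_mem_open
      ((hro d (r d x)).inter (hro ⟨c * d.1, mul_ne_zero hc d.2⟩ (r _ x))) ⟨x, rfl, rfl⟩
    rw [Set.mem_preimage, Set.mem_singleton_iff] at hv1 hv2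
    rw [map_mul, ← hv2, ← map_mul, ← Completion.coe_mul, hr, Ideal.Quotient.eq_zero_iff_mem,
      Ideal.mem_span_singleton, mul_dvd_mul_iff_left hc] at hx
    rw [← hv1, hr, Ideal.Quotient.eq_zero_iff_mem, Ideal.mem_span_singleton]
    exact hx
  have hind : IsUniformInducing (AddMonoidHom.mulLeft (c : Completion V)) := by
    apply AddMonoidHom.isUniformInducing_of_isInducing
    rw [IsTopologicalAddGroup.isInducing_iff_nhds_zero]
    refine le_antisymm ?_ fun W hW ↦ ?_
    · rw [← Filter.map_le_iff_le_comap]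
      have : Continuous (AddMonoidHom.mulLeft (c : Completion V)) := continuous_const_mul _
      simpa [ContinuousAt, Filter.Tendsto] using this.continuousAt (x := 0)
    · obtain ⟨d, hd⟩ := hker W hW
      refine ⟨_, (hro ⟨c * d.1, mul_ne_zero hc d.2⟩ 0).mem_nhds (map_zero _), fun x hx ↦
        hd x (hmul d x hx)⟩
  refine ⟨fun x ↦ ?_, fun x hx ↦ ?_, ?_, fun x hx ↦ ?_⟩
  · obtain ⟨v, hv⟩ := Ideal.Quotient.mk_surjective x
    exact ⟨v, (hρ v).trans hv⟩
  -- Multiplication by `c` is a uniform embedding, so its range is complete and hence closed. It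
  -- contains the multiples of `c` in `V`, which are dense in the kernel of `ρ`.
  · have hcl := hind.isComplete_range.isClosed
    have : x ∈ Set.range (AddMonoidHom.mulLeft (c : Completion V)) := by
      refine hcl.closure_subset_iff.mpr ?_ (Completion.mem_closure_of_residue_eq_zero hρ hopen hx)
      rintro _ ⟨_, ⟨v, rfl⟩, rfl⟩
      exact ⟨v, (Completion.coe_mul c v).symm⟩
    obtain ⟨y, hy⟩ := this
    exact ⟨y, hy.symm⟩
  · rw [hρ, Ideal.Quotient.eq_zero_iff_mem]
    exact Ideal.mem_span_singleton_self c
  · by_contra h0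
    obtain ⟨d, hd⟩ := hker {x}ᶜ (isOpen_compl_singleton.mem_nhds (Ne.symm h0))
    exact hd x (hmul d x (by rw [hx, map_zero])) rfl

end AdicCompletion

namespace ValRing

section

variable (V : Type u) [CommRing V] [IsDomain V] [ValuationRing V]

lemma valuation_le_iff (x y : V) : valuation V x ≤ valuation V y ↔ y ∣ x := by
  change (∃ c : V, c • algebraMap V (FractionRing V) y = algebraMap V (FractionRing V) x) ↔ _
  simp only [Algebra.smul_def, ← map_mul, (IsFractionRing.injective V (FractionRing V)).eq_iff]
  exact ⟨fun ⟨c, hc⟩ ↦ ⟨c, by rw [← hc, mul_comm]⟩, fun ⟨c, hc⟩ ↦ ⟨c, by rw [hc, mul_comm]⟩⟩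

lemma valuation_ne_zero {x : V} (hx : x ≠ 0) : valuation V x ≠ 0 := by
  intro h
  rw [← map_zero (valuation V)] at h
  exact hx (zero_dvd_iff.mp ((valuation_le_iff V _ _).mp h.le))

attribute [local instance] valued

lemma setOf_dvd_mem_nhds {c : V} (hc : c ≠ 0) : {x | c ∣ x} ∈ 𝓝 (0 : V) := by
  rw [Valued.mem_nhds_zero]
  refine ⟨Units.mk0 (Valued.v.restrict c) ?_, fun x hx ↦ ?_⟩
  · rw [Ne, Valuation.restrict_eq_zero_iff]
    exact valuation_ne_zero V hc
  · have : Valued.v.restrict x < Valued.v.restrict c := hx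
    rw [Valuation.restrict_lt_iff] at this
    exact (valuation_le_iff V x c).mp this.le

/-- A basic neighbourhood is `v x < γ` with `γ = v (a / b)`. Multiples of `a` satisfy only `v x ≤
γ`; an extra nonunit factor `p` makes the inequality strict, and exists because `V` is not a field.
-/
lemma exists_setOf_dvd_subset (hV : ¬ IsField V) (s : Set V) (hs : s ∈ 𝓝 (0 : V)) :
    ∃ c : V, c ≠ 0 ∧ {x | c ∣ x} ⊆ s := by
  obtain ⟨p, hp0, hp⟩ := Ring.exists_not_isUnit_of_not_isField hV
  obtain ⟨γ, hγ⟩ := Valued.mem_nhds_zero.mp hs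
  obtain ⟨k, hk'⟩ : ∃ k, ValuationRing.valuation V (FractionRing V) k =
    MonoidWithZeroHom.ValueGroup₀.embedding γ.1 := Quotient.exists_rep _
  obtain ⟨a, b, hb, rfl⟩ := IsFractionRing.div_surjective V k
  have hγ0 : MonoidWithZeroHom.ValueGroup₀.embedding γ.1 ≠ 0 := by simp
  have hvb : ValuationRing.valuation V (FractionRing V) (algebraMap V _ b) ≤ 1 :=
    ((ValuationRing.mem_integer_iff V (FractionRing V) _).mpr ⟨b, rfl⟩ : _)
  have hb0 : algebraMap V (FractionRing V) b ≠ 0 :=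
    IsFractionRing.to_map_ne_zero_of_mem_nonZeroDivisors hb
  have hva : valuation V a ≤ MonoidWithZeroHom.ValueGroup₀.embedding γ.1 := by
    have : algebraMap V (FractionRing V) a =
        algebraMap V _ a / algebraMap V _ b * algebraMap V _ b := by field_simp
    change ValuationRing.valuation V (FractionRing V) (algebraMap V _ a) ≤ _
    rw [this, map_mul, hk']
    exact mul_le_of_le_one_right' hvb
  have ha0 : a ≠ 0 := by
    rintro rfl
    rw [map_zero, zero_div, map_zero] at hk'
    exact hγ0 hk'.symm
  refine ⟨p * a, mul_ne_zero hp0 ha0, fun x hx ↦ hγ ?_⟩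
  change Valued.v.restrict x < γ.1
  rw [Valuation.restrict_lt_iff_lt_embedding]
  refine lt_of_lt_of_le ?_ hva
  change valuation V x < valuation V a
  rw [← not_le, valuation_le_iff]
  rintro ⟨d, hd⟩
  obtain ⟨e, he⟩ := hx
  apply hp
  refine IsUnit.of_mul_eq_one (e * d) (mul_left_cancel₀ ha0 ?_)
  rw [he] at hd
  rw [mul_one]
  conv_rhs => rw [hd]
  ring

lemma singleton_zero_mem_nhds (hV : IsField V) : {0} ∈ 𝓝 (0 : V) := by
  have : DiscreteTopology V := Valued.discreteTopology_of_forall_map_eq_one fun x hx ↦ by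
    obtain ⟨y, hy⟩ := hV.mul_inv_cancel hx
    change valuation V x = 1
    rw [← map_one (valuation V)]
    exact le_antisymm ((valuation_le_iff V _ _).mpr (one_dvd _))
      ((valuation_le_iff V _ _).mpr ⟨y, hy.symm⟩)
  exact (isOpen_discrete _).mem_nhds rfl

/-- The map from a valuation ring to its completion. -/
noncomputable def toCompletion : V →+* Completion V :=
  (UniformSpace.Completion.coeRingHom : V →+* UniformSpace.Completion V)

lemma bijective_toCompletion (hV : IsField V) : Function.Bijective (toCompletion V) :=
  UniformSpace.Completion.bijective_coe_of_discrete (singleton_zero_mem_nhds V hV)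

lemma exists_residue {c : V} (hc : c ≠ 0) : ∃ ρ : Completion V →+* V ⧸ Ideal.span {c},
    ∀ v, ρ (toCompletion V v) = Ideal.Quotient.mk _ v :=
  (UniformSpace.Completion.exists_residue (setOf_dvd_mem_nhds V hc)).imp fun _ h ↦ h.1

lemma exists_isRegularQuotient_residue (hV : ¬ IsField V) {c : V} (hc : c ≠ 0) :
    ∃ ρ : Completion V →+* V ⧸ Ideal.span {c},
      (∀ v, ρ (toCompletion V v) = Ideal.Quotient.mk _ v) ∧
      IsRegularQuotient ρ (toCompletion V c) := by
  obtain ⟨ρ, hρ, hopen⟩ := UniformSpace.Completion.exists_residue (setOf_dvd_mem_nhds V hc)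
  exact ⟨ρ, hρ, UniformSpace.Completion.isRegularQuotient_residue
    (fun c hc ↦ setOf_dvd_mem_nhds V hc) (exists_setOf_dvd_subset V hV) hc hρ hopen⟩

variable {V} {V' : Type v} [CommRing V'] [IsDomain V'] [ValuationRing V'] [Algebra V V']

lemma completionMap_toCompletion (h : IsContinuousExtension V V') (x : V) :
    completionMap h (toCompletion V x) = toCompletion V' (algebraMap V V' x) :=
  UniformSpace.Completion.map_coe
    (uniformContinuous_addMonoidHom_of_continuous (f := (algebraMap V V' : V →+ V')) h) x

/-- The multiples of `a` form a neighbourhood of zero in `V'`, so by continuity their preimage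
contains all multiples of some nonzero `c`. -/
lemma IsContinuousExtension.exists_dvd (h : IsContinuousExtension V V') (hV : ¬ IsField V)
    {a : V'} (ha : a ≠ 0) : ∃ c : V, c ≠ 0 ∧ a ∣ algebraMap V V' c := by
  have hc : Continuous (algebraMap V V') := h
  have : algebraMap V V' ⁻¹' {x | a ∣ x} ∈ 𝓝 (0 : V) :=
    hc.continuousAt.preimage_mem_nhds (by rw [map_zero]; exact setOf_dvd_mem_nhds V' ha)
  obtain ⟨c, hc0, hc⟩ := exists_setOf_dvd_subset V hV _ this
  exact ⟨c, hc0, hc (dvd_refl c)⟩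

end

end ValRing

end

/-! ### Filtered colimits of algebras through factorization -/

section

open CategoryTheory Limits

section IndAlgebras

variable {A : Type u} [CommRing A]

/-- Allows a filtered colimit of algebras to be checked on underlying sets. -/
instance : PreservesFilteredColimits (forget (CommAlgCat.{u} A)) where
  preserves_filtered_colimits J _ _ := by
    have : PreservesColimitsOfShape J (Under.forget (CommRingCat.of A)) := inferInstance
    have h : PreservesColimitsOfShape J ((commAlgCatEquivUnder (.of A)).functor ⋙
      Under.forget (CommRingCat.of A) ⋙ forget CommRingCat.{u}) := inferInstance
    exact h

/-- A morphism from a finitely presented algebra to a filtered colimit factors through one of the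
objects of the diagram. -/
lemma CategoryTheory.ObjectProperty.ind.exists_algHom_factorization
    {P : ObjectProperty (CommAlgCat.{u} A)} {B E : Type u} [CommRing B] [Algebra A B]
    (hB : ObjectProperty.ind.{u} P (CommAlgCat.of A B)) [CommRing E] [Algebra A E] [Algebra.FinitePresentation A E]
    (f : E →ₐ[A] B) :
    ∃ (D : CommAlgCat.{u} A) (g : E →ₐ[A] D) (h : D →ₐ[A] B), P D ∧ h.comp g = f := by
  obtain ⟨J, _, _, pres, hP⟩ := hB
  let e := commAlgCatEquivUnder (.of A)
  let Z : Under (CommRingCat.of A) := e.functor.obj (CommAlgCat.of (CommRingCat.of A) E)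
  have : IsFinitelyPresentable.{u} Z :=
    CommRingCat.isFinitelyPresentable_under _ _ (by
      change (algebraMap A E).FinitePresentation
      rw [RingHom.finitePresentation_algebraMap]
      infer_instance)
  obtain ⟨j, p, hp⟩ := IsFinitelyPresentable.exists_hom_of_isColimit (X := Z) (pres.map e.functor).isColimit
    (e.functor.map (CommAlgCat.ofHom f))
  obtain ⟨p, rfl⟩ := e.functor.map_surjective p
  refine ⟨pres.diag.obj j, p.hom, (pres.ι.app j).hom, hP j, ?_⟩
  have h : p ≫ pres.ι.app j = CommAlgCat.ofHom f := e.functor.map_injective (by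
    rw [Functor.map_comp, ← hp]
    simp
    rfl)
  rw [← CommAlgCat.hom_comp, h, CommAlgCat.hom_ofHom]

/-- The objects over `B` which satisfy `P`, as finitely presented algebras with chosen
presentations. -/
structure PresentedOver (P : ObjectProperty (CommAlgCat.{u} A)) (B : Type u) [CommRing B]
    [Algebra A B] where
  n : ℕ
  I : Ideal (MvPolynomial (Fin n) A)
  prop : P (CommAlgCat.of A (MvPolynomial (Fin n) A ⧸ I))
  map : (MvPolynomial (Fin n) A ⧸ I) →ₐ[A] B

namespace PresentedOver

variable {P : ObjectProperty (CommAlgCat.{u} A)} {B : Type u} [CommRing B] [Algebra A B]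

/-- The underlying algebra. -/
abbrev Carrier (X : PresentedOver P B) : Type u := MvPolynomial (Fin X.n) A ⧸ X.I

noncomputable instance : SmallCategory (PresentedOver P B) where
  Hom X Y := {f : X.Carrier →ₐ[A] Y.Carrier // Y.map.comp f = X.map}
  id X := ⟨AlgHom.id A _, AlgHom.comp_id _⟩
  comp f g := ⟨g.1.comp f.1, by rw [← AlgHom.comp_assoc, g.2, f.2]⟩

variable (P B) in
/-- The diagram of the algebras that satisfy `P`, over `B`. -/
noncomputable def diag : PresentedOver P B ⥤ CommAlgCat.{u} A where
  obj X := CommAlgCat.of A X.Carrier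
  map f := CommAlgCat.ofHom f.1

variable (P B) in
/-- The canonical cocone with point `B`. -/
noncomputable def cocone : Cocone (diag P B) where
  pt := CommAlgCat.of A B
  ι.app X := CommAlgCat.ofHom X.map
  ι.naturality X Y f := by
    ext x
    exact congr($(f.2) x)

variable [P.IsClosedUnderIsomorphisms]
  (hP : ∀ (D : Type u) [CommRing D] [Algebra A D], P (CommAlgCat.of A D) →
    Algebra.FinitePresentation A D)
  (hB : ∀ (E : Type u) [CommRing E] [Algebra A E] [Algebra.FinitePresentation A E]
    (f : E →ₐ[A] B), ∃ (D : Type u) (_ : CommRing D) (_ : Algebra A D) (g : E →ₐ[A] D)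
      (h : D →ₐ[A] B), P (CommAlgCat.of A D) ∧ h.comp g = f)

include hP hB in
-- Finite presentation lets the intermediate algebra be replaced by a quotient of a polynomial ring
-- in `Fin n` variables; such quotients form a small index category.
lemma exists_factorization (E : Type u) [CommRing E] [Algebra A E]
    [Algebra.FinitePresentation A E] (f : E →ₐ[A] B) :
    ∃ (X : PresentedOver P B) (g : E →ₐ[A] X.Carrier), X.map.comp g = f := by
  obtain ⟨D, _, _, g, h, hD, rfl⟩ := hB E f
  obtain ⟨n, π, hπ, -⟩ := (hP D hD).out
  let e := Ideal.quotientKerAlgEquivOfSurjective hπ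
  exact ⟨⟨n, _, P.prop_of_iso (CommAlgCat.isoMk e).symm hD, h.comp e.toAlgHom⟩,
    e.symm.toAlgHom.comp g, by ext; simp⟩

omit [P.IsClosedUnderIsomorphisms] in
include hP in
lemma finitePresentation_carrier (X : PresentedOver P B) :
    Algebra.FinitePresentation A X.Carrier := hP _ X.prop

include hP hB in
/-- Finitely many equations which hold in `B` hold after a transition map. -/
lemma exists_hom_of_map_eq {X : PresentedOver P B} {κ : Type} [Finite κ] (x y : κ → X.Carrier)
    (h : ∀ k, X.map (x k) = X.map (y k)) : ∃ (Y : PresentedOver P B) (f : X ⟶ Y),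
      ∀ k, f.1 (x k) = f.1 (y k) := by
  let I : Ideal X.Carrier := Ideal.span (Set.range fun k ↦ x k - y k)
  have := finitePresentation_carrier hP X
  have : Algebra.FinitePresentation A (X.Carrier ⧸ I) :=
    Algebra.FinitePresentation.quotient (Submodule.fg_span (Set.finite_range _))
  have hI : ∀ a ∈ I, X.map a = 0 := by
    have : I ≤ RingHom.ker X.map := by
      rw [Ideal.span_le]
      rintro _ ⟨k, rfl⟩
      simp [h]
    exact fun a ha ↦ this ha
  obtain ⟨Y, g, hg⟩ := exists_factorization hP hB (X.Carrier ⧸ I) (Ideal.Quotient.liftₐ I X.map hI)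
  refine ⟨Y, ⟨g.comp (Ideal.Quotient.mkₐ A I), ?_⟩, fun k ↦ ?_⟩
  · rw [← AlgHom.comp_assoc, hg]
    exact Ideal.Quotient.liftₐ_comp _ _ _
  · exact congrArg g (Ideal.Quotient.eq.mpr (Ideal.subset_span ⟨k, rfl⟩))

include hP hB in
-- Two objects are dominated by a factorization of the map from their tensor product. Two parallel
-- maps agree over `B`, and need to be equalized on finitely many generators only.
lemma isFiltered : IsFiltered (PresentedOver P B) where
  nonempty := ⟨(exists_factorization hP hB A (Algebra.ofId A B)).choose⟩
  cocone_objs X Y := by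
    have := finitePresentation_carrier hP X
    have := finitePresentation_carrier hP Y
    have : Algebra.FinitePresentation A (TensorProduct A X.Carrier Y.Carrier) :=
      Algebra.FinitePresentation.trans A X.Carrier (TensorProduct A X.Carrier Y.Carrier)
    obtain ⟨Z, g, hg⟩ := exists_factorization hP hB
      (TensorProduct A X.Carrier Y.Carrier)
      (Algebra.TensorProduct.lift X.map Y.map fun _ _ ↦ Commute.all _ _)
    refine ⟨Z, ⟨g.comp Algebra.TensorProduct.includeLeft, ?_⟩,
      ⟨g.comp Algebra.TensorProduct.includeRight, ?_⟩, trivial⟩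
    · rw [← AlgHom.comp_assoc, hg, Algebra.TensorProduct.lift_comp_includeLeft]
    · rw [← AlgHom.comp_assoc, hg]
      ext; simp
  cocone_maps X Y f g := by
    obtain ⟨Z, h, hh⟩ := exists_hom_of_map_eq hP hB
      (fun i ↦ f.1 (Ideal.Quotient.mk _ (MvPolynomial.X i)))
      (fun i ↦ g.1 (Ideal.Quotient.mk _ (MvPolynomial.X i)))
      fun i ↦ congr($(f.2.trans g.2.symm) (Ideal.Quotient.mk _ (MvPolynomial.X i)))
    refine ⟨Z, h, Subtype.ext ?_⟩
    apply Ideal.Quotient.algHom_ext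
    apply MvPolynomial.algHom_ext
    exact hh

include hP hB in
-- On underlying sets: each element of `B` is the value of a map from a polynomial ring in one
-- variable, and two elements with the same image in `B` are identified by a transition map.
lemma nonempty_isColimit_cocone : Nonempty (IsColimit (cocone P B)) := by
  have := isFiltered hP hB
  have : IsColimit ((forget (CommAlgCat.{u} A)).mapCocone (cocone P B)) := by
    refine Types.FilteredColimit.isColimitOf _ _ (fun b ↦ ?_) fun X Y x y h ↦ ?_
    · obtain ⟨X, g, hg⟩ := exists_factorization hP hB (MvPolynomial (Fin 1) A)
        (MvPolynomial.aeval fun _ ↦ (b : B))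
      refine ⟨X, g (MvPolynomial.X 0), ?_⟩
      have := congr($hg (MvPolynomial.X 0))
      exact (this.trans (MvPolynomial.aeval_X _ _)).symm
    · obtain ⟨Z, f, g, -⟩ := IsFilteredOrEmpty.cocone_objs X Y
      obtain ⟨W, k, hk⟩ := exists_hom_of_map_eq (κ := Unit) hP hB (fun _ ↦ f.1 x) (fun _ ↦ g.1 y)
        fun _ ↦ (congr($(f.2) x)).trans (h.trans (congr($(g.2) y)).symm)
      exact ⟨W, f ≫ k, g ≫ k, hk ()⟩
  have : ReflectsColimit (diag P B) (forget (CommAlgCat.{u} A)) :=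
    reflectsColimit_of_reflectsIsomorphisms _ _
  exact ⟨isColimitOfReflects (forget (CommAlgCat.{u} A)) ‹_›⟩

end PresentedOver

/-- If each morphism from a finitely presented algebra to `B` factors through a finitely presented
algebra that satisfies `P`, then `B` is a filtered colimit of such algebras. -/
theorem CategoryTheory.ObjectProperty.ind_of_forall_exists_factorization
    {P : ObjectProperty (CommAlgCat.{u} A)} {B : Type u} [CommRing B] [Algebra A B]
    [P.IsClosedUnderIsomorphisms]
    (hP : ∀ (D : Type u) [CommRing D] [Algebra A D], P (CommAlgCat.of A D) →
      Algebra.FinitePresentation A D)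
    (hB : ∀ (E : Type u) [CommRing E] [Algebra A E] [Algebra.FinitePresentation A E]
      (f : E →ₐ[A] B), ∃ (D : Type u) (_ : CommRing D) (_ : Algebra A D) (g : E →ₐ[A] D)
        (h : D →ₐ[A] B), P (CommAlgCat.of A D) ∧ h.comp g = f) :
    ObjectProperty.ind.{u} P (CommAlgCat.of A B) := by
  obtain ⟨hc⟩ := PresentedOver.nonempty_isColimit_cocone hP hB
  exact ⟨PresentedOver P B, inferInstance, PresentedOver.isFiltered hP hB,
    ⟨PresentedOver.diag P B, (PresentedOver.cocone P B).ι, hc⟩, fun X ↦ X.prop⟩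

end IndAlgebras

lemma IsCompleteIntersectionAlgebra.finitePresentation {A D : Type u} [CommRing A] [CommRing D]
    [Algebra A D] (hD : IsCompleteIntersectionAlgebra A D) : Algebra.FinitePresentation A D := by
  obtain ⟨G, _, _, L, hG, -, ⟨e⟩⟩ := hD
  have : Algebra.FinitePresentation A (G ⧸ Ideal.ofList L) :=
    Algebra.FinitePresentation.quotient (Submodule.fg_span L.finite_toSet)
  exact Algebra.FinitePresentation.equiv e.symm

lemma IsCompleteIntersectionAlgebra.of_algEquiv {A D D' : Type u} [CommRing A] [CommRing D]
    [CommRing D'] [Algebra A D] [Algebra A D'] (e : D ≃ₐ[A] D')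
    (hD : IsCompleteIntersectionAlgebra A D) : IsCompleteIntersectionAlgebra A D' := by
  obtain ⟨G, _, _, L, hG, hL, ⟨e'⟩⟩ := hD
  exact ⟨G, _, _, L, hG, hL, ⟨e.symm.trans e'⟩⟩

lemma IsFilteredLimitOfCI.exists_factorization {A B E : Type u} [CommRing A] [CommRing B]
    [CommRing E] [Algebra A B] [Algebra A E] [Algebra.FinitePresentation A E]
    (h : IsFilteredLimitOfCI A B) (f : E →ₐ[A] B) :
    ∃ (D : Type u) (_ : CommRing D) (_ : Algebra A D) (g : E →ₐ[A] D) (h : D →ₐ[A] B),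
      IsCompleteIntersectionAlgebra A D ∧ h.comp g = f := by
  obtain ⟨D, g, h, hD, hgh⟩ := ObjectProperty.ind.exists_algHom_factorization h f
  exact ⟨D, inferInstance, inferInstance, g, h, hD, hgh⟩

lemma isFilteredLimitOfCI_of_forall_exists_factorization {A B : Type u} [CommRing A] [CommRing B]
    [Algebra A B]
    (hB : ∀ (E : Type u) [CommRing E] [Algebra A E] [Algebra.FinitePresentation A E]
      (f : E →ₐ[A] B), ∃ (D : Type u) (_ : CommRing D) (_ : Algebra A D) (g : E →ₐ[A] D)
        (h : D →ₐ[A] B), IsCompleteIntersectionAlgebra A D ∧ h.comp g = f) :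
    IsFilteredLimitOfCI A B := by
  have : ObjectProperty.IsClosedUnderIsomorphisms
      (fun C : CommAlgCat.{u} A => IsCompleteIntersectionAlgebra A C) :=
    ⟨fun e h ↦ h.of_algEquiv (CommAlgCat.algEquivOfIso e)⟩
  exact ObjectProperty.ind_of_forall_exists_factorization (fun D _ _ h ↦
    IsCompleteIntersectionAlgebra.finitePresentation h) hB

end

/-! ### Separable extensions and generic smoothness -/

section

open MvPolynomial

section Separable

attribute [local instance] MvPolynomial.algebraMvPolynomial

variable {V V' : Type u} [CommRing V] [IsDomain V] [CommRing V'] [Algebra V V']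
  (K : Type v) (K' : Type w) [Field K] [Field K'] [Algebra V K] [IsFractionRing V K]
  [Algebra V' K'] [IsFractionRing V' K'] [Algebra K K'] [Algebra V K']
  [IsScalarTower V K K'] [IsScalarTower V V' K']

include K K' in
/-- If the fraction field of the image of `E` is separably generated and the kernel of `E → V'`
vanishes generically, then `E` is smooth at the kernel. -/
lemma isSmoothAt_ker_of_isSeparableFieldExtension (hsep : IsSeparableFieldExtension K K')
    {E : Type u} [CommRing E] [Algebra V E] [Algebra.FiniteType V E] (f : E →ₐ[V] V')
    (hf : ∀ x, f x = 0 → ∃ s : V, s ≠ 0 ∧ algebraMap V E s * x = 0)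
    [(RingHom.ker f).IsPrime] : Algebra.IsSmoothAt V (RingHom.ker f) := by
  obtain ⟨n, π, hπ⟩ := Algebra.FiniteType.iff_quotient_mvPolynomial''.mp ‹Algebra.FiniteType V E›
  let g : E →ₐ[V] K' := (IsScalarTower.toAlgHom V V' K').comp f
  have hg (x : E) : g x = 0 ↔ f x = 0 :=
    map_eq_zero_iff _ (IsFractionRing.injective V' K')
  let ξ : Fin n → K' := fun i ↦ g (π (X i))
  let L : IntermediateField K K' := IntermediateField.adjoin K (Set.range ξ)
  have hgπ (p) : g (π p) = aeval ξ p := by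
    have : g.comp π = aeval ξ := by
      ext i
      simp [ξ]
    exact congr($this p)
  have hgL (x : E) : g x ∈ L := by
    obtain ⟨p, rfl⟩ := hπ x
    rw [hgπ, ← aeval_map_algebraMap K]
    exact IntermediateField.algebra_adjoin_le_adjoin K _
      (Algebra.adjoin_range_eq_range_aeval K ξ ▸ ⟨_, rfl⟩)
  obtain ⟨s, hs, hsL⟩ := hsep L (IntermediateField.fg_adjoin_of_finite (Set.finite_range ξ))
  have hKL : Algebra.FormallySmooth K L := by
    have : Algebra.IsSeparable
        (IntermediateField.adjoin K (Set.range ((↑) : s → L))) L := by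
      rw [Subtype.range_coe]
      exact hsL
    exact .of_algebraicIndependent_of_isSeparable hs.1
  have hVK : Algebra.FormallySmooth V K := .of_isLocalization (nonZeroDivisors V)
  have hVL : Algebra.FormallySmooth V L := .comp V K L
  let ψ : E →+* L := (g : E →+* K').codRestrict L.toSubring hgL
  have hψ (x : E) : (ψ x : K') = g x := rfl
  let _ : Algebra E L := ψ.toAlgebra
  have : IsScalarTower V E L := .of_algebraMap_eq fun r ↦ Subtype.ext (g.commutes r).symm
  have hsurj (p : MvPolynomial (Fin n) K) : ∃ (r : V) (q : MvPolynomial (Fin n) V), r ≠ 0 ∧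
      algebraMap V K' r * aeval ξ p = aeval ξ q := by
    obtain ⟨⟨q, ⟨_, ⟨r, hr, rfl⟩⟩⟩, hq⟩ := IsLocalization.surj
      ((nonZeroDivisors V).map (C (σ := Fin n))) p
    refine ⟨r, q, nonZeroDivisors.ne_zero hr, ?_⟩
    have := congrArg (aeval ξ) hq
    rw [MvPolynomial.algebraMap_def, aeval_map_algebraMap, map_C, map_mul, aeval_C,
      ← IsScalarTower.algebraMap_apply] at this
    rw [← this, mul_comm]
  have hinj : Function.Injective (algebraMap V K') := by
    rw [IsScalarTower.algebraMap_eq V K K']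
    exact (algebraMap K K').injective.comp (IsFractionRing.injective V K)
  have hgr (r : V) (hr : r ≠ 0) : g (algebraMap V E r) ≠ 0 := by
    rw [g.commutes]
    exact (map_ne_zero_iff _ hinj).mpr hr
  -- `L` is the fraction field of the image of `E`, with coefficients from `K` cleared into `V`. By
  -- `hf`, an element of the kernel is killed by a nonzero element of `V`, which lies outside the
  -- kernel; so the local ring of `E` there is the field `L`, formally smooth over `V`.
  have hloc : IsLocalization (RingHom.ker f).primeCompl L := by
    refine ⟨fun x ↦ ?_, fun z ↦ ?_, fun {x y} h ↦ ?_⟩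
    · refine IsUnit.mk0 _ fun h ↦ x.2 ?_
      exact (hg _).mp (congrArg Subtype.val h)
    · obtain ⟨p, q, hpq⟩ := (IntermediateField.mem_adjoin_range_iff K ξ z.1).mp z.2
      obtain ⟨a, p', ha, hp'⟩ := hsurj p
      obtain ⟨b, q', hb, hq'⟩ := hsurj q
      by_cases hq0 : aeval ξ q = 0
      · refine ⟨⟨0, 1⟩, ?_⟩
        rw [hq0, div_zero] at hpq
        have : z = 0 := Subtype.ext hpq
        simp [this]
      · refine ⟨⟨algebraMap V E b * π p', ⟨algebraMap V E a * π q', ?_⟩⟩, Subtype.ext ?_⟩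
        · change ¬ f _ = 0
          rw [← hg, map_mul, hgπ, ← hq']
          exact mul_ne_zero (hgr a ha) (mul_ne_zero ((map_ne_zero_iff _ hinj).mpr hb) hq0)
        · change z.1 * g (algebraMap V E a * π q') = g (algebraMap V E b * π p')
          rw [map_mul, map_mul, hgπ, hgπ, g.commutes, g.commutes, ← hp', ← hq', hpq]
          field_simp
    · have h0 : f (x - y) = 0 := by
        rw [← hg, map_sub, sub_eq_zero]
        exact congrArg Subtype.val h
      obtain ⟨s, hs0, hs⟩ := hf _ h0
      refine ⟨⟨algebraMap V E s, fun h ↦ hgr s hs0 ((hg _).mpr h)⟩, ?_⟩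
      rw [mul_sub, sub_eq_zero] at hs
      exact hs
  exact Algebra.FormallySmooth.of_equiv
    ((IsLocalization.algEquiv (RingHom.ker f).primeCompl L
      (Localization.AtPrime (RingHom.ker f))).restrictScalars V)

include K K' in
/-- If `K' / K` is separable, each morphism from a finitely presented algebra to `V'` factors
through a finitely presented algebra which is smooth at the kernel. -/
theorem exists_isSmoothAt_of_isSeparableFieldExtension [IsDomain V']
    (hsep : IsSeparableFieldExtension K K')
    {E : Type u} [CommRing E] [Algebra V E] [Algebra.FinitePresentation V E] (f : E →ₐ[V] V') :
    ∃ (E' : Type u) (_ : CommRing E') (_ : Algebra V E') (g : E →ₐ[V] E') (f' : E' →ₐ[V] V')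
      (_ : (RingHom.ker f').IsPrime), Algebra.FinitePresentation V E' ∧
      Algebra.IsSmoothAt V (RingHom.ker f') ∧ f'.comp g = f := by
  classical
  obtain ⟨n, π, hπ, hfg⟩ := Algebra.FinitePresentation.out (R := V) (A := E)
  let φ : MvPolynomial (Fin n) V →ₐ[V] V' := f.comp π
  let κ : MvPolynomial (Fin n) V →+* MvPolynomial (Fin n) K := algebraMap _ _
  -- The kernel need not be finitely generated over `V`, but it generates a finitely generated ideal
  -- over the noetherian ring `K[X]`. Imposing finitely many generators, chosen in the kernel
  -- itself, makes the remaining kernel `V`-torsion.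
  obtain ⟨T, hT, hT'⟩ := (Submodule.fg_span_iff_fg_span_finset_subset
    (R := MvPolynomial (Fin n) K) (κ '' RingHom.ker φ)).mp (IsNoetherian.noetherian _)
  obtain ⟨T₀, hT₀, rfl⟩ := Finset.subset_set_image_iff.mp hT
  let I : Ideal (MvPolynomial (Fin n) V) := RingHom.ker π.toRingHom ⊔ Ideal.span T₀
  have hIφ : ∀ x ∈ I, φ x = 0 := by
    have : I ≤ RingHom.ker φ := by
      refine sup_le (fun x hx ↦ ?_) (Ideal.span_le.mpr hT₀)
      have : π x = 0 := hx
      rw [RingHom.mem_ker, AlgHom.comp_apply, this, map_zero]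
    exact fun x hx ↦ this hx
  have hφI (x) (hx : φ x = 0) : ∃ s : V, s ≠ 0 ∧ C s * x ∈ I := by
    have h1 : κ x ∈ (Ideal.span (T₀ : Set (MvPolynomial (Fin n) V))).map κ := by
      rw [Ideal.map_span]
      rw [Finset.coe_image] at hT'
      exact hT'.le (Submodule.subset_span ⟨x, hx, rfl⟩)
    obtain ⟨_, ⟨s, hs, rfl⟩, h2⟩ := (IsLocalization.algebraMap_mem_map_algebraMap_iff
      ((nonZeroDivisors V).map (C (σ := Fin n))) _ _ _).mp h1
    exact ⟨s, nonZeroDivisors.ne_zero hs, Ideal.mem_sup_right h2⟩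
  let f' : MvPolynomial (Fin n) V ⧸ I →ₐ[V] V' := Ideal.Quotient.liftₐ I φ hIφ
  have hprime : (RingHom.ker f').IsPrime := RingHom.ker_isPrime f'
  have hfp : Algebra.FinitePresentation V (MvPolynomial (Fin n) V ⧸ I) :=
    Algebra.FinitePresentation.quotient (Submodule.FG.sup hfg (Submodule.fg_span T₀.finite_toSet))
  have hle : RingHom.ker π.toRingHom ≤ RingHom.ker (Ideal.Quotient.mkₐ V I).toRingHom :=
    fun x hx ↦ Ideal.Quotient.eq_zero_iff_mem.mpr (Ideal.mem_sup_left hx)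
  refine ⟨MvPolynomial (Fin n) V ⧸ I, inferInstance, inferInstance,
    AlgHom.liftOfSurjective π hπ (Ideal.Quotient.mkₐ V I) hle, f', hprime, hfp, ?_, ?_⟩
  · refine isSmoothAt_ker_of_isSeparableFieldExtension K K' hsep f' fun x hx ↦ ?_
    obtain ⟨x, rfl⟩ := Ideal.Quotient.mk_surjective x
    obtain ⟨s, hs, hsx⟩ := hφI x hx
    exact ⟨s, hs, Ideal.Quotient.eq_zero_iff_mem.mpr hsx⟩
  · ext x
    obtain ⟨p, rfl⟩ := hπ x
    exact congrArg f' (AlgHom.liftOfSurjective_apply π hπ (Ideal.Quotient.mkₐ V I) hle p)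

end Separable

end

/-! ### Permanence properties of complete intersections -/

namespace IsCompleteIntersectionAlgebra

lemma of_smooth {A G : Type u} [CommRing A] [CommRing G] [Algebra A G] [Algebra.Smooth A G]
    [Nontrivial G] : IsCompleteIntersectionAlgebra A G := by
  refine ⟨G, inferInstance, inferInstance, [], inferInstance, ⟨.nil G G, ?_⟩, ⟨?_⟩⟩
  · rw [Ideal.ofList_nil, Submodule.bot_smul]
    exact top_ne_bot
  · exact (AlgEquiv.quotientBot A G).symm.trans
      (Ideal.quotientEquivAlgOfEq A Ideal.ofList_nil.symm)

lemma trans {A B D : Type u} [CommRing A] [CommRing B] [CommRing D] [Algebra A B] [Algebra B D]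
    [Algebra A D] [IsScalarTower A B D] [Algebra.Smooth A B]
    (hD : IsCompleteIntersectionAlgebra B D) : IsCompleteIntersectionAlgebra A D := by
  obtain ⟨G, _, _, L, hG, hL, ⟨e⟩⟩ := hD
  let _ : Algebra A G := ((algebraMap B G).comp (algebraMap A B)).toAlgebra
  have : IsScalarTower A B G := .of_algebraMap_eq fun _ ↦ rfl
  exact ⟨G, inferInstance, inferInstance, L, .comp A B G, hL, ⟨e.restrictScalars A⟩⟩

open Polynomial RingTheory.Sequence in
attribute [local instance] Polynomial.algebra in
/-- A complete intersection over `A` is a complete intersection over `A[X]`, for each choice of the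
image of `X`. -/
lemma polynomial {A D : Type u} [CommRing A] [CommRing D] [Algebra A D] [Algebra A[X] D]
    [IsScalarTower A A[X] D] (hD : IsCompleteIntersectionAlgebra A D) :
    IsCompleteIntersectionAlgebra A[X] D := by
  obtain ⟨G, _, _, L, hG, hL, ⟨e⟩⟩ := hD
  let π : G →ₐ[A] D := (e.symm : (G ⧸ Ideal.ofList L) →ₐ[A] D).comp (Ideal.Quotient.mkₐ A _)
  have hπ : Function.Surjective π := e.symm.surjective.comp Ideal.Quotient.mk_surjective
  have hπL (s : G) : π s = 0 ↔ s ∈ Ideal.ofList L := by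
    rw [← Ideal.Quotient.eq_zero_iff_mem]
    exact map_eq_zero_iff _ e.symm.injective
  obtain ⟨δ, hδ⟩ := hπ (algebraMap A[X] D X)
  have hsm : Algebra.Smooth A[X] G[X] :=
    .of_equiv (Algebra.IsPushout.equiv A A[X] G G[X])
  let I : Ideal G[X] := Ideal.ofList (L.map C)
  have hI (p : G[X]) : p ∈ I ↔ p.map (Ideal.Quotient.mk (Ideal.ofList L)) = 0 := by
    have h := ker_mapRingHom (Ideal.Quotient.mk (Ideal.ofList L))
    rw [Ideal.mk_ker, Ideal.map_ofList] at h
    change p ∈ Ideal.ofList (L.map C) ↔ _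
    rw [← h]
    rfl
  let θ : G[X] →+* D := eval₂RingHom (π : G →+* D) (algebraMap A[X] D X)
  have hθC (s : G) : θ (C s) = π s := eval₂_C _ _
  have hθX : θ X = algebraMap A[X] D X := eval₂_X _ _
  let θ' : G[X] →ₐ[A[X]] D := { θ with
    commutes' := by
      have : θ.comp (algebraMap A[X] G[X]) = algebraMap A[X] D := by
        refine Polynomial.ringHom_ext (fun a ↦ ?_) ?_
        · have h1 : algebraMap A[X] G[X] (C a) = C (algebraMap A G a) := map_C _
          rw [RingHom.comp_apply, h1, hθC, π.commutes, IsScalarTower.algebraMap_apply A A[X] D]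
          rfl
        · have h1 : algebraMap A[X] G[X] X = X := map_X _
          rw [RingHom.comp_apply, h1, hθX]
      exact fun p ↦ congr($this p) }
  have hθ'surj : Function.Surjective θ' := fun d ↦ by
    obtain ⟨s, rfl⟩ := hπ d
    exact ⟨C s, hθC s⟩
  -- With `δ` a lift of the image of `X`, the algebra `D` is the quotient of `G[X]` by `L` and `X -
  -- δ`. A monic polynomial stays a nonzerodivisor over every quotient of `G`, so the sequence
  -- remains regular.
  have hmonic : (X - C δ : G[X]).Monic := monic_X_sub_C δ
  have hker : RingHom.ker θ' = Ideal.ofList (L.map C ++ [X - C δ]) := by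
    rw [Ideal.ofList_append, Ideal.ofList_singleton]
    apply le_antisymm
    · intro p hp
      have h1 := modByMonic_add_div p (X - C δ)
      rw [modByMonic_X_sub_C_eq_C_eval] at h1
      have h2 : θ (C (p.eval δ)) = 0 := by
        have h3 : θ p = 0 := hp
        rw [← h1, map_add, map_mul, map_sub, hθX, hθC δ, hδ, sub_self, zero_mul, add_zero] at h3
        exact h3
      rw [hθC, hπL] at h2
      rw [← h1]
      refine add_mem (Ideal.mem_sup_left ?_) (Ideal.mem_sup_right
        (Ideal.mem_span_singleton.mpr ⟨_, rfl⟩))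
      rw [← Ideal.map_ofList]
      exact Ideal.mem_map_of_mem _ h2
    · refine sup_le (Ideal.span_le.mpr ?_) ((Ideal.span_singleton_le_iff_mem _).mpr ?_)
      · rintro _ hs
        obtain ⟨s, hs', rfl⟩ := List.mem_map.mp hs
        change θ (C s) = 0
        rw [hθC, hπL]
        exact Ideal.subset_span hs'
      · change θ (X - C δ) = 0
        rw [map_sub, hθX, hθC, hδ, sub_self]
  have hD : Nontrivial D := by
    have : Nontrivial (G ⧸ Ideal.ofList L) := by
      rw [Ideal.Quotient.nontrivial_iff]
      have := hL.2
      rw [smul_eq_mul, Ideal.mul_top] at this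
      exact this.symm
    exact e.toEquiv.nontrivial
  refine ⟨G[X], inferInstance, inferInstance, L.map C ++ [X - C δ], hsm, ⟨?_, ?_⟩,
    ⟨((Ideal.quotientKerAlgEquivOfSurjective hθ'surj).symm.trans
      (Ideal.quotientEquivAlgOfEq A[X] hker))⟩⟩
  · rw [isWeaklyRegular_append_iff]
    refine ⟨?_, ?_⟩
    · exact hL.1.of_flat (S := G[X])
    · rw [isWeaklyRegular_singleton_iff, isSMulRegular_quotient_iff_mem_of_smul_mem]
      intro p hp
      rw [smul_eq_mul, smul_eq_mul, Ideal.mul_top] at hp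
      rw [smul_eq_mul, Ideal.mul_top]
      rw [hI, Polynomial.map_mul] at hp
      exact (hI p).mpr ((hmonic.map _).mul_right_eq_zero_iff.mp hp)
  · rw [smul_eq_mul, Ideal.mul_top, ← hker]
    exact (RingHom.ker_ne_top _).symm

end IsCompleteIntersectionAlgebra

/-- Factorization through complete intersections over `A'` of morphisms from finitely presented
`A`-algebras. -/
lemma IsFilteredLimitOfCI.exists_factorization_of_isScalarTower {A A' B E : Type u} [CommRing A]
    [CommRing A'] [CommRing B] [CommRing E] [Algebra A A'] [Algebra A' B] [Algebra A B]
    [IsScalarTower A A' B] [Algebra A E] [Algebra.FinitePresentation A E]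
    (hB : IsFilteredLimitOfCI A' B) (f : E →ₐ[A] B) :
    ∃ (D : Type u) (_ : CommRing D) (_ : Algebra A' D) (_ : Algebra A D)
      (_ : IsScalarTower A A' D) (g : E →ₐ[A] D) (h : D →ₐ[A'] B),
      IsCompleteIntersectionAlgebra A' D ∧ ∀ x, h (g x) = f x := by
  -- Applied to the base change of `E` to `A'`, which is finitely presented over `A'`.
  obtain ⟨D, _, _, g, h, hD, hgh⟩ := hB.exists_factorization
    (Algebra.TensorProduct.lift (Algebra.ofId A' B) f fun _ _ ↦ Commute.all _ _)
  let _ : Algebra A D := ((algebraMap A' D).comp (algebraMap A A')).toAlgebra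
  have : IsScalarTower A A' D := .of_algebraMap_eq fun _ ↦ rfl
  refine ⟨D, inferInstance, inferInstance, inferInstance, inferInstance,
    (g.restrictScalars A).comp Algebra.TensorProduct.includeRight, h, hD, fun x ↦ ?_⟩
  have := congr($hgh (Algebra.TensorProduct.includeRight x))
  refine this.trans ?_
  simp

/-! ### Passage through the completions, and the theorem -/

namespace ValRing

variable {V V' : Type u} [CommRing V] [IsDomain V] [ValuationRing V]
  [CommRing V'] [IsDomain V'] [ValuationRing V'] [Algebra V V']

noncomputable instance (V : Type u) [CommRing V] [IsDomain V] [ValuationRing V] :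
    Algebra V (Completion V) := (toCompletion V).toAlgebra

open MvPolynomial in
/-- A solution in `V'` of a system of equations over `R` yields a solution in a complete
intersection over the completion of `V`, with the same image modulo `c`. -/
lemma exists_solution_of_isFilteredLimitOfCI (hcont : IsContinuousExtension V V')
    (hlim : letI : Algebra (Completion V) (Completion V') := (completionMap hcont).toAlgebra
      IsFilteredLimitOfCI (Completion V) (Completion V'))
    {R : Type u} [CommRing R] [Algebra V R] [Algebra.FinitePresentation V R] [Algebra R V']
    [IsScalarTower V R V'] {ι κ : Type} [Finite ι] [Finite κ] (p : κ → MvPolynomial ι R)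
    (x : ι → V') (hx : ∀ k, aeval x (p k) = 0) {c : V'} (hc : c ≠ 0) :
    ∃ (D : Type u) (_ : CommRing D) (_ : Algebra (Completion V) D) (_ : Algebra R D)
      (y : ι → D) (θ : D →ₐ[R] V' ⧸ Ideal.span {c}),
      IsCompleteIntersectionAlgebra (Completion V) D ∧
      (∀ r : V, algebraMap R D (algebraMap V R r) =
        algebraMap (Completion V) D (algebraMap V (Completion V) r)) ∧
      (∀ k, aeval y (p k) = 0) ∧ ∀ i, θ (y i) = Ideal.Quotient.mk _ (x i) := by
  let _ : Algebra (Completion V) (Completion V') := (completionMap hcont).toAlgebra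
  let _ : Algebra V (Completion V') := ((toCompletion V').comp (algebraMap V V')).toAlgebra
  have : IsScalarTower V (Completion V) (Completion V') :=
    .of_algebraMap_eq fun r ↦ (completionMap_toCompletion hcont r).symm
  let I : Ideal (MvPolynomial ι R) := Ideal.span (Set.range p)
  let E := MvPolynomial ι R ⧸ I
  have hI : ∀ q ∈ I, aeval x q = 0 := by
    have : I ≤ RingHom.ker (aeval (R := R) x) := by
      rw [Ideal.span_le]
      rintro _ ⟨k, rfl⟩
      exact hx k
    exact fun q hq ↦ this hq
  have : Algebra.FinitePresentation R E :=
    Algebra.FinitePresentation.quotient (Submodule.fg_span (Set.finite_range p))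
  have : Algebra.FinitePresentation V E := .trans V R E
  let f : E →ₐ[R] V' := Ideal.Quotient.liftₐ I (aeval x) hI
  let j : V' →ₐ[V] Completion V' := { toCompletion V' with commutes' := fun _ ↦ rfl }
  obtain ⟨D, _, _, _, _, g, h, hD, hgh⟩ := hlim.exists_factorization_of_isScalarTower
    (j.comp (f.restrictScalars V))
  have hgh' (z : E) : h (g z) = toCompletion V' (f z) := hgh z
  obtain ⟨ρ, hρ⟩ := exists_residue V' hc
  -- `R` acts on `D` through `E`, not through the completion of `V`. The two structures agree on
  -- `V`, which is all that can be asked when `R` is `V[X]`.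
  let _ : Algebra R D := ((g : E →+* D).comp (algebraMap R E)).toAlgebra
  have hVD (r : V) : algebraMap R D (algebraMap V R r) =
      algebraMap (Completion V) D (algebraMap V (Completion V) r) := by
    change g (algebraMap R E (algebraMap V R r)) = _
    rw [← IsScalarTower.algebraMap_apply, g.commutes, ← IsScalarTower.algebraMap_apply]
  let gR : E →ₐ[R] D := { (g : E →+* D) with commutes' := fun _ ↦ rfl }
  let θ : D →ₐ[R] V' ⧸ Ideal.span {c} := { ρ.comp (h : D →+* Completion V') with
    commutes' := fun r ↦ by
      change ρ (h (g (algebraMap R E r))) = _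
      rw [hgh', hρ, f.commutes]
      rfl }
  refine ⟨D, inferInstance, inferInstance, inferInstance,
    fun i ↦ gR (Ideal.Quotient.mk I (X i)), θ, hD, hVD, fun k ↦ ?_, fun i ↦ ?_⟩
  · have h1 := algHom_aeval (gR.comp (Ideal.Quotient.mkₐ R I)) X (p k)
    rw [aeval_X_left_apply] at h1
    refine h1.symm.trans ?_
    change gR (Ideal.Quotient.mk I (p k)) = 0
    have h2 : p k ∈ I := Ideal.subset_span ⟨k, rfl⟩
    rw [Ideal.Quotient.eq_zero_iff_mem.mpr h2, map_zero]
  · change ρ (h (g _)) = _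
    rw [hgh', hρ]
    exact congrArg _ (aeval_X x i)

/-- The factorization for a morphism whose source is smooth at the kernel. -/
theorem exists_factorization_of_isSmoothAt (hinj : Function.Injective (algebraMap V V'))
    (hcont : IsContinuousExtension V V')
    (hlim : letI : Algebra (Completion V) (Completion V') := (completionMap hcont).toAlgebra
      IsFilteredLimitOfCI (Completion V) (Completion V'))
    {E : Type u} [CommRing E] [Algebra V E] [Algebra.FinitePresentation V E] (f : E →ₐ[V] V')
    [(RingHom.ker f).IsPrime] [Algebra.IsSmoothAt V (RingHom.ker f)] :
    ∃ (D : Type u) (_ : CommRing D) (_ : Algebra V D) (g : E →ₐ[V] D) (h : D →ₐ[V] V'),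
      IsCompleteIntersectionAlgebra V D ∧ h.comp g = f := by
  obtain ⟨s, hs, _⟩ := Algebra.IsSmoothAt.exists_notMem_isStandardSmooth V (RingHom.ker f)
  have hs0 : f s ≠ 0 := hs
  -- In the remaining case every `t` in `V'` divisible by `f s` is a nonunit, as Newton's lemma
  -- requires.
  by_cases hu : IsUnit (f s)
  · let h : Localization.Away s →ₐ[V] V' :=
      IsLocalization.liftAlgHom (M := Submonoid.powers s) (f := f) (by
        rintro ⟨_, n, rfl⟩
        exact (map_pow f s n).symm ▸ hu.pow n)
    have : Nontrivial (Localization.Away s) := h.toRingHom.domain_nontrivial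
    exact ⟨Localization.Away s, inferInstance, inferInstance, IsScalarTower.toAlgHom V E _, h,
      .of_smooth, AlgHom.ext fun x ↦ IsLocalization.lift_eq _ x⟩
  obtain ⟨a, ha, H⟩ := exists_jacobianData f hs0
  by_cases hV : IsField V
  · open Polynomial in
    -- A field has no nonzero nonunits; the variable plays the role of `t`, with image the nonzero
    -- nonunit `a * f s`.
    let _ : Algebra V[X] V' := (aeval (a * f s)).toRingHom.toAlgebra
    have hX : algebraMap V[X] V' X = a * f s := aeval_X _
    have : IsScalarTower V V[X] V' := .of_algebraMap_eq fun r ↦ (aeval_C _ r).symm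
    obtain ⟨n, ι, σ, κ, _, _, _, _, d, x, hn, hg, he, hD⟩ := H V[X] X
      (mem_nonZeroDivisors_of_ne_zero X_ne_zero) (hX ▸ dvd_mul_right _ _)
    have hT0 : algebraMap V[X] V' (X ^ n) ≠ 0 := by
      rw [map_pow, hX]
      exact pow_ne_zero n (mul_ne_zero ha hs0)
    have hTu : ¬ IsUnit (algebraMap V[X] V' (X ^ n)) := by
      rw [map_pow, hX, isUnit_pow_iff hn]
      exact fun h ↦ hu (isUnit_of_mul_isUnit_right h)
    have hnzd : ∀ r : V[X], (X ^ n) ^ 3 * r = 0 → r = 0 := fun r hr ↦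
      (mul_eq_zero.mp hr).resolve_left (pow_ne_zero _ (pow_ne_zero _ X_ne_zero))
    have : Algebra.FinitePresentation V V[X] := inferInstance
    obtain ⟨D, _, _, _, y, θ, hDci, hVD, hy, hθ⟩ := exists_solution_of_isFilteredLimitOfCI
      hcont hlim (Sum.elim d.g d.e) x (Sum.rec hg he)
      (c := algebraMap V[X] V' ((X ^ n) ^ 3)) (by rw [map_pow]; exact pow_ne_zero 3 hT0)
    let _ : Algebra V D := ((algebraMap V[X] D).comp (algebraMap V V[X])).toAlgebra
    have : IsScalarTower V V[X] D := .of_algebraMap_eq fun _ ↦ rfl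
    have : IsScalarTower V (Completion V) D := .of_algebraMap_eq hVD
    have : Algebra.Smooth V (Completion V) := .of_equiv
      (AlgEquiv.ofBijective (Algebra.ofId V (Completion V)) (bijective_toCompletion V hV))
    have hDci' : IsCompleteIntersectionAlgebra V[X] D := .polynomial (.trans hDci)
    obtain ⟨D', _, _, y', h', hD', hxy, hey⟩ := d.exists_completeIntersection hnzd hT0 hTu x hg
      (Ideal.Quotient.mk _) (isRegularQuotient_mk hnzd) (fun _ ↦ rfl) hDci' y
      (fun j ↦ hy (Sum.inl j)) (fun k ↦ hy (Sum.inr k)) θ hθ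
    let _ : Algebra V D' := ((algebraMap V[X] D').comp (algebraMap V V[X])).toAlgebra
    have : IsScalarTower V V[X] D' := .of_algebraMap_eq fun _ ↦ rfl
    have : Algebra.Smooth V V[X] := ⟨inferInstance, inferInstance⟩
    obtain ⟨g, hg⟩ := hD D' h' y' hxy hey
    exact ⟨D', inferInstance, inferInstance, g, h'.restrictScalars V, .trans hD',
      AlgHom.ext hg⟩
  -- Divisibility by `a` clears denominators; divisibility by `f s` makes `c` a nonunit in `V'`.
  · obtain ⟨c, hc0, hc⟩ := hcont.exists_dvd hV (mul_ne_zero ha hs0)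
    have hcn : c ∈ nonZeroDivisors V := mem_nonZeroDivisors_of_ne_zero hc0
    obtain ⟨n, ι, σ, κ, _, _, _, _, d, x, hn, hg, he, hD⟩ := H V c hcn
      ((dvd_mul_right _ _).trans hc)
    have hT0 : algebraMap V V' (c ^ n) ≠ 0 :=
      (map_ne_zero_iff _ hinj).mpr (pow_ne_zero n hc0)
    have hTu : ¬ IsUnit (algebraMap V V' (c ^ n)) := by
      rw [map_pow, isUnit_pow_iff hn]
      exact fun h ↦ hu (isUnit_of_mul_isUnit_right (isUnit_of_dvd_unit hc h))
    have hC0 : (c ^ n) ^ 3 ≠ 0 := pow_ne_zero 3 (pow_ne_zero n hc0)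
    have hnzd : ∀ r : V, (c ^ n) ^ 3 * r = 0 → r = 0 := fun r hr ↦
      (mul_eq_zero.mp hr).resolve_left hC0
    obtain ⟨D, _, _, _, y, θ, hDci, hVD, hy, hθ⟩ := exists_solution_of_isFilteredLimitOfCI
      hcont hlim (Sum.elim d.g d.e) x (Sum.rec hg he)
      (c := algebraMap V V' ((c ^ n) ^ 3)) (by rw [map_pow]; exact pow_ne_zero 3 hT0)
    obtain ⟨ρ, hρ, hρreg⟩ := exists_isRegularQuotient_residue V hV hC0
    have : IsScalarTower V (Completion V) D := .of_algebraMap_eq hVD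
    obtain ⟨D', _, _, y', h', hD', hxy, hey⟩ := d.exists_completeIntersection hnzd hT0 hTu x hg
      ρ hρreg hρ hDci y (fun j ↦ hy (Sum.inl j)) (fun k ↦ hy (Sum.inr k)) θ hθ
    obtain ⟨g, hg⟩ := hD D' h' y' hxy hey
    exact ⟨D', inferInstance, inferInstance, g, h', hD', AlgHom.ext hg⟩

end ValRing

theorem lemma2p10
    (V V' : Type u) [CommRing V] [IsDomain V] [ValuationRing V]
    [CommRing V'] [IsDomain V'] [ValuationRing V']
    -- `V → V'` is an extension of valuation rings: injective and local, i.e. `V = V' ∩ Frac V`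
    [Algebra V V'] (hinj : Function.Injective (algebraMap V V')) [IsLocalHom (algebraMap V V')]
    -- the extension `K → K'` of the fraction fields
    (K : Type v) (K' : Type w) [Field K] [Field K'] [Algebra V K] [IsFractionRing V K]
    [Algebra V' K'] [IsFractionRing V' K'] [Algebra K K'] [Algebra V K']
    [IsScalarTower V K K'] [IsScalarTower V V' K']
    -- the extension of the completions exists and makes the completion of `V'` a filtered limit
    (hcont : ValRing.IsContinuousExtension V V')
    (hlim : letI : Algebra (ValRing.Completion V) (ValRing.Completion V') :=
        (ValRing.completionMap hcont).toAlgebra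
      IsFilteredLimitOfCI (ValRing.Completion V) (ValRing.Completion V')) :
    (IsSeparableFieldExtension K K' → IsFilteredLimitOfCI V V') ∧
    (∀ (E : Type u) [CommRing E] [Algebra V E] [Algebra.FinitePresentation V E]
      (f : E →ₐ[V] V'), (nonSmoothIdeal V E).map f ≠ ⊥ →
      ∃ (D : Type u) (_ : CommRing D) (_ : Algebra V D) (g : E →ₐ[V] D) (h : D →ₐ[V] V'),
        IsCompleteIntersectionAlgebra V D ∧ h.comp g = f) := by
  refine ⟨fun hsep ↦ isFilteredLimitOfCI_of_forall_exists_factorization fun E _ _ _ f ↦ ?_,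
    fun E _ _ _ f hf ↦ ?_⟩
  · obtain ⟨E', _, _, g', f', _, _, _, rfl⟩ :=
      exists_isSmoothAt_of_isSeparableFieldExtension K K' hsep f
    obtain ⟨D, _, _, g, h, hD, hgh⟩ :=
      ValRing.exists_factorization_of_isSmoothAt hinj hcont hlim f'
    exact ⟨D, inferInstance, inferInstance, g.comp g', h, hD, by rw [← AlgHom.comp_assoc, hgh]⟩
  · have hp : (RingHom.ker f).IsPrime := RingHom.ker_isPrime f
    have hsm : Algebra.IsSmoothAt V (RingHom.ker f) := by
      -- If `E` were not smooth at the kernel, all of `nonSmoothIdeal V E` would lie in the kernel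
      -- and its image would be zero.
      by_contra hns
      refine hf (le_bot_iff.mp (Ideal.map_le_iff_le_comap.mpr fun x hx ↦ ?_))
      exact (PrimeSpectrum.mem_vanishingIdeal _ _).mp hx ⟨RingHom.ker f, hp⟩ hns
    exact ValRing.exists_factorization_of_isSmoothAt hinj hcont hlim f
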